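/- Let $B$ be a $\sigma$-unital $C^*$-algebra and let $(X,D)$ be an even unbounded Kasparov module over $B$: $X$ is a countably generated right Hilbert $C^*$-module over $B$ graded by a selfadjoint unitary $\gamma\in\mathbb L(X)$, and $D$ is a selfadjoint and regular unbounded operator on $X$ which is odd ($D\gamma=-\gamma D$) and has compact resolvent, $(D+i)^{-1}\in\mathbb K(X)$. Here $\mathbb L(X)$ denotes the $C^*$-algebra of bounded adjointable operators on $X$ and $\mathbb K(X)$ the closed ideal of compact operators; $\|\cdot\|$ is the operator norm. Let $H\in\mathbb L(X)$ be selfadjoint and invertible with $H\gamma=\gamma H$, and suppose that $H$ is Lipschitz with respect to $D$, i.e. $H(\mathrm{Dom}(D))\subseteq\mathrm{Dom}(D)$ and $[D,H]:\mathrm{Dom}(D)\to X$ extends to an operator $d(H)\in\mathbb L(X)$. Put $g=\|H^{-1}\|^{-1}$. Let $\phi:\mathbb R\to[0,1]$ be a localizing function, i.e. an even continuous $L^1$-function with support contained in $[-1,1]$, with $\phi=1$ on $[-1/2,1/2]$, decreasing on $[0,\infty)$, and such that $p\,\widehat\phi(p)$ is an $L^1$-function, where $\widehat\phi(p)=\frac1{\sqrt{2\pi}}\int\phi(x)e^{-ixp}\,dx$.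 Put $c_\phi=2\|p\,\widehat\phi(p)\|_1/\sqrt{2\pi}$ and, for $\rho>0$, $\Phi_\rho=\phi(D/\rho)$. For $\kappa,\rho>0$ define the spectral localizer $$L_{\kappa,\rho}=\Phi_\rho\gamma H\Phi_\rho+\kappa\,\Phi_{2\rho}D\Phi_{2\rho}-(1-\Phi_{2\rho}^4)^{1/2}\gamma\in\mathbb L(X)$$ and the constant $C_{\kappa,\rho}=\big(\kappa+\frac{c_\phi\|H\|}{\rho}\big)\|d(H)\|$. The pair $(\kappa,\rho)$ is called admissible if $C_{\kappa,\rho}<\min\{g^2,\kappa^2\rho^2/4\}$. For a unital $C^*$-algebra $L$ and a closed $*$-ideal $A\subseteq L$ let $D(L,A)=\{(x,y)\in L\oplus L\mid x-y\in A\}$, and let $K_0^{\mathrm{inv}}(L,A)$ be the abelian group of selfadjoint invertible matrices over $D(L,A)$ (of all sizes, added by direct sum) modulo stable homotopy, i.e. homotopy through selfadjoint invertible matrices after adding matrices of the form $(G,G)$ with $G$ a selfadjoint invertible matrix over $L$. (1) If $\kappa,\rho>0$ and $(\kappa,\rho)$ is admissible, then $L_{\kappa,\rho}$ is invertible, and $(-\gamma,L_{\kappa,\rho})$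 is a selfadjoint invertible element of $D(\mathbb L(X),\mathbb K(X))$ and hence defines a class $[(-\gamma,L_{\kappa,\rho})]$ in $K_0^{\mathrm{inv}}(\mathbb L(X),\mathbb K(X))$. (2) If $\kappa,\rho>0$ satisfy $\kappa\|d(H)\|<g^2$, $\rho\ge 2g/\kappa$ and $\rho>\dfrac{c_\phi\|H\|\,\|d(H)\|}{g^2-\kappa\|d(H)\|}$, then $(\kappa,\rho)$ is admissible. -/

import Mathlib

namespace SpecLoc

open Complex

section Matrices

/-- The set of selfadjoint invertible elements of the matrix algebra `M_ι(R)`; it carries the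
subspace topology coming from entrywise convergence of matrices (for a C⋆-algebra `R` this is
the topology of the C⋆-norm on `M_ι(R)`). -/
abbrev SAInv (R ι : Type*) [Ring R] [StarRing R] [Fintype ι] [DecidableEq ι] :=
  {H : Matrix ι ι R // IsSelfAdjoint H ∧ IsUnit H}

variable {R S ι κ ι' κ' : Type*} [Ring R] [StarRing R] [Ring S] [StarRing S]
  [Fintype ι] [DecidableEq ι] [Fintype κ] [DecidableEq κ]
  [Fintype ι'] [DecidableEq ι'] [Fintype κ'] [DecidableEq κ']

/-- Direct sum of selfadjoint invertible matrices. -/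
def SAInv.sum (H : SAInv R ι) (K : SAInv R κ) : SAInv R (ι ⊕ κ) :=
  ⟨Matrix.fromBlocks H.1 0 0 K.1, by
    have h1 : Matrix.conjTranspose H.1 = H.1 := H.2.1
    have h2 : Matrix.conjTranspose K.1 = K.1 := K.2.1
    change Matrix.conjTranspose _ = _
    rw [Matrix.fromBlocks_conjTranspose, h1, h2]; simp, by
    obtain ⟨u, hu⟩ := H.2.2
    obtain ⟨v, hv⟩ := K.2.2
    refine ⟨⟨Matrix.fromBlocks u 0 0 v, Matrix.fromBlocks (u⁻¹ : (Matrix ι ι R)ˣ) 0 0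
      (v⁻¹ : (Matrix κ κ R)ˣ), ?_, ?_⟩, ?_⟩
    · simp [Matrix.fromBlocks_multiply]
    · simp [Matrix.fromBlocks_multiply]
    · simp [hu, hv]⟩

/-- Relabelling the rows and columns of a selfadjoint invertible matrix. -/
def SAInv.reindex (e : ι ≃ κ) (H : SAInv R ι) : SAInv R κ :=
  ⟨H.1.submatrix e.symm e.symm, by
    have h1 : Matrix.conjTranspose H.1 = H.1 := H.2.1
    change Matrix.conjTranspose _ = _
    rw [Matrix.conjTranspose_submatrix, h1], by
    obtain ⟨u, hu⟩ := H.2.2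
    refine ⟨⟨(u : Matrix ι ι R).submatrix e.symm e.symm,
      ((u⁻¹ : (Matrix ι ι R)ˣ) : Matrix ι ι R).submatrix e.symm e.symm, ?_, ?_⟩, ?_⟩
    · simp [Matrix.submatrix_mul_equiv]
    · simp [Matrix.submatrix_mul_equiv]
    · simp [hu]⟩

/-- Entrywise application of a unital `*`-homomorphism. -/
def SAInv.map (f : R →+* S) (hf : ∀ x, f (star x) = star (f x)) (H : SAInv R ι) : SAInv S ι :=
  ⟨H.1.map f, by
    have h1 : Matrix.conjTranspose H.1 = H.1 := H.2.1
    change Matrix.conjTranspose _ = _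
    rw [← Matrix.conjTranspose_map f (fun x => hf x), h1],
    H.2.2.map (RingHom.mapMatrix f)⟩

/-- The unit matrix. -/
def SAInv.one (R ι : Type*) [Ring R] [StarRing R] [Fintype ι] [DecidableEq ι] : SAInv R ι :=
  ⟨1, IsSelfAdjoint.one _, isUnit_one⟩

variable [TopologicalSpace R]

lemma continuous_smul_matrix {R : Type*} [Ring R] [TopologicalSpace R] [Algebra ℂ R]
    [ContinuousSMul ℂ R] {ι : Type*} {c : ℝ → ℂ} (hc : Continuous c) (M : Matrix ι ι R) :
    Continuous (fun t => c t • M) := by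
  have h := hc.smul (continuous_const (y := M))
  exact h

lemma SAInv.continuous_sum_left (K : SAInv R κ) :
    Continuous (fun H : SAInv R ι => H.sum K) :=
  Continuous.subtype_mk (Continuous.matrix_fromBlocks continuous_subtype_val continuous_const
    continuous_const continuous_const) _

lemma SAInv.continuous_sum_right (H : SAInv R ι) :
    Continuous (fun K : SAInv R κ => H.sum K) :=
  Continuous.subtype_mk (Continuous.matrix_fromBlocks continuous_const continuous_const
    continuous_const continuous_subtype_val) _

lemma SAInv.continuous_reindex (e : ι ≃ κ) : Continuous (SAInv.reindex (R := R) e) :=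
  Continuous.subtype_mk (Continuous.matrix_submatrix continuous_subtype_val _ _) _

/-- Homotopy up to a relabelling of the indices. -/
def SAInv.HomotopicUpToIndex (H : SAInv R ι) (K : SAInv R κ) : Prop :=
  ∃ e : ι ≃ κ, Joined (H.reindex e) K

lemma SAInv.HomotopicUpToIndex.of_joined {H K : SAInv R ι} (h : Joined H K) :
    H.HomotopicUpToIndex K := ⟨Equiv.refl _, h⟩

lemma SAInv.HomotopicUpToIndex.of_reindex (e : ι ≃ κ) (H : SAInv R ι) :
    H.HomotopicUpToIndex (H.reindex e) := ⟨e, Joined.refl _⟩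

lemma SAInv.HomotopicUpToIndex.symm {H : SAInv R ι} {K : SAInv R κ}
    (h : H.HomotopicUpToIndex K) : K.HomotopicUpToIndex H := by
  obtain ⟨e, h⟩ := h
  refine ⟨e.symm, ?_⟩
  have h2 := (h.map (SAInv.continuous_reindex e.symm)).symm
  have : (H.reindex e).reindex e.symm = H := Subtype.ext (by ext; simp [SAInv.reindex])
  rwa [this] at h2

lemma SAInv.HomotopicUpToIndex.trans {H : SAInv R ι} {K : SAInv R κ} {M : SAInv R ι'}
    (h : H.HomotopicUpToIndex K) (h' : K.HomotopicUpToIndex M) : H.HomotopicUpToIndex M := by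
  obtain ⟨e, h⟩ := h
  obtain ⟨e', h'⟩ := h'
  refine ⟨e.trans e', ?_⟩
  have h2 := h.map (SAInv.continuous_reindex e')
  exact Joined.trans (by exact h2) h'

lemma SAInv.HomotopicUpToIndex.sum {H : SAInv R ι} {K : SAInv R κ} {H' : SAInv R ι'}
    {K' : SAInv R κ'} (h : H.HomotopicUpToIndex K) (h' : H'.HomotopicUpToIndex K') :
    (H.sum H').HomotopicUpToIndex (K.sum K') := by
  obtain ⟨e, h⟩ := h
  obtain ⟨e', h'⟩ := h'
  refine ⟨e.sumCongr e', ?_⟩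
  have : (H.sum H').reindex (e.sumCongr e') = (H.reindex e).sum (H'.reindex e') :=
    Subtype.ext (by ext i j; rcases i with i | i <;> rcases j with j | j <;> rfl)
  rw [this]
  exact (h.map (SAInv.continuous_sum_left _)).trans (h'.map (SAInv.continuous_sum_right _))

lemma SAInv.HomotopicUpToIndex.sum_comm (H : SAInv R ι) (K : SAInv R κ) :
    (H.sum K).HomotopicUpToIndex (K.sum H) :=
  ⟨Equiv.sumComm _ _, by
    have : (H.sum K).reindex (Equiv.sumComm _ _) = K.sum H :=
      Subtype.ext (by ext i j; rcases i with i | i <;> rcases j with j | j <;> rfl)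
    rw [this]⟩

lemma SAInv.HomotopicUpToIndex.sum_assoc (H : SAInv R ι) (K : SAInv R κ) (M : SAInv R ι') :
    ((H.sum K).sum M).HomotopicUpToIndex (H.sum (K.sum M)) :=
  ⟨Equiv.sumAssoc _ _ _, by
    have : ((H.sum K).sum M).reindex (Equiv.sumAssoc _ _ _) = H.sum (K.sum M) :=
      Subtype.ext (by
        ext i j
        rcases i with i | i | i <;> rcases j with j | j | j <;> rfl)
    rw [this]⟩

variable [Algebra ℂ R] [StarModule ℂ R] [IsTopologicalRing R] [ContinuousSMul ℂ R]

/-- Conjugation by a selfadjoint unitary does not change the homotopy class. -/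
lemma SAInv.joined_conj (P : Matrix ι ι R) (hP : star P = P) (hPP : P * P = 1)
    (H K : SAInv R ι) (hK : K.1 = P * H.1 * P) : Joined H K := by
  set Q : Matrix ι ι R := (1 / 2 : ℂ) • (1 - P) with hQ
  have hQs : star Q = Q := by
    rw [hQ, star_smul, star_sub, hP, star_one]; simp
  have hQQ : Q * Q = Q := by
    rw [hQ, smul_mul_smul_comm, sub_mul, mul_sub, mul_sub, hPP]
    simp only [one_mul, mul_one]
    rw [show (1 - P - (P - 1) : Matrix ι ι R) = (2 : ℂ) • (1 - P) by
      rw [two_smul]; abel, smul_smul]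
    norm_num
  let U : ℝ → Matrix ι ι R := fun t => 1 + (exp (Real.pi * t * I) - 1) • Q
  have hUs : ∀ t, star (U t) = 1 + (exp (-(Real.pi * t * I)) - 1) • Q := by
    intro t
    simp only [U, star_add, star_one, star_smul, hQs, star_sub]
    congr 3
    change (starRingEnd ℂ) _ = _
    rw [← exp_conj]; simp
  have key : ∀ a b : ℂ, a * b = 1 →
      ((1 : Matrix ι ι R) + (a - 1) • Q) * (1 + (b - 1) • Q) = 1 := by
    intro a b hab
    rw [add_mul, mul_add, mul_add, smul_mul_smul_comm, hQQ]
    simp only [one_mul, mul_one]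
    rw [add_assoc, ← add_smul, ← add_smul,
      show b - 1 + (a - 1 + (a - 1) * (b - 1)) = 0 by linear_combination hab]
    simp
  have h1 : ∀ t : ℝ, exp (Real.pi * t * I) * exp (-(Real.pi * t * I)) = 1 := by
    intro t; rw [← exp_add]; simp
  have hUU : ∀ t, U t * star (U t) = 1 := fun t => by rw [hUs]; exact key _ _ (h1 t)
  have hUU' : ∀ t, star (U t) * U t = 1 := fun t => by
    rw [hUs]; exact key _ _ (by rw [mul_comm]; exact h1 t)
  have hUc : Continuous U := by
    exact continuous_const.add (continuous_smul_matrix (by fun_prop) Q)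
  have hUsc : Continuous (fun t => star (U t)) := by
    simp only [hUs]
    exact continuous_const.add (continuous_smul_matrix (by fun_prop) Q)
  have hmem : ∀ t, IsSelfAdjoint (U t * H.1 * star (U t)) ∧ IsUnit (U t * H.1 * star (U t)) := by
    intro t
    refine ⟨?_, ?_⟩
    · have := H.2.1.conjugate (U t)
      exact this
    · have hu : IsUnit (U t) := ⟨⟨U t, star (U t), hUU t, hUU' t⟩, rfl⟩
      have hu' : IsUnit (star (U t)) := ⟨⟨star (U t), U t, hUU' t, hUU t⟩, rfl⟩
      exact (hu.mul H.2.2).mul hu'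
  refine ⟨⟨⟨fun t => ⟨U t * H.1 * star (U t), hmem t⟩, ?_⟩, ?_, ?_⟩⟩
  · refine Continuous.subtype_mk ?_ _
    exact ((hUc.comp continuous_subtype_val).matrix_mul continuous_const).matrix_mul
      (hUsc.comp continuous_subtype_val)
  · apply Subtype.ext
    simp [U]
  · apply Subtype.ext
    have e1 : U 1 = P := by
      simp only [U]
      rw [show (Real.pi * ((1 : ℝ) : ℂ) * I) = Real.pi * I by simp, exp_pi_mul_I, hQ, smul_smul]
      norm_num
    simp [e1, hP, hK]

/-- Simultaneous permutations of rows and columns do not change the homotopy class. -/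
lemma SAInv.joined_perm (σ : Equiv.Perm ι) (H : SAInv R ι) : Joined H (H.reindex σ) := by
  induction σ using Equiv.Perm.swap_induction_on generalizing H with
  | one =>
    have : H.reindex 1 = H := Subtype.ext (by ext; rfl)
    rw [this]
  | swap_mul f x y hxy ih =>
    refine (ih H).trans ?_
    have e : H.reindex (Equiv.swap x y * f) = (H.reindex f).reindex (Equiv.swap x y) :=
      Subtype.ext (by ext; simp [SAInv.reindex, Equiv.Perm.mul_def])
    rw [e]
    refine SAInv.joined_conj ((1 : Matrix ι ι R).submatrix (Equiv.swap x y) id) ?_ ?_ _ _ ?_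
    · change Matrix.conjTranspose _ = _
      ext i j
      simp only [Matrix.conjTranspose_apply, Matrix.submatrix_apply, Matrix.one_apply, id]
      have : (Equiv.swap x y) j = i ↔ (Equiv.swap x y) i = j := by
        rw [← Equiv.eq_symm_apply, Equiv.symm_swap, eq_comm]
      simp only [this]; split_ifs <;> simp
    · ext i j
      have : ∀ k, (Equiv.swap x y) k = j ↔ k = (Equiv.swap x y) j := fun k => by
        rw [← Equiv.eq_symm_apply, Equiv.symm_swap]
      simp [Matrix.mul_apply, Matrix.one_apply, this]
    · ext i j
      simp only [Matrix.mul_apply, Matrix.submatrix_apply, Matrix.one_apply, id, SAInv.reindex]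
      have : ∀ k, (Equiv.swap x y) k = j ↔ k = (Equiv.swap x y) j := fun k => by
        rw [← Equiv.eq_symm_apply, Equiv.symm_swap]
      simp [this]

lemma SAInv.HomotopicUpToIndex.joined {H : SAInv R ι} {K : SAInv R κ}
    (h : H.HomotopicUpToIndex K) (e : ι ≃ κ) : Joined (H.reindex e) K := by
  obtain ⟨e', h'⟩ := h
  refine Joined.trans ?_ h'
  have : H.reindex e' = (H.reindex e).reindex (e.symm.trans e') :=
    Subtype.ext (by ext; simp [SAInv.reindex])
  rw [this]
  exact SAInv.joined_perm _ _

/-- `H ⊕ (-H⁻¹)` is homotopic to the off-diagonal unit matrix. -/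
lemma SAInv.exists_sum_joined (H : SAInv R ι) :
    ∃ K : SAInv R ι, ∃ M : SAInv R (ι ⊕ ι),
      M.1 = Matrix.fromBlocks 0 1 1 0 ∧ Joined (H.sum K) M := by
  obtain ⟨u, hu⟩ := H.2.2
  set V : Matrix ι ι R := ((u⁻¹ : (Matrix ι ι R)ˣ) : Matrix ι ι R) with hV
  have hHV : H.1 * V = 1 := by rw [← hu]; simp [hV]
  have hVH : V * H.1 = 1 := by rw [← hu]; simp [hV]
  have hHs : Matrix.conjTranspose H.1 = H.1 := H.2.1
  have hVs : Matrix.conjTranspose V = V := by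
    have h1 : Matrix.conjTranspose V * H.1 = 1 := by
      have := congrArg Matrix.conjTranspose hHV
      rwa [Matrix.conjTranspose_mul, hHs, Matrix.conjTranspose_one] at this
    calc Matrix.conjTranspose V = Matrix.conjTranspose V * (H.1 * V) := by rw [hHV, mul_one]
      _ = V := by rw [← mul_assoc, h1, one_mul]
  let F : ℝ → Matrix (ι ⊕ ι) (ι ⊕ ι) R := fun t =>
    Matrix.fromBlocks ((Real.cos t : ℂ) • H.1) ((Real.sin t : ℂ) • 1) ((Real.sin t : ℂ) • 1)
      (-((Real.cos t : ℂ) • V))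
  let G : ℝ → Matrix (ι ⊕ ι) (ι ⊕ ι) R := fun t =>
    Matrix.fromBlocks ((Real.cos t : ℂ) • V) ((Real.sin t : ℂ) • 1) ((Real.sin t : ℂ) • 1)
      (-((Real.cos t : ℂ) • H.1))
  have hcs : ∀ t : ℝ, (Real.cos t : ℂ) * Real.cos t + (Real.sin t : ℂ) * Real.sin t = 1 := by
    intro t
    have := Real.sin_sq_add_cos_sq t
    rw [← ofReal_mul, ← ofReal_mul, ← ofReal_add, ← ofReal_one]
    congr 1; linarith
  have hFG : ∀ t, F t * G t = 1 := by
    intro t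
    simp only [F, G, Matrix.fromBlocks_multiply, smul_mul_smul_comm, hHV, hVH, mul_one, one_mul,
      mul_neg, neg_mul, neg_neg, mul_comm (Real.sin t : ℂ) (Real.cos t : ℂ), ← add_smul, hcs,
      add_comm ((Real.sin t : ℂ) * Real.sin t), one_smul, add_neg_cancel]
    simp
  have hGF : ∀ t, G t * F t = 1 := by
    intro t
    simp only [F, G, Matrix.fromBlocks_multiply, smul_mul_smul_comm, hHV, hVH, mul_one, one_mul,
      mul_neg, neg_mul, neg_neg, mul_comm (Real.sin t : ℂ) (Real.cos t : ℂ), ← add_smul, hcs,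
      add_comm ((Real.sin t : ℂ) * Real.sin t), one_smul, add_neg_cancel]
    simp
  have hFs : ∀ t, IsSelfAdjoint (F t) := by
    intro t
    change Matrix.conjTranspose _ = _
    simp only [F, Matrix.fromBlocks_conjTranspose, Matrix.conjTranspose_smul,
      Matrix.conjTranspose_neg, hHs, hVs, Matrix.conjTranspose_one]
    simp [-ofReal_cos, -ofReal_sin]
  have hFm : ∀ t, IsSelfAdjoint (F t) ∧ IsUnit (F t) := fun t =>
    ⟨hFs t, ⟨⟨F t, G t, hFG t, hGF t⟩, rfl⟩⟩
  have hFc : Continuous F := by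
    refine Continuous.matrix_fromBlocks ?_ ?_ ?_ (Continuous.neg ?_)
    all_goals exact continuous_smul_matrix (by fun_prop) _
  have hK : IsSelfAdjoint (-V) ∧ IsUnit (-V) :=
    ⟨by change Matrix.conjTranspose _ = _; rw [Matrix.conjTranspose_neg, hVs],
      (u⁻¹).isUnit.neg⟩
  refine ⟨⟨-V, hK⟩, ⟨F (Real.pi / 2), hFm _⟩, ?_, ?_⟩
  · simp [F]
  · refine ⟨⟨⟨fun t => ⟨F (Real.pi / 2 * t), hFm _⟩, ?_⟩, ?_, ?_⟩⟩
    · exact Continuous.subtype_mk (hFc.comp (by fun_prop)) _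
    · apply Subtype.ext
      simp [F, SAInv.sum]
    · apply Subtype.ext
      simp

end Matrices

section RelativeKTheory

/-- A norm-closed two-sided `*`-ideal of a unital C⋆-algebra. -/
structure ClosedStarIdeal (L : Type*) [CStarAlgebra L] extends Submodule ℂ L where
  mul_mem_left' : ∀ (x : L) {a : L}, a ∈ carrier → x * a ∈ carrier
  mul_mem_right' : ∀ (x : L) {a : L}, a ∈ carrier → a * x ∈ carrier
  star_mem' : ∀ {a : L}, a ∈ carrier → star a ∈ carrier
  isClosed' : IsClosed carrier

variable {L : Type*} [CStarAlgebra L]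

/-- The C⋆-algebra `D(L, A) = {(x, y) ∈ L ⊕ L | x - y ∈ A}`. -/
def relDouble (A : ClosedStarIdeal L) : StarSubalgebra ℂ (L × L) where
  carrier := {p | p.1 - p.2 ∈ A.toSubmodule}
  mul_mem' := by
    rintro ⟨x, y⟩ ⟨x', y'⟩ h h'
    have e : x * x' - y * y' = x * (x' - y') + (x - y) * y' := by
      rw [mul_sub, sub_mul]; abel
    change x * x' - y * y' ∈ A.toSubmodule
    rw [e]
    exact A.toSubmodule.add_mem (A.mul_mem_left' _ h') (A.mul_mem_right' _ h)
  add_mem' := by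
    rintro ⟨x, y⟩ ⟨x', y'⟩ h h'
    have e : (x + x') - (y + y') = (x - y) + (x' - y') := by abel
    change (x + x') - (y + y') ∈ A.toSubmodule
    rw [e]
    exact A.toSubmodule.add_mem h h'
  algebraMap_mem' := by
    intro r
    change algebraMap ℂ L r - algebraMap ℂ L r ∈ A.toSubmodule
    rw [sub_self]
    exact A.toSubmodule.zero_mem
  star_mem' := by
    rintro ⟨x, y⟩ h
    change star x - star y ∈ A.toSubmodule
    rw [← star_sub]
    exact A.star_mem' h

/-- The diagonal unital `*`-homomorphism `Δ : L → D(L, A)`, `Δ(x) = (x, x)`. -/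
def diag (A : ClosedStarIdeal L) : L →+* relDouble A where
  toFun x := ⟨(x, x), by
    change x - x ∈ A.toSubmodule
    rw [sub_self]; exact A.toSubmodule.zero_mem⟩
  map_one' := rfl
  map_mul' _ _ := rfl
  map_zero' := rfl
  map_add' _ _ := rfl

/-- `Δ` applied to selfadjoint invertible matrices. -/
def diagMap (A : ClosedStarIdeal L) {ι : Type*} [Fintype ι] [DecidableEq ι] (G : SAInv L ι) :
    SAInv (relDouble A) ι := G.map (diag A) (fun _ => rfl)

/-- `W_n(L, A)`: the selfadjoint invertible elements of `M_n(D(L, A))`. -/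
abbrev W (A : ClosedStarIdeal L) (n : ℕ) := SAInv (relDouble A) (Fin n)

/-- The direct sum `W_n(L, A) × W_m(L, A) → W_{n+m}(L, A)`. -/
def W.sum {A : ClosedStarIdeal L} {n m : ℕ} (H : W A n) (K : W A m) : W A (n + m) :=
  (SAInv.sum H K).reindex finSumFinEquiv

/-- `H₀ ∈ W_n(L, A)` and `H₁ ∈ W_m(L, A)` are stably homotopic: after adding elements `Δ(G₀)` and
`Δ(G₁)` to obtain the same size they can be joined by a continuous path of selfadjoint
invertible matrices over `D(L, A)`. -/
def StablyHomotopic (A : ClosedStarIdeal L) (H₀ H₁ : Σ n : ℕ, W A n) : Prop :=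
  ∃ (p q : ℕ) (h : H₀.1 + p = H₁.1 + q) (G₀ : SAInv L (Fin p)) (G₁ : SAInv L (Fin q)),
    Joined ((H₀.2.sum (diagMap A G₀)).reindex (finCongr h)) (H₁.2.sum (diagMap A G₁))

lemma stablyHomotopic_iff {A : ClosedStarIdeal L} {H₀ H₁ : Σ n : ℕ, W A n} :
    StablyHomotopic A H₀ H₁ ↔ ∃ (p q : ℕ) (G₀ : SAInv L (Fin p)) (G₁ : SAInv L (Fin q)),
      (SAInv.sum H₀.2 (diagMap A G₀)).HomotopicUpToIndex (SAInv.sum H₁.2 (diagMap A G₁)) := by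
  constructor
  · rintro ⟨p, q, h, G₀, G₁, hj⟩
    exact ⟨p, q, G₀, G₁, (SAInv.HomotopicUpToIndex.of_reindex _ _).trans
      (SAInv.HomotopicUpToIndex.trans ⟨_, hj⟩ (SAInv.HomotopicUpToIndex.of_reindex _ _).symm)⟩
  · rintro ⟨p, q, G₀, G₁, hj⟩
    have h : H₀.1 + p = H₁.1 + q := by
      obtain ⟨e, -⟩ := hj
      simpa using Fintype.card_congr e
    exact ⟨p, q, h, G₀, G₁, ((SAInv.HomotopicUpToIndex.of_reindex _ _).symm.trans
      (hj.trans (SAInv.HomotopicUpToIndex.of_reindex _ _))).joined _⟩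

lemma diagMap_sum {A : ClosedStarIdeal L} {ι κ : Type*} [Fintype ι] [DecidableEq ι] [Fintype κ]
    [DecidableEq κ] (G : SAInv L ι) (G' : SAInv L κ) :
    diagMap A (G.sum G') = (diagMap A G).sum (diagMap A G') :=
  Subtype.ext (by
    apply Matrix.ext
    intro i j
    rcases i with i | i <;> rcases j with j | j <;>
      rfl)

lemma stablyHomotopic_of {A : ClosedStarIdeal L} {H₀ H₁ : Σ n : ℕ, W A n}
    {ι κ : Type} [Fintype ι] [DecidableEq ι] [Fintype κ] [DecidableEq κ]
    (G₀ : SAInv L ι) (G₁ : SAInv L κ)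
    (h : (SAInv.sum H₀.2 (diagMap A G₀)).HomotopicUpToIndex (SAInv.sum H₁.2 (diagMap A G₁))) :
    StablyHomotopic A H₀ H₁ := by
  rw [stablyHomotopic_iff]
  have key : ∀ {ι : Type} [Fintype ι] [DecidableEq ι] (G : SAInv L ι) (e : ι ≃ Fin (Fintype.card ι)),
      (diagMap A (G.reindex e)).HomotopicUpToIndex (diagMap A G) := fun G e =>
    SAInv.HomotopicUpToIndex.symm ⟨e, Joined.refl _⟩
  refine ⟨_, _, G₀.reindex (Fintype.equivFin ι), G₁.reindex (Fintype.equivFin κ), ?_⟩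
  exact ((SAInv.HomotopicUpToIndex.of_joined (Joined.refl _)).sum (key _ _)).trans
    (h.trans ((SAInv.HomotopicUpToIndex.of_joined (Joined.refl _)).sum (key _ _).symm))

/-- Being stably homotopic is an equivalence relation on the disjoint union `W(L, A)` of the sets `W_n(L, A)`. -/
instance stableSetoid (A : ClosedStarIdeal L) : Setoid (Σ n : ℕ, W A n) where
  r := StablyHomotopic A
  iseqv := by
    refine ⟨fun H => ?_, fun {H K} h => ?_, fun {H K M} h h' => ?_⟩
    · exact ⟨0, 0, rfl, SAInv.one L _, SAInv.one L _, Joined.refl _⟩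
    · rw [stablyHomotopic_iff] at h ⊢
      obtain ⟨p, q, G₀, G₁, h⟩ := h
      exact ⟨q, p, G₁, G₀, h.symm⟩
    · rw [stablyHomotopic_iff] at h h'
      obtain ⟨p, q, G₀, G₁, h⟩ := h
      obtain ⟨p', q', G₀', G₁', h'⟩ := h'
      refine stablyHomotopic_of (G₀.sum G₀') (G₁'.sum G₁) ?_
      rw [diagMap_sum, diagMap_sum]
      have rf : ∀ {ι : Type} [Fintype ι] [DecidableEq ι] (G : SAInv (relDouble A) ι),
        G.HomotopicUpToIndex G := fun G => SAInv.HomotopicUpToIndex.of_joined (Joined.refl _)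
      refine (SAInv.HomotopicUpToIndex.sum_assoc _ _ _).symm.trans ((h.sum (rf _)).trans ?_)
      refine (SAInv.HomotopicUpToIndex.sum_assoc _ _ _).trans ?_
      refine ((rf _).sum (SAInv.HomotopicUpToIndex.sum_comm _ _)).trans ?_
      refine (SAInv.HomotopicUpToIndex.sum_assoc _ _ _).symm.trans ((h'.sum (rf _)).trans ?_)
      exact SAInv.HomotopicUpToIndex.sum_assoc _ _ _

/-- The group `K₀^inv(L, A) = W(L, A) / ∼`. -/
def K0inv (A : ClosedStarIdeal L) := Quotient (stableSetoid A)

/-- The class in `K₀^inv(L, A)` of an element of `W_n(L, A)`. -/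
def K0inv.mk {A : ClosedStarIdeal L} {n : ℕ} (H : W A n) : K0inv A :=
  Quotient.mk (stableSetoid A) ⟨n, H⟩

lemma K0inv.mk_eq {A : ClosedStarIdeal L} {n m : ℕ} {H : W A n} {K : W A m}
    {ι κ : Type} [Fintype ι] [DecidableEq ι] [Fintype κ] [DecidableEq κ]
    (G₀ : SAInv L ι) (G₁ : SAInv L κ)
    (h : (SAInv.sum H (diagMap A G₀)).HomotopicUpToIndex (SAInv.sum K (diagMap A G₁))) :
    K0inv.mk H = K0inv.mk K :=
  Quotient.sound (stablyHomotopic_of (H₀ := ⟨n, H⟩) (H₁ := ⟨m, K⟩) G₀ G₁ h)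

lemma K0inv.mk_eq' {A : ClosedStarIdeal L} {n m : ℕ} {H : W A n} {K : W A m}
    (h : SAInv.HomotopicUpToIndex H K) : K0inv.mk H = K0inv.mk K :=
  K0inv.mk_eq (SAInv.one L PEmpty) (SAInv.one L PEmpty)
    (h.sum (SAInv.HomotopicUpToIndex.of_joined (Joined.refl _)))

lemma W.homotopic_sum {A : ClosedStarIdeal L} {n m : ℕ} (H : W A n) (K : W A m) :
    SAInv.HomotopicUpToIndex (SAInv.sum H K) (W.sum H K) :=
  SAInv.HomotopicUpToIndex.of_reindex _ _

/-- Addition in `K₀^inv(L, A)` is induced by the direct sum of matrices. -/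
instance (A : ClosedStarIdeal L) : Add (K0inv A) where
  add := Quotient.map₂ (fun H K => ⟨H.1 + K.1, H.2.sum K.2⟩) (by
    rintro ⟨n, H⟩ ⟨n', H'⟩ h ⟨m, K⟩ ⟨m', K'⟩ k
    obtain ⟨p, q, G₀, G₁, h⟩ := stablyHomotopic_iff.1 h
    obtain ⟨p', q', G₀', G₁', k⟩ := stablyHomotopic_iff.1 k
    refine stablyHomotopic_of (G₀.sum G₀') (G₁.sum G₁') ?_
    rw [diagMap_sum, diagMap_sum]
    have rf : ∀ {ι : Type} [Fintype ι] [DecidableEq ι] (G : SAInv (relDouble A) ι),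
      G.HomotopicUpToIndex G := fun G => SAInv.HomotopicUpToIndex.of_joined (Joined.refl _)
    have key : ∀ {ι κ ι' κ' : Type} [Fintype ι] [DecidableEq ι] [Fintype κ] [DecidableEq κ]
        [Fintype ι'] [DecidableEq ι'] [Fintype κ'] [DecidableEq κ']
        (a : SAInv (relDouble A) ι) (b : SAInv (relDouble A) κ)
        (c : SAInv (relDouble A) ι') (d : SAInv (relDouble A) κ'),
        ((a.sum b).sum (c.sum d)).HomotopicUpToIndex ((a.sum c).sum (b.sum d)) := by
      intro ι κ ι' κ' _ _ _ _ _ _ _ _ a b c d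
      refine (SAInv.HomotopicUpToIndex.sum_assoc _ _ _).trans
        (SAInv.HomotopicUpToIndex.trans ?_ (SAInv.HomotopicUpToIndex.sum_assoc _ _ _).symm)
      refine (rf _).sum ((SAInv.HomotopicUpToIndex.sum_assoc _ _ _).symm.trans
        (SAInv.HomotopicUpToIndex.trans ?_ (SAInv.HomotopicUpToIndex.sum_assoc _ _ _)))
      exact (SAInv.HomotopicUpToIndex.sum_comm _ _).sum (rf _)
    refine ((W.homotopic_sum H K).symm.sum (rf _)).trans ((key _ _ _ _).trans ?_)
    refine (h.sum k).trans ((key _ _ _ _).trans ?_)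
    exact (W.homotopic_sum H' K').sum (rf _))

lemma K0inv.mk_add {A : ClosedStarIdeal L} {n m : ℕ} (H : W A n) (K : W A m) :
    K0inv.mk H + K0inv.mk K = K0inv.mk (H.sum K) := rfl

/-- The neutral element is the class of the unit `E₁ = (1, 1)`. -/
instance (A : ClosedStarIdeal L) : Zero (K0inv A) where
  zero := K0inv.mk (n := 1) (SAInv.one _ _)

lemma K0inv.mk_eq_zero {A : ClosedStarIdeal L} {n : ℕ} {H : W A n}
    {ι : Type} [Fintype ι] [DecidableEq ι] (G : SAInv L ι)
    (h : SAInv.HomotopicUpToIndex H (diagMap A G)) : K0inv.mk H = 0 := by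
  refine K0inv.mk_eq (SAInv.one L (Fin 1)) G ?_
  have e : diagMap A (SAInv.one L (Fin 1)) = SAInv.one _ _ :=
    Subtype.ext (by
      change ((1 : Matrix (Fin 1) (Fin 1) L).map (diag A)) = 1
      exact Matrix.map_one _ (map_zero _) (map_one _))
  rw [e]
  exact (h.sum (SAInv.HomotopicUpToIndex.of_joined (Joined.refl _))).trans
    (SAInv.HomotopicUpToIndex.sum_comm _ _)

lemma K0inv.zero_add' {A : ClosedStarIdeal L} (x : K0inv A) : 0 + x = x := by
  induction x using Quotient.inductionOn with
  | h H =>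
  obtain ⟨n, H⟩ := H
  have e : diagMap A (SAInv.one L (Fin 1)) = SAInv.one _ _ :=
    Subtype.ext (by
      change ((1 : Matrix (Fin 1) (Fin 1) L).map (diag A)) = 1
      exact Matrix.map_one _ (map_zero _) (map_one _))
  refine K0inv.mk_eq (H := W.sum (SAInv.one _ _) H) (K := H) (SAInv.one L PEmpty)
    (SAInv.one L (PEmpty ⊕ Fin 1)) ?_
  have e' : SAInv.one L (PEmpty ⊕ Fin 1) = (SAInv.one L PEmpty).sum (SAInv.one L (Fin 1)) :=
    Subtype.ext (by simp [SAInv.one, SAInv.sum])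
  have rf : ∀ {ι : Type} [Fintype ι] [DecidableEq ι] (G : SAInv (relDouble A) ι),
    G.HomotopicUpToIndex G := fun G => SAInv.HomotopicUpToIndex.of_joined (Joined.refl _)
  rw [e', diagMap_sum, e]
  refine ((W.homotopic_sum _ _).symm.sum (rf _)).trans ?_
  refine ((SAInv.HomotopicUpToIndex.sum_comm _ _).sum (rf _)).trans ?_
  refine (SAInv.HomotopicUpToIndex.sum_assoc _ _ _).trans ?_
  exact (rf _).sum (SAInv.HomotopicUpToIndex.sum_comm _ _)

lemma K0inv.add_comm' {A : ClosedStarIdeal L} (x y : K0inv A) : x + y = y + x := by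
  induction x, y using Quotient.inductionOn₂ with
  | h H K =>
  exact K0inv.mk_eq' (H := W.sum H.2 K.2) (K := W.sum K.2 H.2)
    ((W.homotopic_sum _ _).symm.trans
    ((SAInv.HomotopicUpToIndex.sum_comm _ _).trans (W.homotopic_sum _ _)))

lemma K0inv.add_assoc' {A : ClosedStarIdeal L} (x y z : K0inv A) :
    x + y + z = x + (y + z) := by
  induction x, y, z using Quotient.inductionOn₃ with
  | h H K M =>
  have rf : ∀ {ι : Type} [Fintype ι] [DecidableEq ι] (G : SAInv (relDouble A) ι),
    G.HomotopicUpToIndex G := fun G => SAInv.HomotopicUpToIndex.of_joined (Joined.refl _)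
  refine K0inv.mk_eq' (H := W.sum (W.sum H.2 K.2) M.2) (K := W.sum H.2 (W.sum K.2 M.2)) ?_
  refine (W.homotopic_sum _ _).symm.trans (SAInv.HomotopicUpToIndex.trans ?_ (W.homotopic_sum _ _))
  refine ((W.homotopic_sum _ _).symm.sum (rf _)).trans ?_
  refine (SAInv.HomotopicUpToIndex.sum_assoc _ _ _).trans ?_
  exact (rf _).sum (W.homotopic_sum _ _)

lemma K0inv.exists_neg {A : ClosedStarIdeal L} (x : K0inv A) : ∃ y, y + x = 0 := by
  induction x using Quotient.inductionOn with
  | h H =>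
  obtain ⟨n, H⟩ := H
  obtain ⟨K, M, hM, hj⟩ := SAInv.exists_sum_joined H
  refine ⟨K0inv.mk K, ?_⟩
  let G : SAInv L (Fin n ⊕ Fin n) := ⟨Matrix.fromBlocks 0 1 1 0, by
    change Matrix.conjTranspose _ = _
    rw [Matrix.fromBlocks_conjTranspose]; simp,
    ⟨⟨Matrix.fromBlocks 0 1 1 0, Matrix.fromBlocks 0 1 1 0,
      by simp [Matrix.fromBlocks_multiply], by simp [Matrix.fromBlocks_multiply]⟩, rfl⟩⟩
  have hG : diagMap A G = M := Subtype.ext (by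
    rw [hM]
    change (Matrix.fromBlocks 0 1 1 0 : Matrix _ _ L).map (diag A) = _
    rw [Matrix.fromBlocks_map]
    simp [Matrix.map_one _ (map_zero (diag A)) (map_one (diag A))])
  refine K0inv.mk_eq_zero (H := W.sum K H) G ?_
  rw [hG]
  exact (W.homotopic_sum _ _).symm.trans ((SAInv.HomotopicUpToIndex.sum_comm _ _).trans
    (SAInv.HomotopicUpToIndex.of_joined hj))

noncomputable instance (A : ClosedStarIdeal L) : Neg (K0inv A) where
  neg x := (K0inv.exists_neg x).choose

/-- `K₀^inv(L, A)` is an abelian group. -/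
noncomputable instance (A : ClosedStarIdeal L) : AddCommGroup (K0inv A) where
  add_assoc := K0inv.add_assoc'
  zero_add := K0inv.zero_add'
  add_zero x := by rw [K0inv.add_comm', K0inv.zero_add']
  add_comm := K0inv.add_comm'
  neg_add_cancel x := (K0inv.exists_neg x).choose_spec
  nsmul := nsmulRec
  zsmul := zsmulRec

end RelativeKTheory
section HilbertModules

/- Mathlib's `CStarModule A X` uses the convention `⟪x, a • y⟫ = a * ⟪x, y⟫`.  A right Hilbert
C⋆-module over `B` is therefore a `CStarModule Bᵐᵒᵖ X`: the scalar multiplication by `op b` is the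
right multiplication by `b`, and `⟪x, y b⟫ = ⟪x, y⟫ b` holds for the inner product read in `B`. -/

variable (A X : Type*) [NonUnitalCStarAlgebra A] [PartialOrder A] [StarOrderedRing A]
  [NormedAddCommGroup X] [NormedSpace ℂ X] [SMul A X] [CStarModule A X]

/-- The unital subalgebra of adjointable operators inside the bounded operators on `X`. -/
def adjointable : Subalgebra ℂ (X →L[ℂ] X) where
  carrier := {T | ∃ S : X →L[ℂ] X, ∀ x y, inner A (T x) y = inner A x (S y)}
  mul_mem' := by
    rintro T T' ⟨S, h⟩ ⟨S', h'⟩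
    exact ⟨S' * S, fun x y => by simp [h, h']⟩
  add_mem' := by
    rintro T T' ⟨S, h⟩ ⟨S', h'⟩
    exact ⟨S + S', fun x y => by simp [h, h']⟩
  algebraMap_mem' := by
    intro r
    refine ⟨algebraMap ℂ _ (star r), fun x y => ?_⟩
    simp [Algebra.algebraMap_eq_smul_one]

/-- The C⋆-algebra `𝕃(X)` of bounded adjointable operators on the Hilbert C⋆-module `X`,
with the operator norm. -/
def Adj : Type _ := adjointable A X

noncomputable instance : NormedRing (Adj A X) := inferInstanceAs (NormedRing (adjointable A X))

noncomputable instance : NormedAlgebra ℂ (Adj A X) :=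
  inferInstanceAs (NormedAlgebra ℂ (adjointable A X))

variable {A X}

lemma inner_ext {x y : X} (h : ∀ z, inner A z x = inner A z y) : x = y := by
  have : inner A (x - y) (x - y) = 0 := by
    rw [CStarModule.inner_sub_right, h, sub_self]
  exact sub_eq_zero.1 (CStarModule.inner_self.1 this)

lemma smul_add_left (a b : A) (x : X) : (a + b) • x = a • x + b • x :=
  inner_ext (A := A) fun z => by simp [add_mul]

lemma smul_add_right (a : A) (x y : X) : a • (x + y) = a • x + a • y :=
  inner_ext (A := A) fun z => by simp [mul_add]

lemma smul_complex_left (c : ℂ) (a : A) (x : X) : (c • a) • x = c • (a • x) :=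
  inner_ext (A := A) fun z => by simp [smul_mul_assoc]

lemma norm_smul_le' (a : A) (x : X) : ‖a • x‖ ≤ ‖a‖ * ‖x‖ := by
  have h : ‖a • x‖ ^ 2 ≤ (‖a‖ * ‖x‖) ^ 2 := by
    rw [CStarModule.norm_sq_eq A, mul_pow, CStarModule.norm_sq_eq A (x := x)]
    simp only [CStarModule.inner_op_smul_right, CStarModule.inner_op_smul_left]
    calc ‖a * (inner A x x * star a)‖ ≤ ‖a‖ * (‖inner A x x‖ * ‖star a‖) :=
          (norm_mul_le _ _).trans (by gcongr; exact norm_mul_le _ _)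
      _ = _ := by rw [norm_star]; ring
  exact le_of_sq_le_sq h (by positivity)

noncomputable instance : Star (Adj A X) where
  star T := ⟨Classical.choose T.2, T.1, fun x y => by
    rw [← CStarModule.star_inner y, ← Classical.choose_spec T.2, CStarModule.star_inner]⟩

lemma inner_adj (T : Adj A X) (x y : X) :
    inner A (T.1 x) y = inner A x ((star T).1 y) := T.2.choose_spec x y

lemma inner_adj' (T : Adj A X) (x y : X) :
    inner A x (T.1 y) = inner A ((star T).1 x) y := by
  rw [← CStarModule.star_inner, inner_adj, CStarModule.star_inner]

lemma Adj.ext {S T : Adj A X} (h : ∀ x, S.1 x = T.1 x) : S = T :=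
  Subtype.ext (ContinuousLinearMap.ext h)

lemma star_eq_of {S T : Adj A X} (h : ∀ x y, inner A (T.1 x) y = inner A x (S.1 y)) :
    star T = S :=
  Adj.ext fun y => inner_ext (A := A) fun x => by rw [← inner_adj, h]

noncomputable instance : StarRing (Adj A X) where
  star_involutive T := star_eq_of fun x y => by rw [inner_adj' T]
  star_mul S T := star_eq_of fun x y => by
    change inner A (S.1 (T.1 x)) y = inner A x ((star T).1 ((star S).1 y))
    rw [inner_adj, inner_adj]
  star_add S T := star_eq_of fun x y => by
    change inner A (S.1 x + T.1 x) y = inner A x ((star S).1 y + (star T).1 y)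
    rw [CStarModule.inner_add_left, inner_adj, inner_adj, CStarModule.inner_add_right]

noncomputable instance : StarModule ℂ (Adj A X) where
  star_smul c T := star_eq_of fun x y => by
    change inner A (c • T.1 x) y = inner A x (star c • (star T).1 y)
    rw [CStarModule.inner_smul_left_complex, inner_adj, CStarModule.inner_smul_right_complex]

noncomputable instance : CStarRing (Adj A X) where
  norm_mul_self_le T := by
    change ‖T.1‖ * ‖T.1‖ ≤ ‖(star T * T).1‖
    have h : ‖T.1‖ ≤ √‖(star T * T).1‖ := by
      refine ContinuousLinearMap.opNorm_le_bound _ (Real.sqrt_nonneg _) fun x => ?_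
      refine le_of_sq_le_sq ?_ (by positivity)
      rw [mul_pow, Real.sq_sqrt (norm_nonneg _), CStarModule.norm_sq_eq A, inner_adj]
      calc ‖inner A x ((star T).1 (T.1 x))‖ ≤ ‖x‖ * ‖(star T * T).1 x‖ :=
            CStarModule.norm_inner_le X
        _ ≤ ‖x‖ * (‖(star T * T).1‖ * ‖x‖) := by
            gcongr; exact ContinuousLinearMap.le_opNorm _ _
        _ = _ := by ring
    calc ‖T.1‖ * ‖T.1‖ ≤ √‖(star T * T).1‖ * √‖(star T * T).1‖ := by gcongr
      _ = _ := Real.mul_self_sqrt (norm_nonneg _)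

variable [CompleteSpace X]

lemma isClosed_adjointable : IsClosed (adjointable A X : Set (X →L[ℂ] X)) := by
  refine isClosed_of_closure_subset fun T hT => ?_
  obtain ⟨u, hu, hlim⟩ := mem_closure_iff_seq_limit.1 hT
  let v : ℕ → Adj A X := fun n => ⟨u n, hu n⟩
  have hcau : CauchySeq (fun n => (star (v n)).1) := by
    have h1 := hlim.cauchySeq
    rw [Metric.cauchySeq_iff] at h1 ⊢
    intro ε hε
    obtain ⟨N, hN⟩ := h1 ε hε
    refine ⟨N, fun m hm n hn => ?_⟩
    have := hN m hm n hn
    rw [dist_eq_norm] at this ⊢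
    have e : ‖(star (v m - v n) : Adj A X)‖ = ‖v m - v n‖ := norm_star (E := Adj A X) (v m - v n)
    rw [star_sub] at e
    have e1 : ‖(star (v m)).1 - (star (v n)).1‖ = ‖u m - u n‖ := e
    rwa [e1]
  obtain ⟨S, hS⟩ := cauchySeq_tendsto_of_complete hcau
  refine ⟨S, fun x y => ?_⟩
  have l1 : Filter.Tendsto (fun n => inner A (u n x) y) Filter.atTop (nhds (inner A (T x) y)) := by
    have := (CStarModule.continuous_inner (A := A) (E := X)).tendsto (T x, y)
    refine this.comp (Filter.Tendsto.prodMk_nhds ?_ tendsto_const_nhds)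
    exact ((ContinuousLinearMap.apply ℂ X x).continuous.tendsto T).comp hlim
  have l2 : Filter.Tendsto (fun n => inner A x ((star (v n)).1 y)) Filter.atTop
      (nhds (inner A x (S y))) := by
    have := (CStarModule.continuous_inner (A := A) (E := X)).tendsto (x, S y)
    refine this.comp (Filter.Tendsto.prodMk_nhds tendsto_const_nhds ?_)
    exact ((ContinuousLinearMap.apply ℂ X y).continuous.tendsto S).comp hS
  refine tendsto_nhds_unique l1 (l2.congr fun n => ?_)
  exact (inner_adj (v n) x y).symm

instance : CompleteSpace (Adj A X) := (isClosed_adjointable (A := A) (X := X)).completeSpace_coe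

noncomputable instance : CStarAlgebra (Adj A X) where

/-- The rank one operator `θ_{x,y} : z ↦ x⟨y, z⟩`. -/
noncomputable def rankOne (x y : X) : Adj A X :=
  ⟨LinearMap.mkContinuous
    { toFun := fun z => (inner A y z : A) • x
      map_add' := fun z w => by rw [CStarModule.inner_add_right, smul_add_left]
      map_smul' := fun c z => by
        rw [CStarModule.inner_smul_right_complex, smul_complex_left, RingHom.id_apply] }
    (‖y‖ * ‖x‖) (fun z => by
      change ‖(inner A y z : A) • x‖ ≤ _
      calc ‖(inner A y z : A) • x‖ ≤ ‖inner A y z‖ * ‖x‖ := norm_smul_le' _ _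
        _ ≤ (‖y‖ * ‖z‖) * ‖x‖ := by gcongr; exact CStarModule.norm_inner_le X
        _ = _ := by ring),
   LinearMap.mkContinuous
    { toFun := fun z => (inner A x z : A) • y
      map_add' := fun z w => by rw [CStarModule.inner_add_right, smul_add_left]
      map_smul' := fun c z => by
        rw [CStarModule.inner_smul_right_complex, smul_complex_left, RingHom.id_apply] }
    (‖x‖ * ‖y‖) (fun z => by
      change ‖(inner A x z : A) • y‖ ≤ _
      calc ‖(inner A x z : A) • y‖ ≤ ‖inner A x z‖ * ‖y‖ := norm_smul_le' _ _
        _ ≤ (‖x‖ * ‖z‖) * ‖y‖ := by gcongr; exact CStarModule.norm_inner_le X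
        _ = _ := by ring),
   fun z w => by
    change inner A ((inner A y z : A) • x) w = inner A z ((inner A x w : A) • y)
    rw [CStarModule.inner_op_smul_left, CStarModule.inner_op_smul_right, CStarModule.star_inner]⟩

lemma rankOne_apply (x y z : X) : (rankOne x y : Adj A X).1 z = (inner A y z : A) • x := rfl

lemma star_rankOne (x y : X) : star (rankOne x y : Adj A X) = rankOne y x :=
  star_eq_of fun z w => by
    simp only [rankOne_apply]
    rw [CStarModule.inner_op_smul_left, CStarModule.inner_op_smul_right, CStarModule.star_inner]

lemma Adj.map_smul (T : Adj A X) (a : A) (x : X) : T.1 (a • x) = a • T.1 x :=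
  inner_ext (A := A) fun z => by
    rw [inner_adj', CStarModule.inner_op_smul_right, CStarModule.inner_op_smul_right, inner_adj']

lemma mul_rankOne (T : Adj A X) (x y : X) : T * rankOne x y = rankOne (T.1 x) y :=
  Adj.ext fun _ => T.map_smul _ _

lemma rankOne_mul (T : Adj A X) (x y : X) : rankOne x y * T = rankOne x ((star T).1 y) :=
  Adj.ext fun z => by
    change (inner A y (T.1 z) : A) • x = (inner A ((star T).1 y) z : A) • x
    rw [inner_adj']

variable (A X) in
/-- The linear span of the rank one operators. -/
noncomputable def finiteRank : Submodule ℂ (Adj A X) :=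
  Submodule.span ℂ {T | ∃ x y : X, T = rankOne x y}

variable (A X) in
/-- The closed `*`-ideal `𝕂(X) ⊆ 𝕃(X)` of compact operators: the closed linear span of the
rank one operators. -/
noncomputable def compactOps : ClosedStarIdeal (Adj A X) where
  toSubmodule := (finiteRank A X).topologicalClosure
  isClosed' := (finiteRank A X).isClosed_topologicalClosure
  mul_mem_left' := fun T {a} ha => by
    have h : ∀ a ∈ finiteRank A X, T * a ∈ finiteRank A X := by
      intro a ha
      induction ha using Submodule.span_induction with
      | mem a ha =>
        obtain ⟨x, y, rfl⟩ := ha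
        exact Submodule.subset_span ⟨_, _, mul_rankOne T x y⟩
      | zero => rw [mul_zero]; exact Submodule.zero_mem _
      | add a b _ _ ha hb => rw [mul_add]; exact Submodule.add_mem _ ha hb
      | smul c a _ ha => rw [mul_smul_comm]; exact Submodule.smul_mem _ _ ha
    exact map_mem_closure (f := fun a => T * a) (by fun_prop) ha h
  mul_mem_right' := fun T {a} ha => by
    have h : ∀ a ∈ finiteRank A X, a * T ∈ finiteRank A X := by
      intro a ha
      induction ha using Submodule.span_induction with
      | mem a ha =>
        obtain ⟨x, y, rfl⟩ := ha
        exact Submodule.subset_span ⟨_, _, rankOne_mul T x y⟩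
      | zero => rw [zero_mul]; exact Submodule.zero_mem _
      | add a b _ _ ha hb => rw [add_mul]; exact Submodule.add_mem _ ha hb
      | smul c a _ ha => rw [smul_mul_assoc]; exact Submodule.smul_mem _ _ ha
    exact map_mem_closure (f := fun a => a * T) (by fun_prop) ha h
  star_mem' := fun {a} ha => by
    have h : ∀ a ∈ finiteRank A X, star a ∈ finiteRank A X := by
      intro a ha
      induction ha using Submodule.span_induction with
      | mem a ha =>
        obtain ⟨x, y, rfl⟩ := ha
        exact Submodule.subset_span ⟨_, _, star_rankOne x y⟩
      | zero => rw [star_zero]; exact Submodule.zero_mem _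
      | add a b _ _ ha hb => rw [star_add]; exact Submodule.add_mem _ ha hb
      | smul c a _ ha => rw [star_smul]; exact Submodule.smul_mem _ _ ha
    exact map_mem_closure (f := fun a => star a) continuous_star ha h

end HilbertModules

section UnboundedOperators

variable {A X : Type*} [NonUnitalCStarAlgebra A] [PartialOrder A] [StarOrderedRing A]
  [NormedAddCommGroup X] [NormedSpace ℂ X] [SMul A X] [CStarModule A X]

variable (A) in
/-- An unbounded operator `D : Dom(D) → X` is selfadjoint and regular: its domain is a norm-dense
`A`-submodule, `D` is `A`-linear and symmetric, and both `D + i` and `D - i` have image `X`. -/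
structure IsSelfAdjointRegular (D : X →ₗ.[ℂ] X) : Prop where
  dense : Dense (D.domain : Set X)
  smul : ∀ (a : A) (x : D.domain), ∃ h : a • (x : X) ∈ D.domain, D ⟨a • (x : X), h⟩ = a • D x
  symmetric : ∀ x y : D.domain, inner A (D x) (y : X) = inner A (x : X) (D y)
  range_add : ∀ y : X, ∃ x : D.domain, D x + I • (x : X) = y
  range_sub : ∀ y : X, ∃ x : D.domain, D x - I • (x : X) = y

lemma IsSelfAdjointRegular.norm_le {D : X →ₗ.[ℂ] X} (hD : IsSelfAdjointRegular A D)
    {s : ℂ} (hs : s = I ∨ s = -I) (x : D.domain) : ‖(x : X)‖ ≤ ‖D x + s • (x : X)‖ := by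
  have h1 : star s = -s := by rcases hs with rfl | rfl <;> simp
  have h2 : s * s = -1 := by rcases hs with rfl | rfl <;> simp
  refine le_of_sq_le_sq ?_ (norm_nonneg _)
  rw [CStarModule.norm_sq_eq A, CStarModule.norm_sq_eq A (x := D x + s • (x : X))]
  have e : inner A (D x + s • (x : X)) (D x + s • (x : X))
      = inner A (D x) (D x) + inner A (x : X) (x : X) := by
    simp only [CStarModule.inner_add_left, CStarModule.inner_add_right,
      CStarModule.inner_smul_left_complex, CStarModule.inner_smul_right_complex, hD.symmetric x x,
      smul_smul, h1, h2, neg_smul, neg_neg, one_smul, smul_neg, smul_add]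
    abel
  rw [e]
  exact CStarAlgebra.norm_le_norm_of_nonneg_of_le CStarModule.inner_self_nonneg
    (le_add_of_nonneg_left CStarModule.inner_self_nonneg)

/-- Construction of the adjointable inverse of `D + s` for `s = ± i`. -/
lemma IsSelfAdjointRegular.exists_inverse {D : X →ₗ.[ℂ] X} (hD : IsSelfAdjointRegular A D) :
    ∃ R : Adj A X, (∀ y, ∃ h : R.1 y ∈ D.domain, D ⟨R.1 y, h⟩ + I • R.1 y = y) ∧
      (∀ y, ∃ h : (star R).1 y ∈ D.domain, D ⟨(star R).1 y, h⟩ - I • (star R).1 y = y) := by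
  have key : ∀ s : ℂ, (s = I ∨ s = -I) → (∀ y : X, ∃ x : D.domain, D x + s • (x : X) = y) →
      ∃ T : X →L[ℂ] X, ∀ y, ∃ h : T y ∈ D.domain, D ⟨T y, h⟩ + s • T y = y := by
    intro s hs hsurj
    let f : D.domain →ₗ[ℂ] X := D.toFun + s • D.domain.subtype
    have hf : ∀ x, f x = D x + s • (x : X) := fun x => rfl
    have hinj : Function.Injective f := by
      rw [injective_iff_map_eq_zero]
      intro x hx
      have h := hD.norm_le hs x
      rw [← hf, hx, norm_zero] at h
      exact Subtype.ext (norm_le_zero_iff.1 h)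
    let E := LinearEquiv.ofBijective f ⟨hinj, hsurj⟩
    have hE : ∀ y, D (E.symm y) + s • (E.symm y : X) = y := fun y => E.apply_symm_apply y
    refine ⟨LinearMap.mkContinuous (D.domain.subtype ∘ₗ E.symm.toLinearMap) 1 fun y => ?_,
      fun y => ⟨(E.symm y).2, hE y⟩⟩
    have h := hD.norm_le hs (E.symm y)
    rw [hE] at h
    simpa using h
  obtain ⟨R, hR⟩ := key I (Or.inl rfl) hD.range_add
  obtain ⟨S, hS⟩ := key (-I) (Or.inr rfl) (fun y => by
    simpa [sub_eq_add_neg] using hD.range_sub y)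
  have hadj : ∀ x y, inner A (R x) y = inner A x (S y) := by
    intro x y
    obtain ⟨h1, e1⟩ := hR x
    obtain ⟨h2, e2⟩ := hS y
    have e3 : inner A (D ⟨R x, h1⟩) (S y) = inner A (R x) (D ⟨S y, h2⟩) :=
      hD.symmetric ⟨R x, h1⟩ ⟨S y, h2⟩
    calc inner A (R x) y = inner A (R x) (D ⟨S y, h2⟩ + (-I) • S y) := by rw [e2]
      _ = inner A (D ⟨R x, h1⟩ + I • R x) (S y) := by
          rw [CStarModule.inner_add_right, CStarModule.inner_add_left, e3,
            CStarModule.inner_smul_left_complex, CStarModule.inner_smul_right_complex]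
          simp
      _ = inner A x (S y) := by rw [e1]
  let R' : Adj A X := ⟨R, S, hadj⟩
  refine ⟨R', hR, ?_⟩
  have hst : star R' = (⟨S, R, fun x y => by
      rw [← CStarModule.star_inner, ← hadj, CStarModule.star_inner]⟩ : Adj A X) := star_eq_of hadj
  rw [hst]
  intro y
  obtain ⟨h2, e2⟩ := hS y
  exact ⟨h2, by rw [sub_eq_add_neg, ← neg_smul]; exact e2⟩

/-- The resolvent `(D + i)⁻¹` as a bounded adjointable operator. -/
noncomputable def resolvent {D : X →ₗ.[ℂ] X} (hD : IsSelfAdjointRegular A D) : Adj A X :=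
  Classical.choose hD.exists_inverse

/-- `(D + i)⁻¹` maps `X` into `Dom(D)` and is a right inverse of `D + i`. -/
lemma resolvent_spec {D : X →ₗ.[ℂ] X} (hD : IsSelfAdjointRegular A D) (y : X) :
    ∃ h : (resolvent hD).1 y ∈ D.domain,
      D ⟨(resolvent hD).1 y, h⟩ + I • (resolvent hD).1 y = y :=
  (Classical.choose_spec hD.exists_inverse).1 y

/-- `(D + i)⁻¹` is a left inverse of `D + i`. -/
lemma resolvent_left {D : X →ₗ.[ℂ] X} (hD : IsSelfAdjointRegular A D) (x : D.domain) :
    (resolvent hD).1 (D x + I • (x : X)) = x := by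
  obtain ⟨h, e⟩ := resolvent_spec hD (D x + I • (x : X))
  have h1 := hD.norm_le (Or.inl rfl) (⟨_, h⟩ - x)
  have h2 : D (⟨_, h⟩ - x) + I • ((⟨_, h⟩ - x : D.domain) : X) = 0 := by
    rw [D.map_sub, AddSubgroupClass.coe_sub, smul_sub]
    rw [show ∀ a b c d : X, a - b + (c - d) = (a + c) - (b + d) by intros; abel, e, sub_self]
  rw [h2, norm_zero, norm_le_zero_iff, AddSubgroupClass.coe_sub, sub_eq_zero] at h1
  exact h1

lemma star_resolvent_spec {D : X →ₗ.[ℂ] X} (hD : IsSelfAdjointRegular A D) (y : X) :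
    ∃ h : (star (resolvent hD)).1 y ∈ D.domain,
      D ⟨(star (resolvent hD)).1 y, h⟩ - I • (star (resolvent hD)).1 y = y :=
  (Classical.choose_spec hD.exists_inverse).2 y

/-- The Cayley transform `(D - i)(D + i)⁻¹ = 1 - 2i (D + i)⁻¹`. -/
noncomputable def cayley {D : X →ₗ.[ℂ] X} (hD : IsSelfAdjointRegular A D) : Adj A X :=
  1 - (2 * I) • resolvent hD

lemma cayley_apply {D : X →ₗ.[ℂ] X} (hD : IsSelfAdjointRegular A D) (x : D.domain) :
    (cayley hD).1 (D x + I • (x : X)) = D x - I • (x : X) := by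
  change (D x + I • (x : X)) - (2 * I) • (resolvent hD).1 (D x + I • (x : X)) = _
  rw [resolvent_left, mul_smul, two_smul]
  abel

lemma cayley_mem_unitary {D : X →ₗ.[ℂ] X} (hD : IsSelfAdjointRegular A D) :
    cayley hD ∈ unitary (Adj A X) := by
  have hs : star (cayley hD) = 1 + (2 * I) • star (resolvent hD) := by
    simp [cayley, sub_eq_add_neg]
  have hsa : ∀ x : D.domain, (star (cayley hD)).1 (D x - I • (x : X)) = D x + I • (x : X) := by
    intro x
    obtain ⟨h, e⟩ := star_resolvent_spec hD (D x - I • (x : X))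
    have h1 := hD.norm_le (Or.inr rfl) (⟨_, h⟩ - x)
    have h2 : D (⟨_, h⟩ - x) + (-I) • ((⟨_, h⟩ - x : D.domain) : X) = 0 := by
      rw [D.map_sub, AddSubgroupClass.coe_sub, neg_smul, ← sub_eq_add_neg, smul_sub]
      rw [show ∀ a b c d : X, a - b - (c - d) = (a - c) - (b - d) by intros; abel, e, sub_self]
    rw [h2, norm_zero, norm_le_zero_iff, AddSubgroupClass.coe_sub, sub_eq_zero] at h1
    rw [hs]
    change (D x - I • (x : X)) + (2 * I) • (star (resolvent hD)).1 (D x - I • (x : X)) = _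
    change (star (resolvent hD)).1 (D x - I • (x : X)) = x at h1
    rw [h1, mul_smul, two_smul]
    abel
  rw [Unitary.mem_iff]
  constructor
  · refine Adj.ext fun y => ?_
    obtain ⟨x, rfl⟩ := hD.range_add y
    change (star (cayley hD)).1 ((cayley hD).1 _) = _
    rw [cayley_apply, hsa]; rfl
  · refine Adj.ext fun y => ?_
    obtain ⟨x, rfl⟩ := hD.range_sub y
    change (cayley hD).1 ((star (cayley hD)).1 _) = _
    rw [hsa, cayley_apply]; rfl

variable [CompleteSpace X]

/-- The continuous functional calculus `f ↦ f(D)` for continuous functions `f` vanishing at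
infinity: with `c(t) = (t - i)(t + i)⁻¹` the homeomorphism from `ℝ` onto the unit circle without
the point `1`, one has `f(D) = (f ∘ c⁻¹)(C_D)` where `C_D` is the Cayley transform, `f ∘ c⁻¹` is
extended by `0` to the point `1`, and `c⁻¹(z) = i(1 + z)(1 - z)⁻¹`. -/
noncomputable def funcCalc {D : X →ₗ.[ℂ] X} (hD : IsSelfAdjointRegular A D) (f : ℝ → ℝ) :
    Adj A X :=
  open Classical in
  cfc (fun z : ℂ => if z = 1 then 0 else ((f ((I * (1 + z) / (1 - z)).re) : ℝ) : ℂ)) (cayley hD)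

/-- For `f` continuous with compact support, `f(D)` maps `X` into `Dom(D)` and the composition
`D f(D)` is a bounded adjointable operator. -/
lemma exists_mul_funcCalc {D : X →ₗ.[ℂ] X} (hD : IsSelfAdjointRegular A D) {f : ℝ → ℝ}
    (hf : Continuous f) (hc : HasCompactSupport f) :
    ∃ T : Adj A X, ∀ x, ∃ h : (funcCalc hD f).1 x ∈ D.domain,
      T.1 x = D ⟨(funcCalc hD f).1 x, h⟩ := by
  classical
  set C := cayley hD with hC
  set R := resolvent hD with hR
  let F : ℂ → ℂ := fun z => if z = 1 then 0 else ((f ((I * (1 + z) / (1 - z)).re) : ℝ) : ℂ)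
  have hsph : spectrum ℂ C ⊆ Metric.sphere 0 1 :=
    spectrum.subset_circle_of_unitary (cayley_mem_unitary hD)
  let G : ℂ → ℂ := fun z => F z * ((2 * I) / (1 - z))
  have hcont : ∀ z ≠ (1 : ℂ),
      ContinuousAt (fun z : ℂ => (f ((I * (1 + z) / (1 - z)).re) : ℂ)) z := by
    intro z hz
    have h1 : ContinuousAt (fun z : ℂ => I * (1 + z) / (1 - z)) z := by
      refine ContinuousAt.div (by fun_prop) (by fun_prop) ?_
      exact sub_ne_zero.2 (Ne.symm hz)
    have h2 : ContinuousAt (fun z : ℂ => (I * (1 + z) / (1 - z)).re) z :=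
      continuous_re.continuousAt.comp h1
    exact continuous_ofReal.continuousAt.comp (ContinuousAt.comp (f := fun z : ℂ => _)
      hf.continuousAt h2)
  obtain ⟨r, hr⟩ := hc.isCompact.isBounded.subset_closedBall 0
  have hzero : ∀ t : ℝ, r < |t| → f t = 0 := by
    intro t ht
    by_contra h
    have := hr (subset_tsupport f h)
    rw [mem_closedBall_zero_iff, Real.norm_eq_abs] at this
    linarith
  have hnear : ∀ᶠ z in nhdsWithin (1 : ℂ) (spectrum ℂ C), F z = 0 := by
    have hev : ∀ᶠ z in nhdsWithin (1 : ℂ) (spectrum ℂ C), ‖z - 1‖ * (r + 1) < 1 ∧ 0 < ‖1 + z‖ - 1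
        := by
      refine Filter.Eventually.filter_mono nhdsWithin_le_nhds ?_
      refine Filter.Eventually.and ?_ ?_
      · have : ContinuousAt (fun z : ℂ => ‖z - 1‖ * (r + 1)) 1 := by fun_prop
        exact this.eventually (gt_mem_nhds (by simp))
      · have : ContinuousAt (fun z : ℂ => ‖1 + z‖ - 1) 1 := by fun_prop
        exact this.eventually (lt_mem_nhds (by norm_num))
    filter_upwards [hev, self_mem_nhdsWithin] with z hz hzs
    by_cases h1 : z = 1
    · simp [F, h1]
    simp only [F, if_neg h1]
    rw [ofReal_eq_zero]
    refine hzero _ ?_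
    have hn : z * (starRingEnd ℂ) z = 1 := by
      have := mem_sphere_zero_iff_norm.1 (hsph hzs)
      rw [mul_conj, normSq_eq_norm_sq, this]; simp
    have hd : 1 - z ≠ 0 := sub_ne_zero.2 (Ne.symm h1)
    have hd' : 1 - (starRingEnd ℂ) z ≠ 0 := by
      intro h
      apply hd
      have := congrArg (starRingEnd ℂ) h
      simpa using this
    have hreal : (starRingEnd ℂ) (I * (1 + z) / (1 - z)) = I * (1 + z) / (1 - z) := by
      simp only [map_div₀, map_mul, conj_I, map_add, map_sub, map_one]
      rw [div_eq_div_iff hd' hd]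
      linear_combination (2 * I) * hn
    have habs : |(I * (1 + z) / (1 - z)).re| = ‖1 + z‖ / ‖1 - z‖ := by
      have h2 := conj_eq_iff_re.1 hreal
      rw [← Real.norm_eq_abs, ← norm_real, h2]
      simp
    rw [habs, lt_div_iff₀ (norm_pos_iff.2 hd), norm_sub_rev]
    nlinarith [hz.1, hz.2, norm_nonneg (z - 1)]
  have hGc : ContinuousOn G (spectrum ℂ C) := by
    intro z hz
    by_cases h1 : z = 1
    · subst h1
      have : ContinuousWithinAt (fun _ : ℂ => (0 : ℂ)) (spectrum ℂ C) 1 :=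
        continuousWithinAt_const
      refine this.congr_of_eventuallyEq ?_ (by simp [G])
      filter_upwards [hnear] with z hz
      simp [G, hz]
    · refine ContinuousAt.continuousWithinAt ?_
      have h2 : ContinuousAt (fun z : ℂ => (f ((I * (1 + z) / (1 - z)).re) : ℂ) *
          ((2 * I) / (1 - z))) z :=
        (hcont z h1).mul (ContinuousAt.div (by fun_prop) (by fun_prop)
          (sub_ne_zero.2 (Ne.symm h1)))
      refine h2.congr ?_
      filter_upwards [isOpen_ne.mem_nhds h1] with w hw
      have hw' : w ≠ 1 := hw
      simp [G, F, hw']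
  have hnorm : IsStarNormal C := ⟨by
    have h := Unitary.mem_iff.1 (cayley_mem_unitary hD)
    rw [commute_iff_eq, h.1, h.2]⟩
  let K : ℂ → ℂ := fun z => (2 * I)⁻¹ * (1 - z)
  have hK : cfc K C = R := by
    have e : K = fun z => (2 * I)⁻¹ • (1 - z) := by ext; simp [K]
    rw [e, cfc_smul (R := ℂ) (2 * I)⁻¹ (fun z => 1 - z) C, cfc_sub (fun _ => 1) (fun z => z) C,
      cfc_const_one ℂ C, cfc_id' ℂ C, hC, cayley, sub_sub_cancel, smul_smul,
      inv_mul_cancel₀ (by simp), one_smul]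
  have hFG : funcCalc hD f = R * cfc G C := by
    rw [← hK, ← cfc_mul K G C (by fun_prop) hGc]
    refine cfc_congr fun z hz => ?_
    by_cases h1 : z = 1
    · simp [h1, K]
    · have hd : 1 - z ≠ 0 := sub_ne_zero.2 (Ne.symm h1)
      simp only [K, G, F, if_neg h1]
      field_simp
  refine ⟨cfc G C - I • funcCalc hD f, fun x => ?_⟩
  obtain ⟨h, e⟩ := resolvent_spec hD ((cfc G C).1 x)
  have hx : (funcCalc hD f).1 x = (resolvent hD).1 ((cfc G C).1 x) := by rw [hFG]; rfl
  refine ⟨by rw [hx]; exact h, ?_⟩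
  change (cfc G C).1 x - I • (funcCalc hD f).1 x = _
  rw [sub_eq_iff_eq_add]
  simp only [hx]
  exact e.symm

/-- The bounded adjointable operator `D f(D)`. -/
noncomputable def mulFuncCalc {D : X →ₗ.[ℂ] X} (hD : IsSelfAdjointRegular A D) {f : ℝ → ℝ}
    (hf : Continuous f) (hc : HasCompactSupport f) : Adj A X :=
  Classical.choose (exists_mul_funcCalc hD hf hc)

lemma mulFuncCalc_apply {D : X →ₗ.[ℂ] X} (hD : IsSelfAdjointRegular A D) {f : ℝ → ℝ}
    (hf : Continuous f) (hc : HasCompactSupport f) (x : X) :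
    ∃ h : (funcCalc hD f).1 x ∈ D.domain,
      (mulFuncCalc hD hf hc).1 x = D ⟨(funcCalc hD f).1 x, h⟩ :=
  Classical.choose_spec (exists_mul_funcCalc hD hf hc) x

end UnboundedOperators
section Localizer

/-- The Fourier transform `p ↦ (2π)^{-1/2} ∫ f(x) e^{-ixp} dx`. -/
noncomputable def unitaryFourier (f : ℝ → ℝ) (p : ℝ) : ℂ :=
  (1 / √(2 * Real.pi) : ℝ) * ∫ x : ℝ, (f x : ℂ) * exp (-(I * x * p))

/-- Localizing functions `φ : ℝ → [0, 1]`. -/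
structure LocalizingFunction where
  toFun : ℝ → ℝ
  continuous_toFun : Continuous toFun
  mem_Icc : ∀ x, toFun x ∈ Set.Icc (0 : ℝ) 1
  even : ∀ x, toFun (-x) = toFun x
  integrable : MeasureTheory.Integrable toFun
  tsupport_subset : tsupport toFun ⊆ Set.Icc (-1) 1
  eq_one : ∀ x ∈ Set.Icc (-1 / 2 : ℝ) (1 / 2), toFun x = 1
  antitone : ∀ x₀ x₁, 0 ≤ x₀ → x₀ ≤ x₁ → toFun x₁ ≤ toFun x₀
  integrable_mul_fourier : MeasureTheory.Integrable (fun p : ℝ => (p : ℂ) * unitaryFourier toFun p)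

/-- The constant `c_φ = 2 ‖p φ̂(p)‖₁ / √(2π)`. -/
noncomputable def LocalizingFunction.const (φ : LocalizingFunction) : ℝ :=
  2 * (∫ p : ℝ, ‖(p : ℂ) * unitaryFourier φ.toFun p‖) / √(2 * Real.pi)

/-- The rescaled function `φ_ρ(x) = φ(x / ρ)`. -/
noncomputable def LocalizingFunction.scale (φ : LocalizingFunction) (ρ : ℝ) (x : ℝ) : ℝ :=
  φ.toFun (x / ρ)

lemma LocalizingFunction.continuous_scale (φ : LocalizingFunction) (ρ : ℝ) :
    Continuous (φ.scale ρ) :=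
  φ.continuous_toFun.comp (continuous_id.div_const ρ)

lemma LocalizingFunction.hasCompactSupport_scale (φ : LocalizingFunction) {ρ : ℝ} (hρ : 0 < ρ) :
    HasCompactSupport (φ.scale ρ) := by
  refine HasCompactSupport.intro (isCompact_Icc (a := -ρ) (b := ρ)) fun x hx => ?_
  by_contra h
  apply hx
  have h1 := φ.tsupport_subset (subset_tsupport _ h)
  rw [Set.mem_Icc, le_div_iff₀ hρ, div_le_iff₀ hρ] at h1
  exact ⟨by linarith [h1.1], by linarith [h1.2]⟩

/-- A C⋆-algebra is `σ`-unital if it has a countable approximate unit. -/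
def IsSigmaUnital (B : Type*) [NonUnitalCStarAlgebra B] [PartialOrder B] : Prop :=
  ∃ e : ℕ → B, (∀ n, 0 ≤ e n ∧ ‖e n‖ ≤ 1) ∧
    ∀ b, Filter.Tendsto (fun n => e n * b) Filter.atTop (nhds b) ∧
      Filter.Tendsto (fun n => b * e n) Filter.atTop (nhds b)

variable (A X : Type*) [NonUnitalCStarAlgebra A] [PartialOrder A] [StarOrderedRing A]
  [NormedAddCommGroup X] [NormedSpace ℂ X] [SMul A X] [CStarModule A X] [CompleteSpace X]

/-- Even unbounded Kasparov modules `(X, D)`: the Hilbert C⋆-module `X` is countably generated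
and graded by the selfadjoint unitary `γ`, and `D` is an odd selfadjoint and regular unbounded
operator with compact resolvent. -/
structure EvenKasparovModule where
  countablyGenerated : ∃ ξ : ℕ → X,
    Dense (Submodule.span ℂ {x : X | ∃ (n : ℕ) (a : A), x = a • ξ n} : Set X)
  γ : Adj A X
  γ_selfAdjoint : star γ = γ
  γ_sq : γ * γ = 1
  D : X →ₗ.[ℂ] X
  selfAdjointRegular : IsSelfAdjointRegular A D
  odd : ∀ x : D.domain, ∃ h : γ.1 (x : X) ∈ D.domain, D ⟨γ.1 (x : X), h⟩ = -γ.1 (D x)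
  compact_resolvent : resolvent selfAdjointRegular ∈ (compactOps A X).toSubmodule

variable {A X}

/-- `T` is a Lipschitz operator with respect to `D`: it preserves `Dom(D)` and the commutator
`[D, T] : Dom(D) → X` extends to a bounded adjointable operator. -/
def IsLipschitz (D : X →ₗ.[ℂ] X) (T : Adj A X) : Prop :=
  ∃ δ : Adj A X, ∀ x : D.domain, ∃ h : T.1 (x : X) ∈ D.domain,
    δ.1 (x : X) = D ⟨T.1 (x : X), h⟩ - T.1 (D x)

/-- The bounded adjointable extension `d(T)` of `[D, T]`; it is unique as `Dom(D)` is dense. -/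
noncomputable def lipDeriv {D : X →ₗ.[ℂ] X} {T : Adj A X} (hT : IsLipschitz D T) : Adj A X :=
  Classical.choose hT

/-- The gap `g = ‖H⁻¹‖⁻¹` of an invertible operator. -/
noncomputable def gap (H : Adj A X) : ℝ := ‖Ring.inverse H‖⁻¹

/-- The spectral localizer
`L_{κ,ρ} = Φ_ρ γ H Φ_ρ + κ Φ_{2ρ} D Φ_{2ρ} - (1 - Φ_{2ρ}⁴)^{1/2} γ`, where `Φ_ρ = φ_ρ(D)`. -/
noncomputable def localizer (K : EvenKasparovModule A X) (H : Adj A X) (φ : LocalizingFunction)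
    (κ : ℝ) {ρ : ℝ} (hρ : 0 < ρ) : Adj A X :=
  let Φ : ℝ → Adj A X := fun r => funcCalc K.selfAdjointRegular (φ.scale r)
  Φ ρ * K.γ * H * Φ ρ
    + (κ : ℂ) • (Φ (2 * ρ) * mulFuncCalc K.selfAdjointRegular (φ.continuous_scale (2 * ρ))
        (φ.hasCompactSupport_scale (mul_pos two_pos hρ)))
    - cfc Real.sqrt (1 - Φ (2 * ρ) ^ 4) * K.γ

/-- The quantity `C_{κ,ρ} = (κ + c_φ ‖H‖ / ρ) ‖d(H)‖`. -/
noncomputable def locConst (φ : LocalizingFunction) {D : X →ₗ.[ℂ] X} {H : Adj A X}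
    (hH : IsLipschitz D H) (κ ρ : ℝ) : ℝ :=
  (κ + φ.const * ‖H‖ / ρ) * ‖lipDeriv hH‖

/-- Admissibility of the pair `(κ, ρ)` of strictly positive numbers. -/
def Admissible (φ : LocalizingFunction) {D : X →ₗ.[ℂ] X} {H : Adj A X}
    (hH : IsLipschitz D H) (κ ρ : ℝ) : Prop :=
  0 < κ ∧ 0 < ρ ∧ locConst φ hH κ ρ < min (gap H ^ 2) (κ ^ 2 * ρ ^ 2 / 4)

end Localizer

end SpecLoc

open SpecLoc

/-! Write Φ = φ_ρ(D), P = D φ_{2ρ}(D)² and S = (1 - φ_{2ρ}(D)⁴)^{1/2}, so that the localizer is L =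
ΦγHΦ + κP - Sγ. It is selfadjoint, so a strictly positive lower bound for L² gives invertibility.

The square simplifies for two reasons. Since φ_{2ρ} = 1 on the support of φ_ρ, one has SΦ = 0 and PΦ
= DΦ. Since γ commutes with H and with even functions of D but anticommutes with odd ones, the terms
mixing P and Sγ cancel, and the terms mixing ΦγHΦ and P collapse to a compression of [D,H]. With δ =
d(H) this gives (`localizer_sq`) L² = Φ²H²Φ² + κ²P² + S² + ΦNΦ, where N = ΦH[Φ,H] - [Φ,H]ΦH - κγδ.

The analytic input is ‖[Φ,H]‖ ≤ c_φ/(2ρ) ‖δ‖ (`norm_funcCalc_commutator_le`), whence ‖N‖ ≤ C_{κ,ρ}.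
For a bounded operator in place of D it follows from Fourier inversion and ‖[e^{ita},H]‖ ≤ |t|
‖[a,H]‖. For D itself one uses the bounded functions l²D/(D² + l²), whose commutators with H are
bounded by ‖δ‖ uniformly in l, and a strong limit.

With H² ≥ g² and ΦNΦ ≥ -CΦ², the operator L² dominates a function of D alone, namely g²φ_ρ⁴ +
κ²x²φ_{2ρ}⁴ + 1 - φ_{2ρ}⁴ - Cφ_ρ². Admissibility is what keeps this function away from zero
(`LocalizingFunction.exists_lower_bound`).

Finally -γ - L = (S - 1)γ - ΦγHΦ - κP. Here S - 1, Φ and P are compactly supported functions of D;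
such functions factor through the resolvent, hence are compact. Part (2) is elementary algebra. -/

namespace SpecLoc

open Complex Filter Topology

/-! ### Functions on the line with a limit at infinity, viewed as functions on the circle. -/

section CircleFunctions

/-- The inverse Cayley transform `z ↦ i(1 + z)(1 - z)⁻¹` as a real number. -/
noncomputable def cayleyCoord (z : ℂ) : ℝ := (I * (1 + z) / (1 - z)).re

open Classical in
/-- The function on the circle that corresponds to `f` on `ℝ`, with the value `c` at `1`. -/
noncomputable def circleExt (f : ℝ → ℂ) (c : ℂ) (z : ℂ) : ℂ :=
  if z = 1 then c else f (cayleyCoord z)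

/-- `f` is continuous and tends to `c` at infinity. -/
structure HasLimAtInfty (f : ℝ → ℂ) (c : ℂ) : Prop where
  continuous : Continuous f
  tendsto : Tendsto f (cocompact ℝ) (𝓝 c)

lemma tendsto_ofReal_cobounded :
    Tendsto (fun x : ℝ => (x : ℂ)) (cocompact ℝ) (Bornology.cobounded ℂ) := by
  rw [← tendsto_norm_atTop_iff_cobounded]
  simpa only [norm_real] using tendsto_norm_cocompact_atTop (E := ℝ)

namespace HasLimAtInfty

variable {f g : ℝ → ℂ} {c d : ℂ}

lemma add (hf : HasLimAtInfty f c) (hg : HasLimAtInfty g d) :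
    HasLimAtInfty (fun x => f x + g x) (c + d) :=
  ⟨hf.continuous.add hg.continuous, hf.tendsto.add hg.tendsto⟩

lemma sub (hf : HasLimAtInfty f c) (hg : HasLimAtInfty g d) :
    HasLimAtInfty (fun x => f x - g x) (c - d) :=
  ⟨hf.continuous.sub hg.continuous, hf.tendsto.sub hg.tendsto⟩

lemma mul (hf : HasLimAtInfty f c) (hg : HasLimAtInfty g d) :
    HasLimAtInfty (fun x => f x * g x) (c * d) :=
  ⟨hf.continuous.mul hg.continuous, hf.tendsto.mul hg.tendsto⟩

lemma const (c : ℂ) : HasLimAtInfty (fun _ => c) c :=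
  ⟨continuous_const, tendsto_const_nhds⟩

lemma comp {F : ℂ → ℂ} (hF : Continuous F) (hf : HasLimAtInfty f c) :
    HasLimAtInfty (fun x => F (f x)) (F c) :=
  ⟨hF.comp hf.continuous, (hF.tendsto c).comp hf.tendsto⟩

lemma of_hasCompactSupport {f : ℝ → ℝ} (hf : Continuous f) (hc : HasCompactSupport f) :
    HasLimAtInfty (fun x => (f x : ℂ)) 0 :=
  ⟨by fun_prop, by
    have h := (continuous_ofReal.tendsto 0).comp hc.is_zero_at_infty
    simpa [Function.comp_def] using h⟩

lemma ofReal_add_mul_I_ne_zero {s : ℝ} (hs : s ≠ 0) (x : ℝ) : (x : ℂ) + s * I ≠ 0 := by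
  intro h
  have := congrArg Complex.im h
  simp at this
  exact hs this

lemma inv_add_mul_I {s : ℝ} (hs : s ≠ 0) :
    HasLimAtInfty (fun x => ((x : ℂ) + s * I)⁻¹) 0 := by
  refine ⟨Continuous.inv₀ (by fun_prop) (ofReal_add_mul_I_ne_zero hs), ?_⟩
  exact tendsto_inv₀_cobounded.comp
    ((tendsto_add_const_cobounded _).comp tendsto_ofReal_cobounded)

lemma mul_inv_add_mul_I {s : ℝ} (hs : s ≠ 0) :
    HasLimAtInfty (fun x => (x : ℂ) * ((x : ℂ) + s * I)⁻¹) 1 := by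
  have h := (const 1).sub ((const (s * I)).mul (inv_add_mul_I hs))
  have e : (fun x : ℝ => (1 : ℂ) - s * I * ((x : ℂ) + s * I)⁻¹)
      = fun x : ℝ => (x : ℂ) * ((x : ℂ) + s * I)⁻¹ := by
    ext x
    field_simp [ofReal_add_mul_I_ne_zero hs x]
    ring
  rw [e] at h
  simpa using h

end HasLimAtInfty

/-- On the circle conj z = z⁻¹, so the Möbius value is already real and taking the real part loses
nothing. -/
lemma ofReal_cayleyCoord {z : ℂ} (hz : z ∈ Metric.sphere (0 : ℂ) 1) (h1 : z ≠ 1) :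
    (cayleyCoord z : ℂ) = I * (1 + z) / (1 - z) := by
  have hn : z * (starRingEnd ℂ) z = 1 := by
    have := mem_sphere_zero_iff_norm.1 hz
    rw [mul_conj, normSq_eq_norm_sq, this]; simp
  have hd : 1 - z ≠ 0 := sub_ne_zero.2 (Ne.symm h1)
  have hd' : 1 - (starRingEnd ℂ) z ≠ 0 := by
    intro h
    apply hd
    have := congrArg (starRingEnd ℂ) h
    simpa using this
  have hreal : (starRingEnd ℂ) (I * (1 + z) / (1 - z)) = I * (1 + z) / (1 - z) := by
    simp only [map_div₀, map_mul, conj_I, map_add, map_sub, map_one]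
    rw [div_eq_div_iff hd' hd]
    linear_combination (2 * I) * hn
  exact conj_eq_iff_re.1 hreal

/-- The modulus is ‖1 + z‖ / ‖1 - z‖, with numerator tending to 2 and denominator to 0. Thus a limit
at infinity becomes continuity at the point 1. -/
lemma tendsto_cayleyCoord :
    Tendsto cayleyCoord (𝓝[Metric.sphere (0 : ℂ) 1 \ {1}] 1) (cocompact ℝ) := by
  rw [← Metric.cobounded_eq_cocompact, ← tendsto_norm_atTop_iff_cobounded]
  have h0 : Tendsto (fun z : ℂ => ‖1 + z‖ * ‖1 - z‖⁻¹) (𝓝[≠] 1) atTop := by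
    refine Tendsto.pos_mul_atTop (C := 2) (by norm_num) ?_ ?_
    · have : ContinuousAt (fun z : ℂ => ‖1 + z‖) 1 := by fun_prop
      have h := this.tendsto
      norm_num at h
      exact h.mono_left nhdsWithin_le_nhds
    · refine Tendsto.inv_tendsto_nhdsGT_zero ?_
      rw [tendsto_nhdsWithin_iff]
      refine ⟨?_, ?_⟩
      · have : ContinuousAt (fun z : ℂ => ‖1 - z‖) 1 := by fun_prop
        have h := this.tendsto
        simp only [sub_self, norm_zero] at h
        exact h.mono_left nhdsWithin_le_nhds
      · filter_upwards [self_mem_nhdsWithin] with z hz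
        exact norm_pos_iff.2 (sub_ne_zero.2 (Ne.symm hz))
  refine (h0.mono_left (nhdsWithin_mono _ fun z hz => hz.2)).congr' ?_
  filter_upwards [self_mem_nhdsWithin] with z hz
  rw [← norm_real (cayleyCoord z), ofReal_cayleyCoord hz.1 hz.2]
  simp [div_eq_mul_inv]

lemma continuousOn_circleExt {f : ℝ → ℂ} {c : ℂ} (hf : HasLimAtInfty f c) :
    ContinuousOn (circleExt f c) (Metric.sphere 0 1) := by
  intro z hz
  by_cases h1 : z = 1
  · subst h1
    have h := hf.tendsto.comp tendsto_cayleyCoord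
    have : ContinuousWithinAt (circleExt f c) (Metric.sphere (0 : ℂ) 1 \ {1}) 1 := by
      rw [ContinuousWithinAt]
      have e : circleExt f c 1 = c := by simp [circleExt]
      rw [e]
      refine h.congr' ?_
      filter_upwards [self_mem_nhdsWithin] with w hw
      have : w ≠ 1 := hw.2
      simp [circleExt, this]
    exact continuousWithinAt_sdiff_self.1 this
  · refine ContinuousAt.continuousWithinAt ?_
    have h2 : ContinuousAt cayleyCoord z := by
      refine continuous_re.continuousAt.comp (ContinuousAt.div (by fun_prop) (by fun_prop) ?_)
      exact sub_ne_zero.2 (Ne.symm h1)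
    refine (ContinuousAt.comp (f := cayleyCoord) hf.continuous.continuousAt h2).congr ?_
    filter_upwards [isOpen_ne.mem_nhds h1] with w hw
    have hw' : w ≠ 1 := hw
    simp [circleExt, hw']

/-- Complex conjugation on the circle is the sign change x ↦ -x on the line; this turns γ C γ = C*
into γ f(D) γ = f(-D). -/
lemma circleExt_conj (f : ℝ → ℂ) (c : ℂ) {z : ℂ} (hz : z ∈ Metric.sphere (0 : ℂ) 1) :
    circleExt f c (star z) = circleExt (fun x => f (-x)) c z := by
  by_cases h1 : z = 1
  · simp [circleExt, h1]
  have h2 : star z ≠ 1 := by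
    intro h; apply h1; rw [← star_star z, h, star_one]
  have hz' : star z ∈ Metric.sphere (0 : ℂ) 1 := by
    simpa using hz
  simp only [circleExt, if_neg h1, if_neg h2]
  congr 1
  have hn : z * star z = 1 := by
    have := mem_sphere_zero_iff_norm.1 hz
    change z * (starRingEnd ℂ) z = 1
    rw [mul_conj, normSq_eq_norm_sq, this]; simp
  apply ofReal_injective
  rw [ofReal_neg, ofReal_cayleyCoord hz' h2, ofReal_cayleyCoord hz h1]
  have hd : 1 - z ≠ 0 := sub_ne_zero.2 (Ne.symm h1)
  have hd' : 1 - star z ≠ 0 := sub_ne_zero.2 (Ne.symm h2)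
  rw [← neg_div, div_eq_div_iff hd' hd]
  linear_combination (-2 * I) * hn

end CircleFunctions

/-! ### Functional calculus of D through its Cayley transform. -/

section Calculus

variable {A X : Type*} [NonUnitalCStarAlgebra A] [PartialOrder A] [StarOrderedRing A]
  [NormedAddCommGroup X] [NormedSpace ℂ X] [SMul A X] [CStarModule A X]

lemma spectrum_cayley_subset [CompleteSpace X] {D : X →ₗ.[ℂ] X} (hD : IsSelfAdjointRegular A D) :
    spectrum ℂ (cayley hD) ⊆ Metric.sphere 0 1 :=
  spectrum.subset_circle_of_unitary (cayley_mem_unitary hD)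

instance isStarNormal_cayley {D : X →ₗ.[ℂ] X} (hD : IsSelfAdjointRegular A D) :
    IsStarNormal (cayley hD) := ⟨by
  have h := Unitary.mem_iff.1 (cayley_mem_unitary hD)
  rw [commute_iff_eq, h.1, h.2]⟩

variable [CompleteSpace X]

/-- The functional calculus `f ↦ f(D)` for continuous functions with limit `c` at infinity. -/
noncomputable def limCalc {D : X →ₗ.[ℂ] X} (hD : IsSelfAdjointRegular A D) (f : ℝ → ℂ) (c : ℂ) :
    Adj A X :=
  cfc (circleExt f c) (cayley hD)

lemma funcCalc_eq_limCalc {D : X →ₗ.[ℂ] X} (hD : IsSelfAdjointRegular A D) (f : ℝ → ℝ) :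
    funcCalc hD f = limCalc hD (fun x => (f x : ℂ)) 0 := rfl

variable {D : X →ₗ.[ℂ] X} (hD : IsSelfAdjointRegular A D) {f g : ℝ → ℂ} {c d : ℂ}

lemma HasLimAtInfty.continuousOn (hf : HasLimAtInfty f c) :
    ContinuousOn (circleExt f c) (spectrum ℂ (cayley hD)) :=
  (continuousOn_circleExt hf).mono (spectrum_cayley_subset hD)

lemma limCalc_add (hf : HasLimAtInfty f c) (hg : HasLimAtInfty g d) :
    limCalc hD (fun x => f x + g x) (c + d) = limCalc hD f c + limCalc hD g d := by
  rw [limCalc, limCalc, limCalc, ← cfc_add _ _ _ (hf.continuousOn hD) (hg.continuousOn hD)]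
  congr 1
  ext z
  simp only [circleExt]
  split_ifs <;> rfl

lemma limCalc_mul (hf : HasLimAtInfty f c) (hg : HasLimAtInfty g d) :
    limCalc hD (fun x => f x * g x) (c * d) = limCalc hD f c * limCalc hD g d := by
  rw [limCalc, limCalc, limCalc, ← cfc_mul _ _ _ (hf.continuousOn hD) (hg.continuousOn hD)]
  congr 1
  ext z
  simp only [circleExt]
  split_ifs <;> rfl

lemma limCalc_const (c : ℂ) : limCalc hD (fun _ => c) c = c • (1 : Adj A X) := by
  have e : circleExt (fun _ => c) c = fun _ => c := by ext z; simp [circleExt]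
  rw [limCalc, e, cfc_const c _, Algebra.algebraMap_eq_smul_one]

lemma limCalc_smul (a : ℂ) (hf : HasLimAtInfty f c) :
    limCalc hD (fun x => a * f x) (a * c) = a • limCalc hD f c := by
  rw [limCalc_mul hD (HasLimAtInfty.const a) hf, limCalc_const, smul_one_mul]

lemma limCalc_sub (hf : HasLimAtInfty f c) (hg : HasLimAtInfty g d) :
    limCalc hD (fun x => f x - g x) (c - d) = limCalc hD f c - limCalc hD g d := by
  rw [limCalc, limCalc, limCalc, ← cfc_sub _ _ _ (hf.continuousOn hD) (hg.continuousOn hD)]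
  congr 1
  ext z
  simp only [circleExt]
  split_ifs <;> rfl

lemma star_limCalc (f : ℝ → ℂ) (c : ℂ) :
    star (limCalc hD f c) = limCalc hD (fun x => star (f x)) (star c) := by
  rw [limCalc, limCalc, ← cfc_star]
  congr 1
  ext z
  simp only [circleExt]
  split_ifs <;> rfl

lemma isSelfAdjoint_limCalc (f : ℝ → ℝ) (c : ℝ) :
    IsSelfAdjoint (limCalc hD (fun x => (f x : ℂ)) c) := by
  rw [IsSelfAdjoint, star_limCalc]
  congr 1
  · ext x; exact conj_ofReal _
  · exact conj_ofReal _

lemma norm_limCalc_le {b : ℝ} (h : ∀ x, ‖f x‖ ≤ b) (hc : ‖c‖ ≤ b) :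
    ‖limCalc hD f c‖ ≤ b := by
  refine norm_cfc_le ((norm_nonneg _).trans hc) fun z _ => ?_
  simp only [circleExt]
  split_ifs
  exacts [hc, h _]

lemma limCalc_comp {F : ℂ → ℂ} (hF : Continuous F) (hf : HasLimAtInfty f c) :
    cfc F (limCalc hD f c) = limCalc hD (fun x => F (f x)) (F c) := by
  rw [limCalc, limCalc, ← cfc_comp' F _ _ hF.continuousOn (hf.continuousOn hD)]
  congr 1
  ext z
  simp only [circleExt]
  split_ifs <;> rfl

/-- If z is the Cayley transform of x, then x + i = 2i / (1 - z), so (x + i)⁻¹ is the polynomial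
(2i)⁻¹(1 - z), matching the definition of `cayley`. -/
lemma resolvent_eq_limCalc : resolvent hD = limCalc hD (fun x => ((x : ℂ) + I)⁻¹) 0 := by
  have hK : cfc (fun z : ℂ => (2 * I)⁻¹ • (1 - z)) (cayley hD) = resolvent hD := by
    rw [cfc_smul (R := ℂ) (2 * I)⁻¹ (fun z => 1 - z) _, cfc_sub (fun _ => 1) (fun z => z) _,
      cfc_const_one ℂ _, cfc_id' ℂ _, cayley, sub_sub_cancel, smul_smul,
      inv_mul_cancel₀ (by simp), one_smul]
  rw [← hK, limCalc]
  refine cfc_congr fun z hz => ?_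
  by_cases h1 : z = 1
  · simp [h1, circleExt]
  · have hd : 1 - z ≠ 0 := sub_ne_zero.2 (Ne.symm h1)
    simp only [circleExt, if_neg h1, ofReal_cayleyCoord (spectrum_cayley_subset hD hz) h1]
    rw [smul_eq_mul, show I * (1 + z) / (1 - z) + I = 2 * I / (1 - z) by field_simp; ring,
      inv_div]
    field_simp

lemma HasLimAtInfty.inv_add_I : HasLimAtInfty (fun x => ((x : ℂ) + I)⁻¹) 0 := by
  simpa using HasLimAtInfty.inv_add_mul_I (s := 1) one_ne_zero

lemma ofReal_add_I_ne_zero (x : ℝ) : (x : ℂ) + I ≠ 0 := by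
  simpa using HasLimAtInfty.ofReal_add_mul_I_ne_zero (s := 1) one_ne_zero x

/-- Away from 0, f is x⁻¹ times a function with a finite limit; the value 0 at infinity is therefore
forced. -/
lemma HasLimAtInfty.of_ofReal_mul (hf : Continuous f)
    (hxf : HasLimAtInfty (fun x => x * f x) c) : HasLimAtInfty f 0 := by
  refine ⟨hf, ?_⟩
  have hinv := tendsto_inv₀_cobounded.comp tendsto_ofReal_cobounded
  have h4 := hinv.mul hxf.tendsto
  rw [zero_mul] at h4
  refine h4.congr' ?_
  have : ∀ᶠ x : ℝ in cocompact ℝ, x ≠ 0 :=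
    (isCompact_singleton (x := (0 : ℝ))).compl_mem_cocompact
  filter_upwards [this] with x hx
  have : (x : ℂ) ≠ 0 := by exact_mod_cast hx
  change (x : ℂ)⁻¹ * (x * f x) = f x
  field_simp

/-- The factorization f = (x + i)⁻¹ (x f + i f) of functions. It yields that f(D) maps into the
domain, that f(D) can be moved past D, and that f(D) is compact when the resolvent is. -/
lemma limCalc_zero_eq_resolvent_mul (hf : Continuous f)
    (hxf : HasLimAtInfty (fun x => x * f x) c) :
    limCalc hD f 0 = resolvent hD * (limCalc hD (fun x => x * f x) c + I • limCalc hD f 0) := by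
  have hf0 := HasLimAtInfty.of_ofReal_mul hf hxf
  have hI := (HasLimAtInfty.const I).mul hf0
  rw [← limCalc_smul hD I hf0, ← limCalc_add hD hxf hI, resolvent_eq_limCalc,
    ← limCalc_mul hD HasLimAtInfty.inv_add_I (hxf.add hI), zero_mul]
  congr 1
  ext x
  have := ofReal_add_I_ne_zero x
  field_simp

/-- If `f` and `x f(x)` have limits at infinity, then `f(D)` maps into `Dom(D)`. -/
lemma limCalc_apply_mem (hf : Continuous f) (hxf : HasLimAtInfty (fun x => x * f x) c) (v : X) :
    ∃ h : (limCalc hD f 0).1 v ∈ D.domain,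
      D ⟨(limCalc hD f 0).1 v, h⟩ = (limCalc hD (fun x => x * f x) c).1 v := by
  set T := limCalc hD (fun x => x * f x) c
  have e := limCalc_zero_eq_resolvent_mul hD hf hxf
  have e' : (limCalc hD f 0).1 v = (resolvent hD).1 ((T + I • limCalc hD f 0).1 v) := by
    conv_lhs => rw [e]
    rfl
  obtain ⟨h, h'⟩ := resolvent_spec hD ((T + I • limCalc hD f 0).1 v)
  refine ⟨by rw [e']; exact h, ?_⟩
  have h2 : D ⟨(limCalc hD f 0).1 v, by rw [e']; exact h⟩ + I • (limCalc hD f 0).1 v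
      = T.1 v + I • (limCalc hD f 0).1 v := by
    simp only [e'] at h' ⊢
    rw [h', ← e']
    rfl
  exact add_right_cancel h2

/-- The resolvent factor is moved to the right and applied to (D + i)w, where it returns w; the
summands with the factor i then cancel. -/
lemma limCalc_apply_map (hf : Continuous f) (hxf : HasLimAtInfty (fun x => x * f x) c)
    (w : D.domain) :
    (limCalc hD f 0).1 (D w) = (limCalc hD (fun x => x * f x) c).1 (w : X) := by
  have hf0 := HasLimAtInfty.of_ofReal_mul hf hxf
  have e := limCalc_zero_eq_resolvent_mul hD hf hxf
  have hcomm : resolvent hD * (limCalc hD (fun x => x * f x) c + I • limCalc hD f 0)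
      = (limCalc hD (fun x => x * f x) c + I • limCalc hD f 0) * resolvent hD := by
    have hI := (HasLimAtInfty.const I).mul hf0
    rw [← limCalc_smul hD I hf0, ← limCalc_add hD hxf hI, resolvent_eq_limCalc,
      ← limCalc_mul hD HasLimAtInfty.inv_add_I (hxf.add hI),
      ← limCalc_mul hD (hxf.add hI) HasLimAtInfty.inv_add_I, mul_comm]
    congr 1
    ext x
    ring
  rw [hcomm] at e
  have h := congrArg (fun T : Adj A X => T.1 (D w + I • (w : X))) e
  change (limCalc hD f 0).1 (D w + I • (w : X))
    = (limCalc hD (fun x => x * f x) c).1 ((resolvent hD).1 (D w + I • (w : X)))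
      + I • (limCalc hD f 0).1 ((resolvent hD).1 (D w + I • (w : X))) at h
  rw [resolvent_left, map_add, map_smul] at h
  exact add_right_cancel h

/-- `mulFuncCalc` comes from a choice, but its values D f(D)v determine it, which brings it into the
calculus. -/
lemma mulFuncCalc_eq_limCalc {f : ℝ → ℝ} (hf : Continuous f) (hc : HasCompactSupport f) :
    mulFuncCalc hD hf hc = limCalc hD (fun x => x * (f x : ℂ)) 0 := by
  refine Adj.ext fun v => ?_
  obtain ⟨h, e⟩ := mulFuncCalc_apply hD hf hc v
  have hxf : HasLimAtInfty (fun x => x * (f x : ℂ)) 0 := by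
    have := HasLimAtInfty.of_hasCompactSupport (f := fun x => x * f x) (by fun_prop)
      (hc.mul_left)
    simpa using this
  obtain ⟨h', e'⟩ := limCalc_apply_mem hD (f := fun x => (f x : ℂ)) (by fun_prop) hxf v
  rw [e, ← e']
  rfl

/-- Compression of the commutator `[D, T]` by functions of `D`. -/
lemma limCalc_mul_lipDeriv_mul {T δ : Adj A X}
    (hT : ∀ x : D.domain, ∃ h : T.1 (x : X) ∈ D.domain,
      δ.1 (x : X) = D ⟨T.1 (x : X), h⟩ - T.1 (D x))
    (hf : Continuous f) (hxf : HasLimAtInfty (fun x => x * f x) c)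
    (hg : Continuous g) (hxg : HasLimAtInfty (fun x => x * g x) d) :
    limCalc hD f 0 * δ * limCalc hD g 0
      = limCalc hD (fun x => x * f x) c * T * limCalc hD g 0
        - limCalc hD f 0 * T * limCalc hD (fun x => x * g x) d := by
  refine Adj.ext fun v => ?_
  obtain ⟨h, e⟩ := limCalc_apply_mem hD hg hxg v
  obtain ⟨h', e'⟩ := hT ⟨_, h⟩
  change (limCalc hD f 0).1 (δ.1 ((limCalc hD g 0).1 v))
    = (limCalc hD (fun x => x * f x) c).1 (T.1 ((limCalc hD g 0).1 v))
      - (limCalc hD f 0).1 (T.1 ((limCalc hD (fun x => x * g x) d).1 v))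
  -- In f(D)[D,T]g(D) the left D is absorbed by f(D), the right one by g(D); both resulting factors
  -- are bounded.
  rw [e', map_sub, limCalc_apply_map hD hf hxf, e]

lemma limCalc_zero_mem_compactOps (hK : resolvent hD ∈ (compactOps A X).toSubmodule)
    (hf : Continuous f) (hxf : HasLimAtInfty (fun x => x * f x) c) :
    limCalc hD f 0 ∈ (compactOps A X).toSubmodule := by
  rw [limCalc_zero_eq_resolvent_mul hD hf hxf]
  exact (compactOps A X).mul_mem_right' _ hK

/-- Oddness gives γ(D + i)⁻¹γ = (-D + i)⁻¹ = -(D - i)⁻¹, so conjugation by γ exchanges the Cayley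
transform with its inverse. -/
lemma odd_mul_cayley_mul {γ : Adj A X} (hγ2 : γ * γ = 1)
    (hodd : ∀ x : D.domain, ∃ h : γ.1 (x : X) ∈ D.domain, D ⟨γ.1 (x : X), h⟩ = -γ.1 (D x)) :
    γ * cayley hD * γ = star (cayley hD) := by
  have hγγ : ∀ x, γ.1 (γ.1 x) = x := fun x => congrArg (fun T : Adj A X => T.1 x) hγ2
  have h1 : γ * resolvent hD * γ = -star (resolvent hD) := by
    have h2 : resolvent hD * γ = -(γ * star (resolvent hD)) := by
      refine Adj.ext fun v => ?_
      obtain ⟨h, e⟩ := star_resolvent_spec hD v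
      obtain ⟨h', e'⟩ := hodd ⟨_, h⟩
      have h3 := resolvent_left hD ⟨_, h'⟩
      rw [e'] at h3
      change (resolvent hD).1 (γ.1 v) = -γ.1 ((star (resolvent hD)).1 v)
      simp only at h3
      rw [← h3, ← map_neg]
      congr 1
      conv_lhs => rw [← e]
      rw [map_sub, map_smul]
      abel
    rw [mul_assoc, h2, mul_neg, ← mul_assoc, hγ2, one_mul]
  have hs : star (cayley hD) = 1 + (2 * I) • star (resolvent hD) := by
    simp [cayley, sub_eq_add_neg]
  rw [hs, cayley, mul_sub, sub_mul, mul_one, hγ2, mul_smul_comm, smul_mul_assoc, h1, smul_neg,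
    sub_neg_eq_add]

/-- A selfadjoint unitary `γ` with `Dγ = -γD` satisfies `γ f(D) γ = f(-D)`. -/
lemma odd_mul_limCalc_mul {γ : Adj A X} (hγ : star γ = γ) (hγ2 : γ * γ = 1)
    (hodd : ∀ x : D.domain, ∃ h : γ.1 (x : X) ∈ D.domain, D ⟨γ.1 (x : X), h⟩ = -γ.1 (D x))
    (hf : HasLimAtInfty f c) :
    γ * limCalc hD f c * γ = limCalc hD (fun x => f (-x)) c := by
  have hu : γ ∈ unitary (Adj A X) := Unitary.mem_iff.2 ⟨by rw [hγ, hγ2], by rw [hγ, hγ2]⟩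
  let F := Unitary.conjStarAlgAut ℂ (Adj A X) ⟨γ, hu⟩
  have hF : ∀ x, F x = γ * x * γ := fun x => by
    change γ * x * star γ = _
    rw [hγ]
  have hFc : Continuous F := by
    have : (F : Adj A X → Adj A X) = fun x => γ * x * γ := funext hF
    rw [this]
    fun_prop
  have hsub : spectrum ℂ (star (cayley hD)) ⊆ Metric.sphere 0 1 :=
    spectrum.subset_circle_of_unitary (Unitary.star_mem (cayley_mem_unitary hD))
  -- Conjugation by the unitary γ is a continuous `*`-automorphism and hence commutes with the
  -- functional calculus.
  have h1 := StarAlgHomClass.map_cfc F (circleExt f c) (cayley hD) (hf.continuousOn hD) hFc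
    inferInstance (by rw [hF, odd_mul_cayley_mul hD hγ2 hodd]; infer_instance)
  rw [hF, hF, odd_mul_cayley_mul hD hγ2 hodd] at h1
  rw [limCalc, h1, limCalc]
  rw [← cfc_comp_star _ _ ((continuousOn_circleExt hf).mono (by
    rintro _ ⟨z, hz, rfl⟩
    simpa using spectrum_cayley_subset hD hz))]
  exact cfc_congr fun z hz => circleExt_conj f c (spectrum_cayley_subset hD hz)

/-- The range contains Dom(D), since every x in the domain is the resolvent applied to (D + i)x. -/
lemma denseRange_resolvent : DenseRange (resolvent hD).1 := by
  refine hD.dense.mono fun x hx => ?_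
  exact ⟨_, resolvent_left hD ⟨x, hx⟩⟩

end Calculus

open MeasureTheory

/-! ### Commutators with functions of a bounded selfadjoint element. -/

section BoundedCommutator

variable {𝒜 : Type*} [CStarAlgebra 𝒜]

/-- The curve t ↦ e^{-ita} H e^{ita} has derivative -i e^{-ita}[a,H]e^{ita}, of norm at most ‖[a,H]‖
by unitarity. The mean value inequality bounds its distance from H, and multiplying by e^{ita} gives
the commutator. -/
lemma norm_exp_commutator_le {a : 𝒜} (ha : IsSelfAdjoint a) (H : 𝒜) (t : ℝ) :
    ‖NormedSpace.exp (t • (I • a)) * H - H * NormedSpace.exp (t • (I • a))‖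
      ≤ |t| * ‖a * H - H * a‖ := by
  have hsk : ∀ t : ℝ, t • (I • a) ∈ skewAdjoint 𝒜 := fun t => by
    rw [skewAdjoint.mem_iff, star_smul, star_smul, ha.star_eq]
    simp
  let +nondep : NormedAlgebra ℚ 𝒜 := .restrictScalars ℚ ℂ 𝒜
  have hexp : ∀ t : ℝ, NormedSpace.exp (t • (I • a)) ∈ unitary 𝒜 := fun t =>
    NormedSpace.exp_mem_unitary_of_mem_skewAdjoint (hsk t)
  let u : ℝ → 𝒜 := fun t => NormedSpace.exp (t • (I • a))
  let v : ℝ → 𝒜 := fun t => NormedSpace.exp (t • (-(I • a)))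
  have hv : ∀ t, v t = star (u t) := fun t => by
    simp only [u, v, NormedSpace.star_exp]
    rw [(skewAdjoint.mem_iff).1 (hsk t), smul_neg]
  have hu : ∀ t, u t ∈ unitary 𝒜 := hexp
  have hd : ∀ t, HasDerivAt (fun t => v t * H * u t) (-(I • (v t * (a * H - H * a) * u t))) t := by
    intro t
    have h1 : HasDerivAt u ((I • a) * u t) t := hasDerivAt_exp_smul_const' (𝕂 := ℝ) (I • a) t
    have h2 : HasDerivAt v (v t * (-(I • a))) t := hasDerivAt_exp_smul_const (𝕂 := ℝ) (-(I • a)) t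
    refine ((h2.mul_const H).mul h1).congr_deriv ?_
    simp only [mul_sub, sub_mul, smul_sub, mul_neg, neg_mul, smul_mul_assoc, mul_smul_comm,
      mul_assoc]
    abel
  have hb : ∀ t, ‖-(I • (v t * (a * H - H * a) * u t))‖ ≤ ‖a * H - H * a‖ := by
    intro t
    rw [norm_neg, norm_smul, norm_I, one_mul, CStarRing.norm_mul_mem_unitary _ (hu t), hv,
      CStarRing.norm_mem_unitary_mul _ (Unitary.star_mem (hu t))]
  have h := Convex.norm_image_sub_le_of_norm_hasDerivWithin_le (s := Set.univ) (x := 0) (y := t)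
    (fun t _ => (hd t).hasDerivWithinAt) (fun t _ => hb t) convex_univ trivial trivial
  have h0 : v 0 * H * u 0 = H := by simp [u, v]
  rw [h0, sub_zero, Real.norm_eq_abs, mul_comm] at h
  have e : u t * (v t * H * u t - H) = -(u t * H - H * u t) := by
    rw [mul_sub, ← mul_assoc, ← mul_assoc, hv, (Unitary.mem_iff.1 (hu t)).2, one_mul, neg_sub]
  calc ‖u t * H - H * u t‖ = ‖u t * (v t * H * u t - H)‖ := by rw [e, norm_neg]
    _ = ‖v t * H * u t - H‖ := CStarRing.norm_mem_unitary_mul _ (hu t)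
    _ ≤ _ := h

/-- For `f(x) = ∫ h(p) e^{ipsx} dp` one has `‖[f(a), H]‖ ≤ |s| ‖p h(p)‖₁ ‖[a, H]‖`. -/
lemma norm_cfc_integral_commutator_le {a : 𝒜} (ha : IsSelfAdjoint a) (H : 𝒜) {h : ℝ → ℂ}
    (hc : Continuous h) (hi : Integrable h) (hpi : Integrable (fun p : ℝ => (p : ℂ) * h p))
    (s : ℝ) :
    ‖cfc (fun z => ∫ p : ℝ, h p * exp ((p * s : ℝ) * (I * z))) a * H
        - H * cfc (fun z => ∫ p : ℝ, h p * exp ((p * s : ℝ) * (I * z))) a‖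
      ≤ |s| * (∫ p : ℝ, ‖(p : ℂ) * h p‖) * ‖a * H - H * a‖ := by
  have hn := ha.isStarNormal
  -- The spectrum is real, so the exponential has modulus 1 there and |h| dominates the integrand.
  have hb : ∀ p : ℝ, ∀ z ∈ spectrum ℂ a, ‖h p * exp ((p * s : ℝ) * (I * z))‖ ≤ ‖h p‖ := by
    intro p z hz
    rw [ha.mem_spectrum_eq_re hz, norm_mul, mul_left_comm, ← ofReal_mul, mul_comm I,
      norm_exp_ofReal_mul_I, mul_one]
  have hco : Continuous (Function.uncurry
      (fun (p : ℝ) (z : ℂ) => h p * exp ((p * s : ℝ) * (I * z)))) := by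
    unfold Function.uncurry
    fun_prop
  have e1 := cfc_integral (μ := volume)
    (fun (p : ℝ) (z : ℂ) => h p * exp ((p * s : ℝ) * (I * z))) (fun p => ‖h p‖) a
    hco.continuousOn (Filter.Eventually.of_forall hb) hi.norm.hasFiniteIntegral
  have hint := integrable_cfc (μ := volume)
    (fun (p : ℝ) (z : ℂ) => h p * exp ((p * s : ℝ) * (I * z))) (fun p => ‖h p‖) a
    hco.continuousOn (Filter.Eventually.of_forall hb) hi.norm.hasFiniteIntegral
  have e2 : ∀ p : ℝ, cfc (fun z : ℂ => h p * exp ((p * s : ℝ) * (I * z))) a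
      = h p • NormedSpace.exp ((p * s) • (I • a)) := by
    intro p
    rw [cfc_const_mul (R := ℂ) (h p) (fun z => exp ((p * s : ℝ) * (I * z))) a (by fun_prop)]
    congr 1
    have e3 : (p * s) • (I • a) = (((p * s : ℝ) : ℂ) * I) • a := by
      rw [mul_smul (((p * s : ℝ) : ℂ)), Complex.coe_smul]
    have hn' : IsStarNormal ((((p * s : ℝ) : ℂ) * I) • a) := inferInstance
    rw [e3, ← CFC.complex_exp_eq_normedSpace_exp,
      ← cfc_comp_smul (((p * s : ℝ) : ℂ) * I) exp a (by fun_prop)]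
    congr 1
    ext z
    simp [mul_assoc]
  simp only [e2] at e1 hint
  rw [e1]
  -- Taking the commutator with H is bounded and linear, so it passes under the integral.
  let Lc : 𝒜 →L[ℂ] 𝒜 := (ContinuousLinearMap.mul ℂ 𝒜).flip H - ContinuousLinearMap.mul ℂ 𝒜 H
  have hL : ∀ x, Lc x = x * H - H * x := fun x => rfl
  rw [← hL, ← Lc.integral_comp_comm hint, mul_assoc, mul_comm (∫ p : ℝ, _), ← mul_assoc,
    ← integral_const_mul]
  refine norm_integral_le_of_norm_le (hpi.norm.const_mul _) (Filter.Eventually.of_forall fun p => ?_)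
  rw [hL, smul_mul_assoc, mul_smul_comm, ← smul_sub, norm_smul, norm_mul, norm_real]
  calc ‖h p‖ * _ ≤ ‖h p‖ * (|p * s| * ‖a * H - H * a‖) := by
        gcongr; exact norm_exp_commutator_le ha H _
    _ = _ := by rw [abs_mul, Real.norm_eq_abs]; ring

end BoundedCommutator

/-! ### Fourier inversion for localizing functions. -/

section Fourier

open FourierTransform

variable (φ : LocalizingFunction)

lemma unitaryFourier_eq_fourier (f : ℝ → ℝ) (p : ℝ) :
    unitaryFourier f p = (1 / √(2 * Real.pi) : ℝ) * 𝓕 (fun x => (f x : ℂ)) (p / (2 * Real.pi)) := by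
  rw [unitaryFourier, Real.fourier_eq']
  congr 1
  refine integral_congr_ae (Filter.Eventually.of_forall fun x => ?_)
  simp only [smul_eq_mul]
  rw [mul_comm]
  congr 2
  simp only [RCLike.inner_apply, conj_trivial]
  push_cast
  have : (Real.pi : ℂ) ≠ 0 := by exact_mod_cast Real.pi_ne_zero
  field_simp

lemma LocalizingFunction.integrable_ofReal : Integrable (fun x => (φ.toFun x : ℂ)) :=
  φ.integrable.ofReal

lemma LocalizingFunction.continuous_fourier : Continuous (unitaryFourier φ.toFun) := by
  have h : Continuous (𝓕 (fun x => (φ.toFun x : ℂ))) :=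
    VectorFourier.fourierIntegral_continuous Real.continuous_fourierChar
      (by exact continuous_inner) φ.integrable_ofReal
  have e : unitaryFourier φ.toFun = fun p => (1 / √(2 * Real.pi) : ℝ) *
      𝓕 (fun x => (φ.toFun x : ℂ)) (p / (2 * Real.pi)) :=
    funext (unitaryFourier_eq_fourier _)
  rw [e]
  fun_prop

/-- Continuity gives integrability on [-1,1]; outside, |φ̂(p)| ≤ |p φ̂(p)|, which is integrable by
assumption. -/
lemma LocalizingFunction.integrable_fourier : Integrable (unitaryFourier φ.toFun) := by
  have h1 := φ.continuous_fourier
  have h2 : IntegrableOn (unitaryFourier φ.toFun) (Set.Icc (-1) 1) :=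
    h1.continuousOn.integrableOn_compact isCompact_Icc
  rw [← integrableOn_univ, ← Set.union_compl_self (Set.Icc (-1 : ℝ) 1)]
  refine h2.union ?_
  refine Integrable.mono φ.integrable_mul_fourier.integrableOn h1.aestronglyMeasurable ?_
  refine (ae_restrict_iff' measurableSet_Icc.compl).2 (Filter.Eventually.of_forall fun p hp => ?_)
  rw [norm_mul, norm_real, Real.norm_eq_abs]
  have hp' : 1 ≤ |p| := by
    by_contra hlt
    rw [not_le, abs_lt] at hlt
    exact hp ⟨hlt.1.le, hlt.2.le⟩
  nlinarith [norm_nonneg (unitaryFourier φ.toFun p)]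

/-- Fourier inversion. -/
lemma LocalizingFunction.eq_integral (x : ℝ) :
    (φ.toFun x : ℂ) = ∫ p : ℝ, (1 / √(2 * Real.pi) : ℝ) * unitaryFourier φ.toFun p
      * exp (p * (I * x)) := by
  have hpi : (0 : ℝ) < 2 * Real.pi := by positivity
  have e : ∀ p, 𝓕 (fun x => (φ.toFun x : ℂ)) p
      = (√(2 * Real.pi) : ℝ) * unitaryFourier φ.toFun (2 * Real.pi * p) := by
    intro p
    rw [unitaryFourier_eq_fourier, ← mul_assoc, ← ofReal_mul,
      mul_one_div_cancel (Real.sqrt_pos.2 hpi).ne', ofReal_one, one_mul,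
      mul_div_cancel_left₀ _ hpi.ne']
  have hF : Integrable (𝓕 (fun x => (φ.toFun x : ℂ))) := by
    rw [show 𝓕 (fun x => (φ.toFun x : ℂ)) = _ from funext e]
    exact (φ.integrable_fourier.comp_mul_left' hpi.ne').const_mul _
  have hcont : Continuous (fun x => (φ.toFun x : ℂ)) :=
    continuous_ofReal.comp φ.continuous_toFun
  have h := congrFun (hcont.fourierInv_fourier_eq φ.integrable_ofReal hF) x
  rw [Real.fourierInv_eq'] at h
  simp only [e, smul_eq_mul, RCLike.inner_apply, conj_trivial] at h
  rw [← h]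
  -- The substitution p ↦ 2πp passes between the frequency convention e^{2πixp} and e^{ixp}; its
  -- Jacobian combines with √(2π) to give 1/√(2π).
  have h2 := MeasureTheory.Measure.integral_comp_mul_left (fun p : ℝ =>
    exp (p * (I * x)) * ((√(2 * Real.pi) : ℝ) * unitaryFourier φ.toFun p)) (2 * Real.pi)
  have e3 : ∀ p : ℝ, exp (((2 * Real.pi * p : ℝ) : ℂ) * (I * x))
      = exp ((2 * Real.pi * (x * p) : ℝ) * I) := by
    intro p
    congr 1
    push_cast
    ring
  simp only [e3] at h2
  rw [h2, abs_of_pos (inv_pos.2 hpi), ← integral_smul]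
  refine integral_congr_ae (Filter.Eventually.of_forall fun p => ?_)
  simp only [real_smul]
  have e4 : ((2 * Real.pi)⁻¹ : ℝ) * √(2 * Real.pi) = 1 / √(2 * Real.pi) := by
    have h5 := Real.sqrt_pos.2 hpi
    rw [inv_mul_eq_div, div_eq_div_iff hpi.ne' h5.ne', Real.mul_self_sqrt hpi.le, one_mul]
  rw [← e4]
  push_cast
  ring

/-- Half of the constant `c_φ`. -/
lemma LocalizingFunction.integral_norm :
    (∫ p : ℝ, ‖(p : ℂ) * ((1 / √(2 * Real.pi) : ℝ) * unitaryFourier φ.toFun p)‖)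
      = φ.const / 2 := by
  have e : ∀ p : ℝ, ‖(p : ℂ) * ((1 / √(2 * Real.pi) : ℝ) * unitaryFourier φ.toFun p)‖
      = (1 / √(2 * Real.pi)) * ‖(p : ℂ) * unitaryFourier φ.toFun p‖ := by
    intro p
    rw [mul_left_comm, norm_mul, norm_real, Real.norm_of_nonneg (by positivity)]
  simp only [e]
  rw [integral_const_mul, LocalizingFunction.const]
  ring

lemma LocalizingFunction.const_nonneg : 0 ≤ φ.const := by
  unfold LocalizingFunction.const
  have : 0 ≤ ∫ p : ℝ, ‖(p : ℂ) * unitaryFourier φ.toFun p‖ := integral_nonneg fun _ => norm_nonneg _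
  positivity

lemma LocalizingFunction.integrable_coeff :
    Integrable (fun p : ℝ => (1 / √(2 * Real.pi) : ℝ) * unitaryFourier φ.toFun p) :=
  φ.integrable_fourier.const_mul _

lemma LocalizingFunction.integrable_mul_coeff :
    Integrable (fun p : ℝ => (p : ℂ) * ((1 / √(2 * Real.pi) : ℝ) * unitaryFourier φ.toFun p)) := by
  exact (φ.integrable_mul_fourier.const_mul _).congr
    (Filter.Eventually.of_forall fun p => mul_left_comm _ _ _)

/-- A localizing function is Lipschitz. -/
lemma LocalizingFunction.abs_sub_le (x y : ℝ) :
    |φ.toFun x - φ.toFun y| ≤ φ.const / 2 * |x - y| := by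
  rw [← Real.norm_eq_abs, ← norm_real, ofReal_sub, φ.eq_integral, φ.eq_integral y]
  have hi : ∀ x : ℝ, Integrable (fun p : ℝ => (1 / √(2 * Real.pi) : ℝ) *
      unitaryFourier φ.toFun p * exp (p * (I * x))) := by
    intro x
    refine φ.integrable_coeff.mul_bdd (c := 1) (by fun_prop)
      (Filter.Eventually.of_forall fun p => ?_)
    rw [mul_left_comm, ← ofReal_mul, mul_comm I, norm_exp_ofReal_mul_I]
  rw [← integral_sub (hi x) (hi y), ← φ.integral_norm, ← integral_mul_const]
  refine norm_integral_le_of_norm_le (φ.integrable_mul_coeff.norm.mul_const _)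
    (Filter.Eventually.of_forall fun p => ?_)
  rw [← mul_sub, norm_mul, norm_mul (p : ℂ), norm_real, mul_comm ‖p‖, mul_assoc]
  gcongr
  -- Extracting a phase leaves |e^{ip(x-y)} - 1| ≤ |p| |x - y|, whose integral against |φ̂| is the
  -- Lipschitz constant.
  have e : exp (p * (I * x)) - exp (p * (I * y))
      = exp ((p * y : ℝ) * I) * (exp (I * (p * (x - y) : ℝ)) - 1) := by
    rw [mul_sub, ← exp_add, mul_one]
    congr 2 <;> push_cast <;> ring
  rw [e, norm_mul, norm_exp_ofReal_mul_I, one_mul]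
  refine (Real.norm_exp_I_mul_ofReal_sub_one_le).trans ?_
  rw [norm_mul, Real.norm_eq_abs (x - y)]

/-- Fourier inversion for φ at x/ρ, that is, the integral estimate with s = 1/ρ. The real part
appears because the complex functional calculus is used; it is harmless on the real spectrum. -/
lemma norm_cfc_localizing_commutator_le {𝒜 : Type*} [CStarAlgebra 𝒜] {a : 𝒜}
    (ha : IsSelfAdjoint a) (H : 𝒜) {ρ : ℝ} (hρ : 0 < ρ) :
    ‖cfc (fun z : ℂ => (φ.scale ρ z.re : ℂ)) a * H
        - H * cfc (fun z : ℂ => (φ.scale ρ z.re : ℂ)) a‖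
      ≤ φ.const / (2 * ρ) * ‖a * H - H * a‖ := by
  have h := norm_cfc_integral_commutator_le ha H
    (h := fun p : ℝ => (1 / √(2 * Real.pi) : ℝ) * unitaryFourier φ.toFun p)
    (continuous_const.mul φ.continuous_fourier) φ.integrable_coeff φ.integrable_mul_coeff ρ⁻¹
  have e : cfc (fun z : ℂ => ∫ p : ℝ, (1 / √(2 * Real.pi) : ℝ) * unitaryFourier φ.toFun p
      * exp ((p * ρ⁻¹ : ℝ) * (I * z))) a = cfc (fun z : ℂ => (φ.scale ρ z.re : ℂ)) a := by
    refine cfc_congr fun z hz => ?_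
    rw [LocalizingFunction.scale, φ.eq_integral]
    refine integral_congr_ae (Filter.Eventually.of_forall fun p => ?_)
    simp only
    congr 2
    conv_lhs => rw [ha.mem_spectrum_eq_re hz]
    push_cast
    ring
  rw [e, φ.integral_norm, abs_of_pos (inv_pos.2 hρ)] at h
  refine h.trans_eq ?_
  congr 1
  field_simp

end Fourier

/-! ### Commutator estimate for unbounded D by bounded approximation. -/

section UnboundedCommutator

/-- The bounded approximation `λ²x / (x² + λ²)` of the coordinate function `x`. -/
noncomputable def truncCoord (l x : ℝ) : ℝ := l ^ 2 * x / (x ^ 2 + l ^ 2)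

/-- Partial fractions: the approximation is a combination of the resolvents at ±il, so its
commutators reduce to resolvent commutators. -/
lemma ofReal_truncCoord {l : ℝ} (hl : l ≠ 0) (x : ℝ) :
    (truncCoord l x : ℂ)
      = (l ^ 2 / 2 : ℝ) * (((x : ℂ) + l * I)⁻¹ + ((x : ℂ) + (-l : ℝ) * I)⁻¹) := by
  have h1 := HasLimAtInfty.ofReal_add_mul_I_ne_zero hl x
  have h2 := HasLimAtInfty.ofReal_add_mul_I_ne_zero (neg_ne_zero.2 hl) x
  have h3 : (x : ℂ) ^ 2 + (l : ℂ) ^ 2 ≠ 0 := by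
    have : 0 < x ^ 2 + l ^ 2 := by positivity
    exact_mod_cast this.ne'
  have h4 : ((x : ℂ) + l * I) * ((x : ℂ) + (-l : ℝ) * I) = (x : ℂ) ^ 2 + (l : ℂ) ^ 2 := by
    push_cast
    linear_combination (-(l : ℂ) ^ 2) * I_sq
  rw [inv_add_inv h1 h2, h4, truncCoord]
  push_cast
  field_simp
  ring

lemma hasLimAtInfty_truncCoord {l : ℝ} (hl : l ≠ 0) :
    HasLimAtInfty (fun x => (truncCoord l x : ℂ)) 0 := by
  have h := (HasLimAtInfty.const ((l ^ 2 / 2 : ℝ) : ℂ)).mul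
    ((HasLimAtInfty.inv_add_mul_I hl).add (HasLimAtInfty.inv_add_mul_I (neg_ne_zero.2 hl)))
  rw [add_zero, mul_zero] at h
  simpa only [ofReal_truncCoord hl] using h

/-- The error grows like |x|³ / l² for |x| much smaller than l; this is the reason for the three
resolvent factors used for strong convergence. -/
lemma abs_truncCoord_sub {l : ℝ} (hl : l ≠ 0) (x : ℝ) :
    |truncCoord l x - x| = |x| ^ 3 / (x ^ 2 + l ^ 2) := by
  have h : 0 < x ^ 2 + l ^ 2 := by positivity
  have e : truncCoord l x - x = -(x ^ 3 / (x ^ 2 + l ^ 2)) := by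
    rw [truncCoord]
    field_simp
    ring
  rw [e, abs_neg, abs_div, abs_pow, abs_of_pos h]

variable {A X : Type*} [NonUnitalCStarAlgebra A] [PartialOrder A] [StarOrderedRing A]
  [NormedAddCommGroup X] [NormedSpace ℂ X] [SMul A X] [CStarModule A X]

lemma Adj.norm_val (T : Adj A X) : ‖T.1‖ = ‖T‖ := rfl

/-- Uniformly bounded operators that converge on a dense range converge strongly. -/
lemma tendsto_apply_of_denseRange {T : ℕ → X →L[ℂ] X} {S R : X →L[ℂ] X} (hT : ∀ n, ‖T n‖ ≤ 1)
    (hS : ‖S‖ ≤ 1) (hR : DenseRange R) (h : Tendsto (fun n => (T n - S).comp R) atTop (𝓝 0))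
    (v : X) : Tendsto (fun n => T n v) atTop (𝓝 (S v)) := by
  rw [Metric.tendsto_atTop]
  intro ε hε
  obtain ⟨w, hw⟩ := hR.exists_dist_lt v (show 0 < ε / 3 by positivity)
  have h1 : Tendsto (fun n => ((T n - S).comp R) w) atTop (𝓝 0) :=
    ((ContinuousLinearMap.apply ℂ X w).continuous.tendsto _).comp h
  obtain ⟨N, hN⟩ := (Metric.tendsto_atTop.1 h1) (ε / 3) (by positivity)
  refine ⟨N, fun n hn => ?_⟩
  have h2 := hN n hn
  rw [dist_zero_right] at h2
  rw [dist_eq_norm] at hw ⊢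
  -- An ε/3 argument: the uniform bounds control the two outer terms and the convergence after
  -- composing with R controls the middle one.
  have e : T n v - S v = T n (v - R w) + ((T n - S).comp R) w - S (v - R w) := by
    simp only [map_sub, ContinuousLinearMap.comp_apply, sub_apply]
    abel
  have h3 := (T n).le_of_opNorm_le (hT n) (v - R w)
  have h4 := S.le_of_opNorm_le hS (v - R w)
  rw [e]
  calc _ ≤ ‖T n (v - R w)‖ + ‖((T n - S).comp R) w‖ + ‖S (v - R w)‖ :=
        (norm_sub_le _ _).trans (by gcongr; exact norm_add_le _ _)
    _ < ε := by linarith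

variable [CompleteSpace X] {D : X →ₗ.[ℂ] X} (hD : IsSelfAdjointRegular A D)

lemma norm_inv_add_mul_I_le {s : ℝ} (hs : s ≠ 0) (x : ℝ) : ‖((x : ℂ) + s * I)⁻¹‖ ≤ |s|⁻¹ := by
  rw [norm_inv]
  refine inv_anti₀ (abs_pos.2 hs) ?_
  have := abs_im_le_norm ((x : ℂ) + s * I)
  simpa using this

/-- The identity [R,T] = -R[D,T]R for R = (D + is)⁻¹, obtained from DR = 1 - isR. -/
lemma resolvent_commutator {T δ : Adj A X}
    (hT : ∀ x : D.domain, ∃ h : T.1 (x : X) ∈ D.domain,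
      δ.1 (x : X) = D ⟨T.1 (x : X), h⟩ - T.1 (D x)) {s : ℝ} (hs : s ≠ 0) :
    limCalc hD (fun x => ((x : ℂ) + s * I)⁻¹) 0 * T
        - T * limCalc hD (fun x => ((x : ℂ) + s * I)⁻¹) 0
      = -(limCalc hD (fun x => ((x : ℂ) + s * I)⁻¹) 0 * δ
        * limCalc hD (fun x => ((x : ℂ) + s * I)⁻¹) 0) := by
  have hR := HasLimAtInfty.inv_add_mul_I hs
  have hxR := HasLimAtInfty.mul_inv_add_mul_I hs
  have e : limCalc hD (fun x => (x : ℂ) * ((x : ℂ) + s * I)⁻¹) 1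
      = 1 - (s * I) • limCalc hD (fun x => ((x : ℂ) + s * I)⁻¹) 0 := by
    rw [← limCalc_smul hD _ hR, ← one_smul ℂ (1 : Adj A X), ← limCalc_const hD,
      ← limCalc_sub hD (.const 1) ((HasLimAtInfty.const _).mul hR), mul_zero, sub_zero]
    congr 1
    ext x
    have := HasLimAtInfty.ofReal_add_mul_I_ne_zero hs x
    field_simp
    ring
  rw [limCalc_mul_lipDeriv_mul hD hT hR.continuous hxR hR.continuous hxR, e]
  simp only [sub_mul, mul_sub, smul_mul_assoc, mul_smul_comm, one_mul, mul_one]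
  abel

/-- The commutator is -(l²/2)(RδR + R'δR') with ‖R‖, ‖R'‖ ≤ 1/|l|. The powers of l cancel, and the
bound is uniform in l. -/
lemma norm_truncCoord_commutator_le {T δ : Adj A X}
    (hT : ∀ x : D.domain, ∃ h : T.1 (x : X) ∈ D.domain,
      δ.1 (x : X) = D ⟨T.1 (x : X), h⟩ - T.1 (D x)) {l : ℝ} (hl : l ≠ 0) :
    ‖limCalc hD (fun x => (truncCoord l x : ℂ)) 0 * T
      - T * limCalc hD (fun x => (truncCoord l x : ℂ)) 0‖ ≤ ‖δ‖ := by
  have hl' := neg_ne_zero.2 hl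
  have hR := HasLimAtInfty.inv_add_mul_I hl
  have hR' := HasLimAtInfty.inv_add_mul_I hl'
  set R := limCalc hD (fun x => ((x : ℂ) + l * I)⁻¹) 0 with hRdef
  set R' := limCalc hD (fun x => ((x : ℂ) + (-l : ℝ) * I)⁻¹) 0 with hRdef'
  have e : limCalc hD (fun x => (truncCoord l x : ℂ)) 0 = ((l ^ 2 / 2 : ℝ) : ℂ) • (R + R') := by
    rw [hRdef, hRdef', ← limCalc_add hD hR hR', ← limCalc_smul hD _ (hR.add hR'), add_zero,
      mul_zero]
    simp only [ofReal_truncCoord hl]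
  have h1 := resolvent_commutator hD hT hl
  have h2 := resolvent_commutator hD hT hl'
  rw [← hRdef] at h1
  rw [← hRdef'] at h2
  have e2 : limCalc hD (fun x => (truncCoord l x : ℂ)) 0 * T
      - T * limCalc hD (fun x => (truncCoord l x : ℂ)) 0
      = -(((l ^ 2 / 2 : ℝ) : ℂ) • (R * δ * R + R' * δ * R')) := by
    rw [e, smul_mul_assoc, mul_smul_comm, ← smul_sub, ← smul_neg]
    congr 1
    rw [add_mul, mul_add, neg_add, ← h1, ← h2]
    abel
  have n1 : ‖R‖ ≤ |l|⁻¹ := norm_limCalc_le hD (norm_inv_add_mul_I_le hl) (by simp)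
  have n2 : ‖R'‖ ≤ |l|⁻¹ := by
    have := norm_limCalc_le hD (norm_inv_add_mul_I_le hl') (c := 0) (by simp)
    rwa [abs_neg] at this
  have n3 : ∀ S : Adj A X, ‖S‖ ≤ |l|⁻¹ → ‖S * δ * S‖ ≤ |l|⁻¹ * ‖δ‖ * |l|⁻¹ := fun S hS =>
    (norm_mul_le _ _).trans (mul_le_mul ((norm_mul_le _ _).trans (by gcongr)) hS (norm_nonneg _)
      (by positivity))
  rw [e2, norm_neg, norm_smul, norm_real, Real.norm_of_nonneg (by positivity)]
  calc l ^ 2 / 2 * ‖R * δ * R + R' * δ * R'‖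
      ≤ l ^ 2 / 2 * (|l|⁻¹ * ‖δ‖ * |l|⁻¹ + |l|⁻¹ * ‖δ‖ * |l|⁻¹) := by
        gcongr
        exact (norm_add_le _ _).trans (add_le_add (n3 R n1) (n3 R' n2))
    _ = ‖δ‖ := by
        have : |l| ≠ 0 := abs_ne_zero.2 hl
        rw [← sq_abs l]
        field_simp
        ring

/-- A localizing function of the real part, as a function on `ℂ`. -/
noncomputable def LocalizingFunction.scaleRe (φ : LocalizingFunction) (ρ : ℝ) (z : ℂ) : ℂ :=
  (φ.scale ρ z.re : ℂ)

lemma LocalizingFunction.continuous_scaleRe (φ : LocalizingFunction) (ρ : ℝ) :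
    Continuous (φ.scaleRe ρ) := by
  have := φ.continuous_scale ρ
  unfold LocalizingFunction.scaleRe
  fun_prop

lemma LocalizingFunction.norm_scaleRe_le (φ : LocalizingFunction) (ρ : ℝ) (z : ℂ) :
    ‖φ.scaleRe ρ z‖ ≤ 1 := by
  have := φ.mem_Icc (z.re / ρ)
  rw [LocalizingFunction.scaleRe, LocalizingFunction.scale, norm_real, Real.norm_of_nonneg this.1]
  exact this.2

lemma LocalizingFunction.hasLimAtInfty_scale (φ : LocalizingFunction) {ρ : ℝ} (hρ : 0 < ρ) :
    HasLimAtInfty (fun x => (φ.scale ρ x : ℂ)) 0 :=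
  HasLimAtInfty.of_hasCompactSupport (φ.continuous_scale ρ) (φ.hasCompactSupport_scale hρ)

/-- The Lipschitz bound for φ turns the difference into a multiple of |x|³ / (x² + l²), and the
three factors (x + i)⁻¹ absorb the cube. -/
lemma LocalizingFunction.norm_scaleRe_truncCoord_sub_mul_le (φ : LocalizingFunction) {ρ : ℝ}
    (hρ : 0 < ρ) {l : ℝ} (hl : l ≠ 0) (x : ℝ) :
    ‖(φ.scaleRe ρ (truncCoord l x) - (φ.scale ρ x : ℂ)) *
      (((x : ℂ) + I)⁻¹ * ((x : ℂ) + I)⁻¹ * ((x : ℂ) + I)⁻¹)‖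
      ≤ φ.const / 2 * ρ⁻¹ * (1 / l ^ 2) := by
  have hK := φ.const_nonneg
  have e1 : φ.scaleRe ρ (truncCoord l x) - (φ.scale ρ x : ℂ)
      = ((φ.toFun (truncCoord l x / ρ) - φ.toFun (x / ρ) : ℝ) : ℂ) := by
    simp [LocalizingFunction.scaleRe, LocalizingFunction.scale]
  have e2 : |x| ≤ ‖(x : ℂ) + I‖ := by
    simpa using abs_re_le_norm ((x : ℂ) + I)
  have e3 : 0 < ‖(x : ℂ) + I‖ := norm_pos_iff.2 (ofReal_add_I_ne_zero x)
  have hl2 : 0 < l ^ 2 := by positivity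
  have hx : 0 < x ^ 2 + l ^ 2 := by positivity
  rw [e1, norm_mul, norm_real, Real.norm_eq_abs, norm_mul, norm_mul, norm_inv]
  have e4 := φ.abs_sub_le (truncCoord l x / ρ) (x / ρ)
  rw [← sub_div, abs_div, abs_of_pos hρ, abs_truncCoord_sub hl] at e4
  calc _ ≤ φ.const / 2 * (|x| ^ 3 / (x ^ 2 + l ^ 2) / ρ) *
        (‖(x : ℂ) + I‖⁻¹ * ‖(x : ℂ) + I‖⁻¹ * ‖(x : ℂ) + I‖⁻¹) := by gcongr
    _ ≤ φ.const / 2 * (‖(x : ℂ) + I‖ ^ 3 / (x ^ 2 + l ^ 2) / ρ) *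
        (‖(x : ℂ) + I‖⁻¹ * ‖(x : ℂ) + I‖⁻¹ * ‖(x : ℂ) + I‖⁻¹) := by gcongr
    _ = φ.const / 2 * ρ⁻¹ * (1 / (x ^ 2 + l ^ 2)) := by field_simp
    _ ≤ φ.const / 2 * ρ⁻¹ * (1 / l ^ 2) := by
      gcongr
      nlinarith [sq_nonneg x]

/-- The truncated coordinate tends to 0 at infinity, so its localization tends to φ(0) = 1 whereas
φ_ρ tends to 0. The difference is not small in supremum norm; only after damping by resolvents is
there norm convergence. -/
lemma norm_scaleRe_truncCoord_sub_mul_resolvent_le (φ : LocalizingFunction) {ρ : ℝ}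
    (hρ : 0 < ρ) {l : ℝ} (hl : l ≠ 0) :
    ‖(limCalc hD (fun x => φ.scaleRe ρ (truncCoord l x)) (φ.scaleRe ρ 0)
      - funcCalc hD (φ.scale ρ)) * (resolvent hD * resolvent hD * resolvent hD)‖
      ≤ φ.const / 2 * ρ⁻¹ * (1 / l ^ 2) := by
  have hi := HasLimAtInfty.inv_add_I
  have hφ := φ.hasLimAtInfty_scale hρ
  have hlim : HasLimAtInfty (fun x => φ.scaleRe ρ (truncCoord l x)) (φ.scaleRe ρ 0) :=
    HasLimAtInfty.comp (φ.continuous_scaleRe ρ) (hasLimAtInfty_truncCoord hl)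
  have hK := φ.const_nonneg
  rw [funcCalc_eq_limCalc, resolvent_eq_limCalc, ← limCalc_sub hD hlim hφ,
    ← limCalc_mul hD hi hi, ← limCalc_mul hD (hi.mul hi) hi,
    ← limCalc_mul hD (hlim.sub hφ) ((hi.mul hi).mul hi)]
  refine norm_limCalc_le hD (φ.norm_scaleRe_truncCoord_sub_mul_le hρ hl) ?_
  rw [mul_zero, mul_zero, norm_zero]
  positivity

lemma denseRange_resolvent_cube :
    DenseRange (resolvent hD * resolvent hD * resolvent hD).1 := by
  have h := denseRange_resolvent hD
  have hc := (resolvent hD).1.continuous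
  have h2 : DenseRange (resolvent hD * resolvent hD).1 :=
    DenseRange.comp (g := (resolvent hD).1) (f := (resolvent hD).1) h h hc
  exact DenseRange.comp (g := (resolvent hD * resolvent hD).1) (f := (resolvent hD).1)
    h2 h (hc.comp hc)

/-- `φ_ρ` of the bounded approximations of `D` converges strongly to `φ_ρ(D)`. -/
lemma tendsto_limCalc_scaleRe (φ : LocalizingFunction) {ρ : ℝ} (hρ : 0 < ρ) (v : X) :
    Tendsto (fun n : ℕ => (limCalc hD (fun x => φ.scaleRe ρ (truncCoord (n + 1) x))
      (φ.scaleRe ρ 0)).1 v) atTop (𝓝 ((funcCalc hD (φ.scale ρ)).1 v)) := by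
  refine tendsto_apply_of_denseRange
    (T := fun n : ℕ => (limCalc hD (fun x => φ.scaleRe ρ (truncCoord (n + 1) x))
      (φ.scaleRe ρ 0)).1)
    (S := (funcCalc hD (φ.scale ρ)).1) (fun n => ?_) ?_ (denseRange_resolvent_cube hD) ?_ v
  · rw [Adj.norm_val]
    exact norm_limCalc_le hD (fun x => φ.norm_scaleRe_le ρ _) (φ.norm_scaleRe_le ρ 0)
  · rw [Adj.norm_val, funcCalc_eq_limCalc]
    exact norm_limCalc_le hD (fun x => φ.norm_scaleRe_le ρ x) (by simp)
  · have hc : Tendsto (fun n : ℕ => φ.const / 2 * ρ⁻¹ * (1 / ((n : ℝ) + 1) ^ 2)) atTop (𝓝 0) := by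
      have h1 := tendsto_one_div_add_atTop_nhds_zero_nat (𝕜 := ℝ)
      have h2 := (h1.mul h1).const_mul (φ.const / 2 * ρ⁻¹)
      simp only [mul_zero] at h2
      refine h2.congr fun n => ?_
      rw [one_div_mul_one_div, sq]
    exact squeeze_zero_norm
      (fun n => norm_scaleRe_truncCoord_sub_mul_resolvent_le hD φ hρ (by positivity)) hc

/-- `‖[φ_ρ(D), T]‖ ≤ c_φ / (2ρ) ‖[D, T]‖`. -/
lemma norm_funcCalc_commutator_le (φ : LocalizingFunction) {T δ : Adj A X}
    (hT : ∀ x : D.domain, ∃ h : T.1 (x : X) ∈ D.domain,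
      δ.1 (x : X) = D ⟨T.1 (x : X), h⟩ - T.1 (D x)) {ρ : ℝ} (hρ : 0 < ρ) :
    ‖funcCalc hD (φ.scale ρ) * T - T * funcCalc hD (φ.scale ρ)‖ ≤ φ.const / (2 * ρ) * ‖δ‖ := by
  let Φ : ℕ → Adj A X := fun n =>
    limCalc hD (fun x => φ.scaleRe ρ (truncCoord (n + 1) x)) (φ.scaleRe ρ 0)
  have hK := φ.const_nonneg
  have hb : ∀ n, ‖Φ n * T - T * Φ n‖ ≤ φ.const / (2 * ρ) * ‖δ‖ := by
    intro n
    have hl : (n : ℝ) + 1 ≠ 0 := by positivity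
    have hsa : IsSelfAdjoint (limCalc hD (fun x => (truncCoord (n + 1) x : ℂ)) 0) := by
      simpa using isSelfAdjoint_limCalc hD (truncCoord (n + 1)) 0
    have h1 := norm_cfc_localizing_commutator_le φ hsa T hρ
    have e : cfc (fun z : ℂ => (φ.scale ρ z.re : ℂ))
        (limCalc hD (fun x => (truncCoord (n + 1) x : ℂ)) 0) = Φ n :=
      limCalc_comp hD (φ.continuous_scaleRe ρ) (hasLimAtInfty_truncCoord hl)
    rw [e] at h1
    refine h1.trans ?_
    gcongr
    exact norm_truncCoord_commutator_le hD hT hl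
  have hstrong : ∀ v, Tendsto (fun n => (Φ n).1 v) atTop
      (𝓝 ((funcCalc hD (φ.scale ρ)).1 v)) := tendsto_limCalc_scaleRe hD φ hρ
  -- A uniform operator norm bound survives strong limits, so it suffices to argue vector by vector.
  refine ContinuousLinearMap.opNorm_le_bound _ (by positivity) fun v => ?_
  have hlim2 : Tendsto (fun n => (Φ n * T - T * Φ n).1 v) atTop
      (𝓝 ((funcCalc hD (φ.scale ρ) * T - T * funcCalc hD (φ.scale ρ)).1 v)) :=
    (hstrong (T.1 v)).sub ((T.1.continuous.tendsto _).comp (hstrong v))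
  exact le_of_tendsto hlim2.norm (Eventually.of_forall fun n =>
    ContinuousLinearMap.le_of_opNorm_le _ (hb n) v)

end UnboundedCommutator

/-! ### The algebraic square of the localizer and positivity in a C⋆-algebra. -/

section SquareOfLocalizer

/-- The mixed terms in the square of the spectral localizer. -/
lemma localizer_sq {𝒜 : Type*} [Ring 𝒜] [Algebra ℂ 𝒜] {Φ γ H T P S δ : 𝒜} (κ : ℂ)
    (hγΦ : γ * Φ = Φ * γ) (hγH : H * γ = γ * H) (hγ : γ * γ = 1) (hSΦ : S * Φ = 0)
    (hΦS : Φ * S = 0) (hγS : γ * S = S * γ) (hPΦ : P * Φ = T) (hΦP : Φ * P = T)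
    (hγP : γ * P = -(P * γ)) (hγT : γ * T = -(T * γ)) (hSP : S * P = P * S)
    (hδ : Φ * δ * Φ = T * H * Φ - Φ * H * T) :
    (Φ * γ * H * Φ + κ • P - S * γ) * (Φ * γ * H * Φ + κ • P - S * γ)
      = (Φ * Φ) * (H * H) * (Φ * Φ) + ((κ * κ) • (P * P) + S * S)
        + Φ * (Φ * H * (Φ * H - H * Φ) - (Φ * H - H * Φ) * (Φ * H) - κ • (γ * δ)) * Φ := by
  have e1 : (Φ * γ * H * Φ) * (Φ * γ * H * Φ) = Φ * H * Φ * (Φ * H * Φ) := by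
    calc (Φ * γ * H * Φ) * (Φ * γ * H * Φ) = Φ * (γ * H) * Φ * (Φ * γ) * H * Φ := by noncomm_ring
      _ = Φ * H * (γ * Φ) * (γ * Φ) * H * Φ := by rw [← hγH, ← hγΦ]; noncomm_ring
      _ = Φ * H * Φ * (γ * γ) * Φ * H * Φ := by
          rw [hγΦ, show Φ * H * (Φ * γ) * (Φ * γ) * H * Φ = Φ * H * Φ * (γ * Φ) * γ * H * Φ by
            noncomm_ring, hγΦ, show Φ * H * Φ * (Φ * γ) * γ * H * Φ
              = Φ * H * Φ * Φ * (γ * γ) * H * Φ by noncomm_ring, hγ]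
          noncomm_ring
      _ = Φ * H * Φ * (Φ * H * Φ) := by rw [hγ]; noncomm_ring
  -- As γ anticommutes with T = PΦ, this anticommutator is -γ times the commutator TH Φ - ΦHT, the
  -- compression of δ.
  have e2 : (Φ * γ * H * Φ) * P + P * (Φ * γ * H * Φ) = -(Φ * (γ * δ) * Φ) := by
    calc (Φ * γ * H * Φ) * P + P * (Φ * γ * H * Φ)
        = (Φ * γ) * H * (Φ * P) + (P * Φ) * γ * H * Φ := by noncomm_ring
      _ = γ * (Φ * H * T) + (T * γ) * H * Φ := by rw [hΦP, hPΦ, ← hγΦ]; noncomm_ring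
      _ = -(γ * (T * H * Φ - Φ * H * T)) := by
          rw [← neg_eq_iff_eq_neg.2 hγT]; noncomm_ring
      _ = -((γ * Φ) * δ * Φ) := by rw [← hδ]; noncomm_ring
      _ = _ := by rw [hγΦ]; noncomm_ring
  have e3 : (Φ * γ * H * Φ) * (S * γ) = 0 := by
    rw [show (Φ * γ * H * Φ) * (S * γ) = Φ * γ * H * (Φ * S) * γ by noncomm_ring, hΦS]; simp
  have e4 : (S * γ) * (Φ * γ * H * Φ) = 0 := by
    rw [show (S * γ) * (Φ * γ * H * Φ) = S * (γ * Φ) * γ * H * Φ by noncomm_ring, hγΦ,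
      show S * (Φ * γ) * γ * H * Φ = (S * Φ) * γ * γ * H * Φ by noncomm_ring, hSΦ]
    simp
  -- The even part S commutes with P while γ anticommutes with it.
  have e5 : P * (S * γ) + (S * γ) * P = 0 := by
    rw [mul_assoc S, hγP, mul_neg, ← mul_assoc, ← mul_assoc, hSP, add_neg_cancel]
  have e6 : (S * γ) * (S * γ) = S * S := by
    rw [show (S * γ) * (S * γ) = S * (γ * S) * γ by noncomm_ring, hγS,
      show S * (S * γ) * γ = S * S * (γ * γ) by noncomm_ring, hγ, mul_one]
  -- Both copies of H are brought together between factors Φ², where H² ≥ g² applies; the cost is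
  -- commutators compressed by Φ.
  have e7 : Φ * H * Φ * (Φ * H * Φ) = (Φ * Φ) * (H * H) * (Φ * Φ)
      + Φ * (Φ * H * (Φ * H - H * Φ) - (Φ * H - H * Φ) * (Φ * H)) * Φ := by noncomm_ring
  calc (Φ * γ * H * Φ + κ • P - S * γ) * (Φ * γ * H * Φ + κ • P - S * γ)
      = (Φ * γ * H * Φ) * (Φ * γ * H * Φ)
        + κ • ((Φ * γ * H * Φ) * P + P * (Φ * γ * H * Φ))
        - (Φ * γ * H * Φ) * (S * γ) - (S * γ) * (Φ * γ * H * Φ)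
        + (κ * κ) • (P * P) - κ • (P * (S * γ) + (S * γ) * P) + (S * γ) * (S * γ) := by
        generalize Φ * γ * H * Φ = U, S * γ = V
        simp only [mul_add, add_mul, mul_sub, sub_mul, smul_mul_assoc, mul_smul_comm, smul_smul,
          smul_add, smul_sub]
        abel
    _ = _ := by
        rw [e1, e2, e3, e4, e5, e6, e7]
        simp only [mul_sub, sub_mul, mul_smul_comm, smul_mul_assoc, smul_neg, smul_zero, sub_zero]
        abel

variable {𝒜 : Type*} [CStarAlgebra 𝒜] [PartialOrder 𝒜] [StarOrderedRing 𝒜]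

/-- For V = H⁻¹, conjugating V*V ≤ ‖V‖² by H gives 1 ≤ ‖V‖² H². -/
lemma inv_norm_inverse_sq_le {H : 𝒜} (hs : IsSelfAdjoint H) (hu : IsUnit H) :
    (‖Ring.inverse H‖⁻¹ ^ 2) • (1 : 𝒜) ≤ H * H := by
  set V := Ring.inverse H
  have hVH : V * H = 1 := Ring.inverse_mul_cancel H hu
  have h1 : star V * V ≤ (‖V‖ ^ 2) • (1 : 𝒜) := by
    rw [← Algebra.algebraMap_eq_smul_one]
    exact CStarAlgebra.star_mul_le_algebraMap_norm_sq
  have h2 := star_left_conjugate_le_conjugate h1 H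
  have e : star H * (star V * V) * H = 1 := by
    rw [show star H * (star V * V) * H = star (V * H) * (V * H) by rw [star_mul]; noncomm_ring,
      hVH, star_one, one_mul]
  rw [e, mul_smul_comm, smul_mul_assoc, mul_one, hs.star_eq] at h2
  -- This happens only in the zero algebra; the convention 0⁻¹ = 0 then leaves just 0 ≤ H².
  by_cases hV : ‖V‖ = 0
  · have h0 : (0 : 𝒜) ≤ H * H := by
      have := star_mul_self_nonneg H
      rwa [hs.star_eq] at this
    simpa [hV] using h0
  · have h3 := smul_le_smul_of_nonneg_left h2 (show 0 ≤ ‖V‖⁻¹ ^ 2 by positivity)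
    rwa [smul_smul, ← mul_pow, inv_mul_cancel₀ hV, one_pow, one_smul] at h3

/-- N itself need not be selfadjoint. Since its compression is, N can be replaced by its real part
N', which has the same compression and satisfies N' ≥ -C. -/
lemma neg_norm_smul_le_conj {Φ N : 𝒜} (hΦ : IsSelfAdjoint Φ) (hN : IsSelfAdjoint (Φ * N * Φ))
    {C : ℝ} (hC : ‖N‖ ≤ C) : -(C • (Φ * Φ)) ≤ Φ * N * Φ := by
  set N' : 𝒜 := (1 / 2 : ℝ) • (N + star N)
  have hN' : IsSelfAdjoint N' := by
    rw [IsSelfAdjoint, star_smul, star_add, star_star, add_comm]; simp [N']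
  have e : Φ * N * Φ = Φ * N' * Φ := by
    have h1 : Φ * star N * Φ = Φ * N * Φ := by
      have := hN.star_eq
      rw [star_mul, star_mul, hΦ.star_eq] at this
      rw [← mul_assoc] at this
      exact this
    rw [mul_smul_comm, smul_mul_assoc, mul_add, add_mul, h1, ← two_smul ℝ, smul_smul]
    norm_num
  have hn : ‖N'‖ ≤ C := by
    rw [norm_smul, Real.norm_of_nonneg (by norm_num)]
    have := norm_add_le N (star N)
    rw [norm_star] at this
    linarith
  have h1 : -(C • (1 : 𝒜)) ≤ N' := by
    refine le_trans ?_ hN'.neg_algebraMap_norm_le_self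
    rw [Algebra.algebraMap_eq_smul_one, neg_le_neg_iff]
    exact smul_le_smul_of_nonneg_right hn zero_le_one
  have h2 := star_left_conjugate_le_conjugate h1 Φ
  rw [hΦ.star_eq, mul_neg, neg_mul, mul_smul_comm, smul_mul_assoc, mul_one] at h2
  rwa [e]

/-- A lower bound for the square of a selfadjoint element gives invertibility. -/
lemma isUnit_of_sq_eq {L Φ H Q N : 𝒜} (hL : IsSelfAdjoint L) (hΦ : IsSelfAdjoint Φ)
    (hH : IsSelfAdjoint H) (hu : IsUnit H) (hQ : IsSelfAdjoint Q)
    (hsq : L * L = (Φ * Φ) * (H * H) * (Φ * Φ) + Q + Φ * N * Φ) {C ε : ℝ} (hε : 0 < ε)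
    (hC : ‖N‖ ≤ C)
    (hlow : ε • (1 : 𝒜) ≤ (‖Ring.inverse H‖⁻¹ ^ 2) • ((Φ * Φ) * (Φ * Φ)) + Q - C • (Φ * Φ)) :
    IsUnit L := by
  have hΦΦ : IsSelfAdjoint (Φ * Φ) := by
    rw [IsSelfAdjoint, star_mul, hΦ.star_eq]
  have hHH : IsSelfAdjoint (H * H) := by
    rw [IsSelfAdjoint, star_mul, hH.star_eq]
  have hLL : IsSelfAdjoint (L * L) := by
    rw [IsSelfAdjoint, star_mul, hL.star_eq]
  -- Inherited from the other terms of the identity for L².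
  have hN : IsSelfAdjoint (Φ * N * Φ) := by
    have e : Φ * N * Φ = L * L - ((Φ * Φ) * (H * H) * (Φ * Φ) + Q) := by rw [hsq]; abel
    rw [e]
    refine hLL.sub (IsSelfAdjoint.add ?_ hQ)
    rw [IsSelfAdjoint, star_mul (Φ * Φ * (H * H)), star_mul (Φ * Φ) (H * H), hΦΦ.star_eq,
      hHH.star_eq, mul_assoc (Φ * Φ)]
  have h1 := star_left_conjugate_le_conjugate (inv_norm_inverse_sq_le hH hu) (Φ * Φ)
  rw [hΦΦ.star_eq, mul_smul_comm, smul_mul_assoc, mul_one] at h1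
  have h2 := neg_norm_smul_le_conj hΦ hN hC
  have h3 : ε • (1 : 𝒜) ≤ L * L := by
    rw [hsq]
    refine hlow.trans ?_
    rw [sub_eq_add_neg]
    gcongr
  have h4 : IsUnit (L * L) := by
    refine CStarAlgebra.isUnit_of_le (ε • (1 : 𝒜)) h3 ?_
    rw [IsStrictlyPositive.iff_of_unital]
    refine ⟨smul_nonneg hε.le zero_le_one, ?_⟩
    rw [← Algebra.algebraMap_eq_smul_one]
    exact (IsUnit.mk0 ε hε.ne').map _
  exact ((Commute.refl L).isUnit_mul_iff.1 h4).1

end SquareOfLocalizer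

/-! ### Order bounds from pointwise bounds. -/

section LowerBound

variable {A X : Type*} [NonUnitalCStarAlgebra A] [PartialOrder A] [StarOrderedRing A]
  [NormedAddCommGroup X] [NormedSpace ℂ X] [SMul A X] [CStarModule A X] [CompleteSpace X]
  {D : X →ₗ.[ℂ] X} (hD : IsSelfAdjointRegular A D)

/-- The function f - ε is the square of the real function √(f - ε), so f(D) - ε is of the form a*a.
The bound on c covers the point at infinity. -/
lemma smul_one_le_limCalc [PartialOrder (Adj A X)] [StarOrderedRing (Adj A X)] {f : ℝ → ℝ}
    {c ε : ℝ} (hf : HasLimAtInfty (fun x => (f x : ℂ)) c) (hle : ∀ x, ε ≤ f x) (hc : ε ≤ c) :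
    ε • (1 : Adj A X) ≤ limCalc hD (fun x => (f x : ℂ)) c := by
  let F : ℂ → ℂ := fun z => (√(z.re - ε) : ℂ)
  have hF : Continuous F := by fun_prop
  have h1 := hf.comp hF
  have hs : star (limCalc hD (fun x => F (f x)) (F c)) = limCalc hD (fun x => F (f x)) (F c) :=
    (isSelfAdjoint_limCalc hD (fun x => √((f x : ℂ).re - ε)) (√((c : ℂ).re - ε))).star_eq
  have h2 := star_mul_self_nonneg (limCalc hD (fun x => F (f x)) (F c))
  rw [hs, ← limCalc_mul hD h1 h1] at h2
  have e : ∀ t : ℝ, ε ≤ t → F t * F t = t - ε := fun t ht => by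
    simp only [F, ofReal_re]
    rw [← ofReal_mul, Real.mul_self_sqrt (by linarith), ofReal_sub]
  rw [e c hc, funext fun x => e (f x) (hle x), limCalc_sub hD hf (.const _), limCalc_const,
    Complex.coe_smul, sub_nonneg] at h2
  exact h2

end LowerBound

/-! ### Scalar estimates and the building blocks of the localizer. -/

section Localizer

variable (φ : LocalizingFunction)

lemma LocalizingFunction.scale_mem_Icc (ρ x : ℝ) : φ.scale ρ x ∈ Set.Icc (0 : ℝ) 1 :=
  φ.mem_Icc _

lemma LocalizingFunction.scale_eq_one {ρ x : ℝ} (hρ : 0 < ρ) (hx : |x| ≤ ρ / 2) :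
    φ.scale ρ x = 1 := by
  refine φ.eq_one _ ?_
  rw [abs_le] at hx
  rw [Set.mem_Icc, le_div_iff₀ hρ, div_le_iff₀ hρ]
  constructor <;> linarith

lemma LocalizingFunction.scale_eq_zero {ρ x : ℝ} (hρ : 0 < ρ) (hx : ρ < |x|) :
    φ.scale ρ x = 0 := by
  by_contra h
  have h1 := φ.tsupport_subset (subset_tsupport _ h)
  rw [Set.mem_Icc, le_div_iff₀ hρ, div_le_iff₀ hρ] at h1
  have := abs_le.2 (show -ρ ≤ x ∧ x ≤ ρ from ⟨by linarith [h1.1], by linarith [h1.2]⟩)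
  linarith

lemma LocalizingFunction.scale_neg (ρ x : ℝ) : φ.scale ρ (-x) = φ.scale ρ x := by
  rw [LocalizingFunction.scale, neg_div, φ.even, LocalizingFunction.scale]

/-- The nesting of supports: φ_ρ lives on |x| ≤ ρ, where φ_{2ρ} = 1. This gives SΦ = 0 and PΦ = DΦ.
-/
lemma LocalizingFunction.scale_eq_zero_or {ρ : ℝ} (hρ : 0 < ρ) (x : ℝ) :
    φ.scale ρ x = 0 ∨ φ.scale (2 * ρ) x = 1 := by
  rcases lt_or_ge ρ |x| with h | h
  · exact Or.inl (φ.scale_eq_zero hρ h)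
  · exact Or.inr (φ.scale_eq_one (by positivity) (by linarith))

/-- The scalar lower bound for the square of the spectral localizer. -/
lemma LocalizingFunction.exists_lower_bound {κ ρ G C : ℝ} (hκ : 0 < κ) (hρ : 0 < ρ)
    (hG : 0 ≤ G) (hC : 0 ≤ C) (h1 : C < G) (h2 : C < κ ^ 2 * ρ ^ 2 / 4) :
    ∃ ε : ℝ, 0 < ε ∧ ε ≤ 1 ∧ ∀ x, ε ≤ G * φ.scale ρ x ^ 4
      + (κ ^ 2 * x ^ 2 * φ.scale (2 * ρ) x ^ 4 + (1 - φ.scale (2 * ρ) x ^ 4))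
      - C * φ.scale ρ x ^ 2 := by
  have hκρ : 0 < κ ^ 2 * ρ ^ 2 := by positivity
  -- The regions |x| ≤ ρ/2, ρ/2 < |x| ≤ ρ and |x| > ρ have lower bounds G - C, κ²ρ²/4 - C and min(1,
  -- κ²ρ²). The entry 1 also ensures ε ≤ 1, the limit of the function at infinity.
  refine ⟨min (min (G - C) (κ ^ 2 * ρ ^ 2 / 4 - C)) (min 1 (κ ^ 2 * ρ ^ 2)), ?_, ?_, fun x => ?_⟩
  · refine lt_min (lt_min ?_ ?_) (lt_min one_pos hκρ) <;> linarith
  · exact (min_le_right _ _).trans (min_le_left _ _)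
  obtain ⟨a0, a1⟩ := φ.scale_mem_Icc ρ x
  obtain ⟨b0, b1⟩ := φ.scale_mem_Icc (2 * ρ) x
  have hκx : 0 ≤ κ ^ 2 * x ^ 2 := by positivity
  rcases le_or_gt |x| (ρ / 2) with h | h
  · rw [φ.scale_eq_one hρ h, φ.scale_eq_one (ρ := 2 * ρ) (by positivity) (by linarith)]
    refine ((min_le_left _ _).trans (min_le_left _ _)).trans ?_
    linarith
  rcases le_or_gt |x| ρ with h' | h'
  -- Here φ_ρ may be small, so the gap term is dropped and κ²x² ≥ κ²ρ²/4 does the work.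
  · rw [φ.scale_eq_one (ρ := 2 * ρ) (by positivity) (by linarith)]
    refine ((min_le_left _ _).trans (min_le_right _ _)).trans ?_
    have h3 : ρ ^ 2 / 4 ≤ x ^ 2 := by
      rw [← sq_abs x]
      nlinarith
    have h4 : φ.scale ρ x ^ 2 ≤ 1 := pow_le_one₀ a0 a1
    have h5 : 0 ≤ G * φ.scale ρ x ^ 4 := by positivity
    have h6 : κ ^ 2 * (ρ ^ 2 / 4) ≤ κ ^ 2 * x ^ 2 := by gcongr
    have h7 : C * φ.scale ρ x ^ 2 ≤ C * 1 := by gcongr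
    linarith
  -- The error term vanishes, and what remains is a convex combination of κ²x² and 1 with weight
  -- φ_{2ρ}⁴.
  · rw [φ.scale_eq_zero hρ h']
    refine (min_le_right _ _).trans ?_
    have h3 : ρ ^ 2 ≤ x ^ 2 := by
      rw [← sq_abs x]
      gcongr
    have h4 : κ ^ 2 * ρ ^ 2 ≤ κ ^ 2 * x ^ 2 := by gcongr
    have h5 : φ.scale (2 * ρ) x ^ 4 ≤ 1 := pow_le_one₀ b0 b1
    have h6 : 0 ≤ φ.scale (2 * ρ) x ^ 4 := by positivity
    have m1 := min_le_left 1 (κ ^ 2 * ρ ^ 2)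
    have m2 := min_le_right 1 (κ ^ 2 * ρ ^ 2)
    nlinarith

variable {A X : Type*} [NonUnitalCStarAlgebra A] [PartialOrder A] [StarOrderedRing A]
  [NormedAddCommGroup X] [NormedSpace ℂ X] [SMul A X] [CStarModule A X] [CompleteSpace X]
  {D : X →ₗ.[ℂ] X} (hD : IsSelfAdjointRegular A D)

lemma LocalizingFunction.hasLimAtInfty_mul_scale {ρ : ℝ} (hρ : 0 < ρ) :
    HasLimAtInfty (fun x => x * (φ.scale ρ x : ℂ)) 0 := by
  have h := φ.continuous_scale ρ
  have := HasLimAtInfty.of_hasCompactSupport (f := fun x => x * φ.scale ρ x) (by fun_prop)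
    ((φ.hasCompactSupport_scale hρ).mul_left)
  simpa using this

/-- The function `(1 - φ_ρ⁴)^{1/2}`. -/
noncomputable def LocalizingFunction.complement (ρ x : ℝ) : ℝ := √(1 - φ.scale ρ x ^ 4)

lemma LocalizingFunction.hasLimAtInfty_one_sub {ρ : ℝ} (hρ : 0 < ρ) :
    HasLimAtInfty (fun x => ((1 - φ.scale ρ x ^ 4 : ℝ) : ℂ)) 1 := by
  have h := HasLimAtInfty.comp (F := fun z => 1 - z ^ 4) (by fun_prop) (φ.hasLimAtInfty_scale hρ)
  simpa using h

lemma LocalizingFunction.hasLimAtInfty_complement {ρ : ℝ} (hρ : 0 < ρ) :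
    HasLimAtInfty (fun x => (φ.complement ρ x : ℂ)) 1 := by
  have h := HasLimAtInfty.comp (F := fun z => (√z.re : ℂ)) (by fun_prop)
    (φ.hasLimAtInfty_one_sub hρ)
  simp only [ofReal_re, one_re, Real.sqrt_one, ofReal_one] at h
  exact h

lemma LocalizingFunction.complement_sq (ρ x : ℝ) :
    φ.complement ρ x * φ.complement ρ x = 1 - φ.scale ρ x ^ 4 := by
  obtain ⟨b0, b1⟩ := φ.scale_mem_Icc ρ x
  exact Real.mul_self_sqrt (by linarith [pow_le_one₀ b0 b1 (n := 4)])

lemma funcCalc_pow_four {ρ : ℝ} (hρ : 0 < ρ) :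
    1 - funcCalc hD (φ.scale ρ) ^ 4 = limCalc hD (fun x => ((1 - φ.scale ρ x ^ 4 : ℝ) : ℂ)) 1 := by
  have h := φ.hasLimAtInfty_scale hρ
  have h4 := ((h.mul h).mul h).mul h
  have e : funcCalc hD (φ.scale ρ) ^ 4 = limCalc hD (fun x => (φ.scale ρ x : ℂ) * φ.scale ρ x
      * φ.scale ρ x * φ.scale ρ x) (0 * 0 * 0 * 0) := by
    rw [limCalc_mul hD ((h.mul h).mul h) h, limCalc_mul hD (h.mul h) h, limCalc_mul hD h h,
      funcCalc_eq_limCalc]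
    simp only [pow_succ, pow_zero, one_mul]
  rw [e, ← one_smul ℂ (1 : Adj A X), ← limCalc_const hD, ← limCalc_sub hD (.const 1) h4]
  congr 1
  · ext x; push_cast; ring
  · simp

/-- The real functional calculus is passed to the complex one as √(re z), which is continuous on all
of ℂ, so the composition rule applies. -/
lemma cfc_sqrt_eq_limCalc {ρ : ℝ} (hρ : 0 < ρ) :
    cfc Real.sqrt (1 - funcCalc hD (φ.scale ρ) ^ 4)
      = limCalc hD (fun x => (φ.complement ρ x : ℂ)) 1 := by
  have hsa : IsSelfAdjoint (limCalc hD (fun x => ((1 - φ.scale ρ x ^ 4 : ℝ) : ℂ)) 1) := by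
    simpa only [ofReal_one] using isSelfAdjoint_limCalc hD (fun x => 1 - φ.scale ρ x ^ 4) 1
  rw [funcCalc_pow_four φ hD hρ, cfc_real_eq_complex Real.sqrt hsa,
    limCalc_comp hD (F := fun z => ((√z.re : ℝ) : ℂ)) (by fun_prop) (φ.hasLimAtInfty_one_sub hρ)]
  simp only [ofReal_re, one_re, Real.sqrt_one, ofReal_one]
  rfl

end Localizer

/-! ### Invertibility of the localizer. -/

section LocalizerInvertible

variable {A X : Type*} [NonUnitalCStarAlgebra A] [PartialOrder A] [StarOrderedRing A]
  [NormedAddCommGroup X] [NormedSpace ℂ X] [SMul A X] [CStarModule A X] [CompleteSpace X]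

lemma limCalc_comm {D : X →ₗ.[ℂ] X} (hD : IsSelfAdjointRegular A D) (f g : ℝ → ℂ) (c d : ℂ) :
    limCalc hD f c * limCalc hD g d = limCalc hD g d * limCalc hD f c :=
  (cfc_commute_cfc (circleExt f c) (circleExt g d) (cayley hD)).eq

namespace EvenKasparovModule

variable (K : EvenKasparovModule A X) {f : ℝ → ℂ} {c : ℂ}

lemma γ_mul_limCalc_of_even (hf : HasLimAtInfty f c) (he : ∀ x, f (-x) = f x) :
    K.γ * limCalc K.selfAdjointRegular f c = limCalc K.selfAdjointRegular f c * K.γ := by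
  have h := odd_mul_limCalc_mul K.selfAdjointRegular K.γ_selfAdjoint K.γ_sq K.odd hf
  rw [funext he] at h
  conv_rhs => rw [← h]
  rw [mul_assoc _ K.γ K.γ, K.γ_sq, mul_one]

lemma γ_mul_limCalc_of_odd (hf : HasLimAtInfty f 0) (ho : ∀ x, f (-x) = -f x) :
    K.γ * limCalc K.selfAdjointRegular f 0 = -(limCalc K.selfAdjointRegular f 0 * K.γ) := by
  have h := odd_mul_limCalc_mul K.selfAdjointRegular K.γ_selfAdjoint K.γ_sq K.odd hf
  have e := limCalc_smul K.selfAdjointRegular (-1) hf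
  simp only [neg_one_mul, neg_zero, neg_one_smul] at e
  rw [funext ho, e] at h
  rw [← neg_mul, ← h, mul_assoc _ K.γ K.γ, K.γ_sq, mul_one]

lemma norm_γ_mul (T : Adj A X) : ‖K.γ * T‖ = ‖T‖ :=
  CStarRing.norm_mem_unitary_mul _
    (Unitary.mem_iff.2 ⟨by rw [K.γ_selfAdjoint, K.γ_sq], by rw [K.γ_selfAdjoint, K.γ_sq]⟩)

end EvenKasparovModule

variable (K : EvenKasparovModule A X) (φ : LocalizingFunction) (H : Adj A X) (κ : ℝ)

/-- The spectral localizer in terms of the functional calculus of `D`. -/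
lemma localizer_eq {ρ : ℝ} (hρ : 0 < ρ) :
    localizer K H φ κ hρ
      = limCalc K.selfAdjointRegular (fun x => (φ.scale ρ x : ℂ)) 0 * K.γ * H
          * limCalc K.selfAdjointRegular (fun x => (φ.scale ρ x : ℂ)) 0
        + (κ : ℂ) • limCalc K.selfAdjointRegular
          (fun x => ((x * φ.scale (2 * ρ) x ^ 2 : ℝ) : ℂ)) 0
        - limCalc K.selfAdjointRegular (fun x => (φ.complement (2 * ρ) x : ℂ)) 1 * K.γ := by
  have h2 : 0 < 2 * ρ := by positivity
  have e : limCalc K.selfAdjointRegular (fun x => ((x * φ.scale (2 * ρ) x ^ 2 : ℝ) : ℂ)) 0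
      = funcCalc K.selfAdjointRegular (φ.scale (2 * ρ))
        * mulFuncCalc K.selfAdjointRegular (φ.continuous_scale (2 * ρ))
          (φ.hasCompactSupport_scale h2) := by
    rw [mulFuncCalc_eq_limCalc, funcCalc_eq_limCalc,
      ← limCalc_mul _ (φ.hasLimAtInfty_scale h2) (φ.hasLimAtInfty_mul_scale h2), mul_zero]
    congr 1
    ext x
    push_cast
    ring
  rw [e, ← cfc_sqrt_eq_limCalc φ K.selfAdjointRegular h2]
  rfl

lemma LocalizingFunction.hasLimAtInfty_mul_scale_sq {ρ : ℝ} (hρ : 0 < ρ) :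
    HasLimAtInfty (fun x => ((x * φ.scale ρ x ^ 2 : ℝ) : ℂ)) 0 := by
  have h := (φ.hasLimAtInfty_mul_scale hρ).mul (φ.hasLimAtInfty_scale hρ)
  rw [mul_zero] at h
  convert h using 2 with x
  push_cast
  ring

variable {H}

/-- The adjoint reverses γH and Sγ; these products commute, by hypothesis for H and by evenness of φ
for S. -/
lemma localizer_isSelfAdjoint (hH : IsSelfAdjoint H) (hγH : H * K.γ = K.γ * H) {ρ : ℝ}
    (hρ : 0 < ρ) : IsSelfAdjoint (localizer K H φ κ hρ) := by
  have h2 : 0 < 2 * ρ := by positivity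
  have hΦ := isSelfAdjoint_limCalc K.selfAdjointRegular (φ.scale ρ) 0
  have hP := isSelfAdjoint_limCalc K.selfAdjointRegular (fun x => x * φ.scale (2 * ρ) x ^ 2) 0
  have hS := isSelfAdjoint_limCalc K.selfAdjointRegular (φ.complement (2 * ρ)) 1
  rw [ofReal_zero] at hΦ hP
  rw [ofReal_one] at hS
  have hγS := K.γ_mul_limCalc_of_even (φ.hasLimAtInfty_complement h2)
    (fun x => by simp only [LocalizingFunction.complement, φ.scale_neg])
  rw [localizer_eq]
  refine IsSelfAdjoint.sub (IsSelfAdjoint.add ?_ (IsSelfAdjoint.smul (conj_ofReal κ) hP)) ?_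
  · rw [IsSelfAdjoint, mul_assoc _ K.γ H, star_mul, star_mul, star_mul, hΦ.star_eq, hH.star_eq,
      K.γ_selfAdjoint, hγH]
    simp only [mul_assoc]
  · rw [IsSelfAdjoint, star_mul, hS.star_eq, K.γ_selfAdjoint, hγS]

/-- Each commutator term contributes at most ‖H‖ c_φ/(2ρ) ‖δ‖, and the unitary γ leaves κ‖δ‖ for the
last one. The sum is exactly C_{κ,ρ}. -/
lemma norm_localizer_error_le (hH : IsLipschitz K.D H) (hκ : 0 < κ) {ρ : ℝ} (hρ : 0 < ρ) :
    ‖funcCalc K.selfAdjointRegular (φ.scale ρ) * H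
        * (funcCalc K.selfAdjointRegular (φ.scale ρ) * H
          - H * funcCalc K.selfAdjointRegular (φ.scale ρ))
      - (funcCalc K.selfAdjointRegular (φ.scale ρ) * H
          - H * funcCalc K.selfAdjointRegular (φ.scale ρ))
        * (funcCalc K.selfAdjointRegular (φ.scale ρ) * H)
      - (κ : ℂ) • (K.γ * lipDeriv hH)‖ ≤ locConst φ hH κ ρ := by
  have hk := norm_funcCalc_commutator_le K.selfAdjointRegular φ (Classical.choose_spec hH) hρ
  change _ ≤ φ.const / (2 * ρ) * ‖lipDeriv hH‖ at hk
  have hΦ : ‖funcCalc K.selfAdjointRegular (φ.scale ρ)‖ ≤ 1 := by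
    rw [funcCalc_eq_limCalc]
    exact norm_limCalc_le _ (fun x => φ.norm_scaleRe_le ρ x) (by simp)
  set Φ := funcCalc K.selfAdjointRegular (φ.scale ρ)
  set k := φ.const / (2 * ρ) * ‖lipDeriv hH‖ with hkdef
  have hΦH : ‖Φ * H‖ ≤ ‖H‖ := (norm_mul_le _ _).trans
    (mul_le_of_le_one_left (norm_nonneg _) hΦ)
  have hk0 : 0 ≤ k := (norm_nonneg _).trans hk
  calc _ ≤ ‖Φ * H * (Φ * H - H * Φ)‖ + ‖(Φ * H - H * Φ) * (Φ * H)‖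
        + ‖(κ : ℂ) • (K.γ * lipDeriv hH)‖ :=
        (norm_sub_le _ _).trans (by gcongr; exact norm_sub_le _ _)
    _ ≤ ‖H‖ * k + k * ‖H‖ + κ * ‖lipDeriv hH‖ := by
        rw [norm_smul, norm_real, Real.norm_of_nonneg hκ.le, K.norm_γ_mul]
        gcongr
        · exact (norm_mul_le _ _).trans (by gcongr)
        · exact (norm_mul_le _ _).trans (by gcongr)
    _ = locConst φ hH κ ρ := by
        rw [locConst, hkdef]
        field_simp
        ring

/-- The spectral localizer of an admissible pair is invertible. -/
theorem isUnit_localizer (hH : IsSelfAdjoint H) (hu : IsUnit H) (hγH : H * K.γ = K.γ * H)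
    (hlip : IsLipschitz K.D H) {κ ρ : ℝ} (hρ : 0 < ρ) (hadm : Admissible φ hlip κ ρ) :
    IsUnit (localizer K H φ κ hρ) := by
  -- The comparison of L² with a function of D uses the spectral order on 𝕃(X), introduced locally.
  let _ : PartialOrder (Adj A X) := CStarAlgebra.spectralOrder (Adj A X)
  let _ : StarOrderedRing (Adj A X) := CStarAlgebra.spectralOrderedRing (Adj A X)
  obtain ⟨hκ, -, hC⟩ := hadm
  rw [lt_min_iff] at hC
  have h2 : 0 < 2 * ρ := by positivity
  set hD := K.selfAdjointRegular
  have ha := φ.hasLimAtInfty_scale hρ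
  have hb := φ.hasLimAtInfty_mul_scale_sq h2
  have hs := φ.hasLimAtInfty_complement h2
  have hxa := φ.hasLimAtInfty_mul_scale hρ
  have hL := localizer_isSelfAdjoint K φ κ hH hγH hρ
  have hN := norm_localizer_error_le K φ κ hlip hκ hρ
  rw [funcCalc_eq_limCalc] at hN
  have hC0 : 0 ≤ locConst φ hlip κ ρ := (norm_nonneg _).trans hN
  obtain ⟨ε, hε, hε1, hlow⟩ := φ.exists_lower_bound hκ hρ (sq_nonneg (gap H)) hC0 hC.1 hC.2
  rw [localizer_eq] at hL ⊢
  set Φ := limCalc hD (fun x => (φ.scale ρ x : ℂ)) 0 with hΦdef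
  set P := limCalc hD (fun x => ((x * φ.scale (2 * ρ) x ^ 2 : ℝ) : ℂ)) 0 with hPdef
  set S := limCalc hD (fun x => (φ.complement (2 * ρ) x : ℂ)) 1 with hSdef
  have hΦ : IsSelfAdjoint Φ := by
    simpa only [ofReal_zero] using isSelfAdjoint_limCalc hD (φ.scale ρ) 0
  have hP : IsSelfAdjoint P := by
    simpa only [ofReal_zero] using
      isSelfAdjoint_limCalc hD (fun x => x * φ.scale (2 * ρ) x ^ 2) 0
  have hS : IsSelfAdjoint S := by
    simpa only [ofReal_one] using isSelfAdjoint_limCalc hD (φ.complement (2 * ρ)) 1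
  have hsa : ∀ x, φ.complement (2 * ρ) x * φ.scale ρ x = 0 := fun x => by
    rcases φ.scale_eq_zero_or hρ x with h | h <;> simp [LocalizingFunction.complement, h]
  have hba : ∀ x, φ.scale (2 * ρ) x ^ 2 * φ.scale ρ x = φ.scale ρ x := fun x => by
    rcases φ.scale_eq_zero_or hρ x with h | h <;> simp [h]
  have hSΦ : S * Φ = 0 := by
    rw [← limCalc_mul hD hs ha, mul_zero]
    have e : (fun x => (φ.complement (2 * ρ) x : ℂ) * (φ.scale ρ x : ℂ)) = fun _ => 0 := by
      ext x
      rw [← ofReal_mul, hsa, ofReal_zero]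
    rw [e, limCalc_const, zero_smul]
  have hΦS : Φ * S = 0 := by
    have h := congrArg star hSΦ
    rwa [star_mul, hΦ.star_eq, hS.star_eq, star_zero] at h
  have hPΦ : P * Φ = limCalc hD (fun x => x * (φ.scale ρ x : ℂ)) 0 := by
    rw [← limCalc_mul hD hb ha, mul_zero]
    congr 1
    ext x
    rw [← ofReal_mul, mul_assoc, hba, ofReal_mul]
  have hΦP : Φ * P = limCalc hD (fun x => x * (φ.scale ρ x : ℂ)) 0 := by
    rw [← hPΦ, limCalc_comm]
  have hSP : S * P = P * S := limCalc_comm hD _ _ _ _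
  have hsq := localizer_sq (δ := lipDeriv hlip) (κ : ℂ)
    (K.γ_mul_limCalc_of_even ha (fun x => by rw [φ.scale_neg])) hγH K.γ_sq hSΦ hΦS
    (K.γ_mul_limCalc_of_even hs
      (fun x => by simp only [LocalizingFunction.complement, φ.scale_neg])) hPΦ hΦP
    (K.γ_mul_limCalc_of_odd hb (fun x => by rw [φ.scale_neg]; push_cast; ring))
    (K.γ_mul_limCalc_of_odd hxa (fun x => by rw [φ.scale_neg]; push_cast; ring)) hSP
    -- With f = g = φ_ρ this is ΦδΦ = (DΦ)HΦ - ΦH(DΦ), the only point where δ enters the algebra.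
    (limCalc_mul_lipDeriv_mul hD (Classical.choose_spec hlip) ha.continuous hxa ha.continuous hxa)
  have hQ : IsSelfAdjoint (((κ : ℂ) * κ) • (P * P) + S * S) := by
    refine IsSelfAdjoint.add (IsSelfAdjoint.smul ?_ ?_) ?_
    · rw [← ofReal_mul]
      exact conj_ofReal _
    · rw [IsSelfAdjoint, star_mul, hP.star_eq]
    · rw [IsSelfAdjoint, star_mul, hS.star_eq]
  refine isUnit_of_sq_eq hL hΦ hH hu hQ hsq hε hN ?_
  have haa := ha.mul ha
  have hbb := hb.mul hb
  have hss := hs.mul hs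
  have hf := (((HasLimAtInfty.const ((gap H ^ 2 : ℝ) : ℂ)).mul (haa.mul haa)).add
    (((HasLimAtInfty.const ((κ : ℂ) * κ)).mul hbb).add hss)).sub
    ((HasLimAtInfty.const ((locConst φ hlip κ ρ : ℝ) : ℂ)).mul haa)
  have hfun : (fun x => ((gap H ^ 2 * φ.scale ρ x ^ 4
      + (κ ^ 2 * x ^ 2 * φ.scale (2 * ρ) x ^ 4 + (1 - φ.scale (2 * ρ) x ^ 4))
      - locConst φ hlip κ ρ * φ.scale ρ x ^ 2 : ℝ) : ℂ))
      = fun x => ((gap H ^ 2 : ℝ) : ℂ) * ((φ.scale ρ x * φ.scale ρ x : ℂ)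
          * (φ.scale ρ x * φ.scale ρ x))
        + (((κ : ℂ) * κ) * (((x * φ.scale (2 * ρ) x ^ 2 : ℝ) : ℂ)
            * ((x * φ.scale (2 * ρ) x ^ 2 : ℝ) : ℂ))
          + (φ.complement (2 * ρ) x : ℂ) * (φ.complement (2 * ρ) x : ℂ))
        - ((locConst φ hlip κ ρ : ℝ) : ℂ) * (φ.scale ρ x * φ.scale ρ x : ℂ) := by
    ext x
    rw [← ofReal_mul (φ.complement _ _), φ.complement_sq]
    push_cast
    ring
  -- At infinity every term vanishes except S², which contributes 1; hence the requirement ε ≤ 1.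
  have hlim : ((gap H ^ 2 : ℝ) : ℂ) * (0 * 0 * (0 * 0)) + ((κ : ℂ) * κ * (0 * 0) + 1 * 1)
      - ((locConst φ hlip κ ρ : ℝ) : ℂ) * (0 * 0) = ((1 : ℝ) : ℂ) := by simp
  rw [hlim, ← hfun] at hf
  refine (smul_one_le_limCalc hD hf hlow hε1).trans_eq ?_
  rw [hfun, ← hlim, limCalc_sub hD
      (((HasLimAtInfty.const _).mul (haa.mul haa)).add (((HasLimAtInfty.const _).mul hbb).add hss))
      ((HasLimAtInfty.const _).mul haa),
    limCalc_add hD ((HasLimAtInfty.const _).mul (haa.mul haa))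
      (((HasLimAtInfty.const _).mul hbb).add hss),
    limCalc_add hD ((HasLimAtInfty.const _).mul hbb) hss,
    limCalc_smul hD _ (haa.mul haa), limCalc_smul hD _ hbb, limCalc_smul hD _ haa,
    limCalc_mul hD haa haa, limCalc_mul hD ha ha, limCalc_mul hD hb hb, limCalc_mul hD hs hs,
    Complex.coe_smul, Complex.coe_smul]
  rfl

end LocalizerInvertible

/-! ### The class in relative K-theory and sufficient conditions for admissibility. -/

section LocalizerClass

variable {A X : Type*} [NonUnitalCStarAlgebra A] [PartialOrder A] [StarOrderedRing A]
  [NormedAddCommGroup X] [NormedSpace ℂ X] [SMul A X] [CStarModule A X] [CompleteSpace X]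

/-- Compactly supported functions of an operator with compact resolvent are compact. -/
lemma limCalc_mem_compactOps {D : X →ₗ.[ℂ] X} {hD : IsSelfAdjointRegular A D}
    (hK : resolvent hD ∈ (compactOps A X).toSubmodule) {f : ℝ → ℝ} (hf : Continuous f)
    (hc : HasCompactSupport f) :
    limCalc hD (fun x => (f x : ℂ)) 0 ∈ (compactOps A X).toSubmodule := by
  have hxf := HasLimAtInfty.of_hasCompactSupport (f := fun x => x * f x) (by fun_prop) hc.mul_left
  simp only [ofReal_mul] at hxf
  exact limCalc_zero_mem_compactOps hD hK (by fun_prop) hxf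

/-- The leading -γ cancels against Sγ up to (S - 1)γ, so only terms with a factor in the ideal
remain. -/
lemma neg_sub_localizer_mem {L : Type*} [CStarAlgebra L] (𝔞 : ClosedStarIdeal L)
    (γ H : L) (κ : ℂ) {Φ P S : L} (hΦ : Φ ∈ 𝔞.toSubmodule) (hP : P ∈ 𝔞.toSubmodule)
    (hS : S - 1 ∈ 𝔞.toSubmodule) :
    -γ - (Φ * γ * H * Φ + κ • P - S * γ) ∈ 𝔞.toSubmodule := by
  have h : -γ - (Φ * γ * H * Φ + κ • P - S * γ)
      = (S - 1) * γ - (Φ * γ * H * Φ + κ • P) := by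
    rw [sub_mul, one_mul]
    abel
  have m1 : (S - 1) * γ ∈ 𝔞.toSubmodule := 𝔞.mul_mem_right' γ hS
  have m2 : Φ * γ * H * Φ ∈ 𝔞.toSubmodule := 𝔞.mul_mem_left' (Φ * γ * H) hΦ
  rw [h]
  exact 𝔞.toSubmodule.sub_mem m1 (𝔞.toSubmodule.add_mem m2 (𝔞.toSubmodule.smul_mem κ hP))

lemma neg_γ_sub_localizer_mem (K : EvenKasparovModule A X) (φ : LocalizingFunction)
    (H : Adj A X) (κ : ℝ) {ρ : ℝ} (hρ : 0 < ρ) :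
    -K.γ - localizer K H φ κ hρ ∈ (compactOps A X).toSubmodule := by
  have h2 : 0 < 2 * ρ := by positivity
  have hcr := K.compact_resolvent
  have ha := limCalc_mem_compactOps hcr (φ.continuous_scale ρ) (φ.hasCompactSupport_scale hρ)
  have hcont := φ.continuous_scale (2 * ρ)
  have hPc : HasCompactSupport (fun x => x * φ.scale (2 * ρ) x ^ 2) :=
    HasCompactSupport.mul_left
      ((φ.hasCompactSupport_scale h2).comp_left (g := fun y => y ^ 2) (by simp))
  -- The function y ↦ √(1 - y⁴) - 1 vanishes at 0, so the support stays inside that of φ_{2ρ}.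
  have hSc : HasCompactSupport (fun x => φ.complement (2 * ρ) x - 1) :=
    (φ.hasCompactSupport_scale h2).comp_left (g := fun y => √(1 - y ^ 4) - 1) (by simp)
  have hScont : Continuous (fun x => φ.complement (2 * ρ) x - 1) := by
    unfold LocalizingFunction.complement
    fun_prop
  have hP := limCalc_mem_compactOps hcr (by fun_prop) hPc
  have hS := limCalc_mem_compactOps hcr hScont hSc
  have e : limCalc K.selfAdjointRegular (fun x => ((φ.complement (2 * ρ) x - 1 : ℝ) : ℂ)) 0
      = limCalc K.selfAdjointRegular (fun x => (φ.complement (2 * ρ) x : ℂ)) 1 - 1 := by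
    rw [← one_smul ℂ (1 : Adj A X), ← limCalc_const K.selfAdjointRegular,
      ← limCalc_sub _ (φ.hasLimAtInfty_complement h2) (.const 1), sub_self]
    simp only [ofReal_sub, ofReal_one]
  rw [e] at hS
  rw [localizer_eq]
  exact neg_sub_localizer_mem (compactOps A X) _ _ _ ha hP hS

/-- A pair of a selfadjoint unitary and a selfadjoint invertible element that agree modulo `𝔞`
defines an element of `W₁(L, 𝔞)`. -/
lemma exists_W_one {L : Type*} [CStarAlgebra L] (𝔞 : ClosedStarIdeal L) {u x : L}
    (hu : IsSelfAdjoint u) (huu : u * u = 1) (hx : IsSelfAdjoint x) (hxu : IsUnit x)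
    (h : u - x ∈ 𝔞.toSubmodule) : ∃ w : W 𝔞 1, (w.1 0 0 : L × L) = (u, x) := by
  obtain ⟨v, rfl⟩ := hxu
  -- Invertibility in the double requires the two inverses to agree modulo the ideal; u is its own
  -- inverse.
  have hinv : u - (↑v⁻¹ : L) ∈ 𝔞.toSubmodule := by
    have e : u - (↑v⁻¹ : L) = -(u * (u - v) * (↑v⁻¹ : L)) := by
      rw [mul_sub, sub_mul, huu, one_mul, mul_assoc, v.mul_inv, mul_one, neg_sub]
    rw [e]
    exact Submodule.neg_mem _ (𝔞.mul_mem_right' _ (𝔞.mul_mem_left' _ h))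
  let a : relDouble 𝔞 := ⟨(u, (v : L)), h⟩
  let b : relDouble 𝔞 := ⟨(u, (↑v⁻¹ : L)), hinv⟩
  have hab : a * b = 1 := Subtype.ext (Prod.ext huu v.mul_inv)
  have hba : b * a = 1 := Subtype.ext (Prod.ext huu v.inv_mul)
  have hsa : star a = a := Subtype.ext (Prod.ext hu hx)
  refine ⟨⟨Matrix.scalar (Fin 1) a, ?_, ?_⟩, rfl⟩
  · change Matrix.conjTranspose _ = _
    rw [Matrix.scalar_apply, Matrix.diagonal_conjTranspose]
    congr 1
    ext1 i
    exact hsa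
  · exact IsUnit.map (Matrix.scalar (Fin 1)) (⟨⟨a, b, hab, hba⟩, rfl⟩ : IsUnit a)

lemma W.ext_one {L : Type*} [CStarAlgebra L] {𝔞 : ClosedStarIdeal L} {w w' : W 𝔞 1}
    (h : (w.1 0 0 : L × L) = (w'.1 0 0 : L × L)) : w = w' := by
  refine Subtype.ext (Matrix.ext fun i j => ?_)
  rw [Subsingleton.elim i 0, Subsingleton.elim j 0]
  exact Subtype.ext h

/-- The third condition is C_{κ,ρ} < g² solved for ρ. The second gives κ²ρ²/4 ≥ g², so g² is the
smaller entry of the minimum. -/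
lemma admissible_of_lt (φ : LocalizingFunction) {D : X →ₗ.[ℂ] X} {H : Adj A X}
    (hH : IsLipschitz D H) {κ ρ : ℝ} (hκ : 0 < κ) (hρ : 0 < ρ)
    (h1 : κ * ‖lipDeriv hH‖ < gap H ^ 2) (h2 : 2 * gap H / κ ≤ ρ)
    (h3 : φ.const * ‖H‖ * ‖lipDeriv hH‖ / (gap H ^ 2 - κ * ‖lipDeriv hH‖) < ρ) :
    Admissible φ hH κ ρ := by
  have h4 : locConst φ hH κ ρ < gap H ^ 2 := by
    rw [div_lt_iff₀ (by linarith)] at h3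
    have h5 : φ.const * ‖H‖ / ρ * ‖lipDeriv hH‖ < gap H ^ 2 - κ * ‖lipDeriv hH‖ := by
      rw [div_mul_eq_mul_div, div_lt_iff₀ hρ]
      linarith
    rw [locConst]
    linarith
  have hg : 0 ≤ gap H := inv_nonneg.2 (norm_nonneg _)
  have h6 : gap H ≤ κ * ρ / 2 := by
    rw [div_le_iff₀ hκ] at h2
    linarith
  refine ⟨hκ, hρ, lt_min h4 (h4.trans_le ?_)⟩
  calc gap H ^ 2 ≤ (κ * ρ / 2) ^ 2 := by gcongr
    _ = κ ^ 2 * ρ ^ 2 / 4 := by ring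

end LocalizerClass

end SpecLoc

theorem propositionp {B X : Type*} [NonUnitalCStarAlgebra B] [PartialOrder B] [StarOrderedRing B]
    (hB : IsSigmaUnital B)
    -- `X` is a right Hilbert C⋆-module over `B`: the right action is that of `Bᵐᵒᵖ`
    [NormedAddCommGroup X] [NormedSpace ℂ X] [CompleteSpace X] [SMul Bᵐᵒᵖ X] [CStarModule Bᵐᵒᵖ X]
    (K : EvenKasparovModule Bᵐᵒᵖ X) (φ : LocalizingFunction)
    (H : Adj Bᵐᵒᵖ X) (H_selfAdjoint : IsSelfAdjoint H) (H_invertible : IsUnit H)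
    (H_even : H * K.γ = K.γ * H) (H_lip : IsLipschitz K.D H) :
    (∀ (κ ρ : ℝ) (_ : 0 < κ) (hρ : 0 < ρ), Admissible φ H_lip κ ρ →
      IsUnit (localizer K H φ κ hρ) ∧
      ∃! c : K0inv (compactOps Bᵐᵒᵖ X), ∃ w : W (compactOps Bᵐᵒᵖ X) 1,
        (w.1 0 0 : Adj Bᵐᵒᵖ X × Adj Bᵐᵒᵖ X) = (-K.γ, localizer K H φ κ hρ) ∧ K0inv.mk w = c) ∧
    (∀ κ ρ : ℝ, 0 < κ → 0 < ρ → κ * ‖lipDeriv H_lip‖ < gap H ^ 2 → 2 * gap H / κ ≤ ρ →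
      φ.const * ‖H‖ * ‖lipDeriv H_lip‖ / (gap H ^ 2 - κ * ‖lipDeriv H_lip‖) < ρ →
      Admissible φ H_lip κ ρ) := by
  refine ⟨fun κ ρ _ hρ hadm => ?_, fun κ ρ hκ hρ => admissible_of_lt φ H_lip hκ hρ⟩
  have hunit := isUnit_localizer K φ H_selfAdjoint H_invertible H_even H_lip hρ hadm
  obtain ⟨w, hw⟩ := exists_W_one (compactOps Bᵐᵒᵖ X)
    (u := -K.γ) (IsSelfAdjoint.neg K.γ_selfAdjoint) (by rw [neg_mul_neg, K.γ_sq])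
    (localizer_isSelfAdjoint K φ κ H_selfAdjoint H_even hρ) hunit
    (neg_γ_sub_localizer_mem K φ H κ hρ)
  -- Uniqueness of the class: a 1×1 matrix over the double is determined by its single entry, so any
  -- other representative equals w.
  refine ⟨hunit, K0inv.mk w, ⟨w, hw, rfl⟩, ?_⟩
  rintro _ ⟨w', hw', rfl⟩
  rw [W.ext_one (hw'.trans hw.symm)]
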